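/- **Theorem (Very weak confinement).** Let $\chi>0$ and let $V:[0,\infty)\to[0,\infty)$ be a continuous function with $V(1)=0$ and $V(r)\ge\max\{0,\log r\}$ for every $r\ge 0$ (a *circle potential*). Suppose that there exists $R\ge 1$ such that $$V(r)=\log r\ \text{ for every } r\ge R\qquad\text{and}\qquad V(r)>\log r\ \text{ for every } r\in(1,R).$$ For every $n$ let $(x_1^{(n)},\dots,x_n^{(n)})$ be distributed according to the probability measure on $\mathbb C^n$ proportional to $$\prod_{i<j}|x_i-x_j|^2\, e^{-2(n+\chi)\sum_{i=1}^n V(|x_i|)}\,d\ell_{\mathbb C}(x_1)\cdots d\ell_{\mathbb C}(x_n),$$ where $\ell_{\mathbb C}$ is Lebesgue measure on $\mathbb C$ (the total mass of this density is positive and finite). Then there is a determinantal point process $\mathbb B^R$ on $\{z\in\mathbb C:|z|>R\}$ associated to Lebesgue measure and to the kernel $$K_{\mathbb B^R}(z,w)=\frac{1}{\pi|z\bar w|^{\chi+1}}\sum_{k=0}^\infty\frac{(k+\chi)R^{2k+2\chi}}{(z\bar w)^k},$$ and, for any such process, $$\{x_k^{(n)}:k\in\{1,\dots,n\},\ |x_k^{(n)}|>R\}\longrightarrow\mathbb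 B^R\qquad(n\to\infty)$$ in law, as random point configurations (integer-valued measures that are finite on compact sets) on $\{z\in\mathbb C:|z|>R\}$ with the vague topology. Furthermore, almost surely $\max\{|z|:z\in\mathbb B^R\}$ exists, and $\max\{|x_1^{(n)}|,\dots,|x_n^{(n)}|\}$ converges in law to it. More explicitly, $$\lim_{n\to\infty}\mathbb P\left(\max\{|x_1^{(n)}|,\dots,|x_n^{(n)}|\}\le t\right)=\prod_{k=0}^\infty\left(1-(R/t)^{2k+2\chi}\right)\qquad\text{for every } t\ge R.$$ -/

import Mathlib

open MeasureTheory ProbabilityTheory Filter Topology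
open scoped ENNReal

noncomputable section

/-- A circle potential: a continuous function `V : [0, ∞) → [0, ∞)` with `V 1 = 0` and
`V r ≥ max {0, log r}`. Only the values of `V` on `[0, ∞)` matter. At `r = 0` the second bound
is void (`log 0 = -∞`), and Lean's value `Real.log 0 = 0` gives the same condition. -/
structure IsCirclePotential (V : ℝ → ℝ) : Prop where
  continuousOn : ContinuousOn V (Set.Ici 0)
  at_one : V 1 = 0
  lower_bound : ∀ r, 0 ≤ r → max 0 (Real.log r) ≤ V r

/-- The unnormalized density
`∏_{i<j} |x_i - x_j|² exp (-2 (n + χ) ∑_i V(|x_i|))` of the radial determinantal Coulomb gas. -/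
def coulombDensity (V : ℝ → ℝ) (χ : ℝ) (n : ℕ) (x : Fin n → ℂ) : ℝ :=
  (∏ i : Fin n, ∏ j ∈ Finset.Ioi i, ‖x i - x j‖ ^ 2) *
    Real.exp (-2 * (n + χ) * ∑ i : Fin n, V ‖x i‖)

/-- The law of the `n` particles `(x_1, …, x_n)`: the measure on `ℂⁿ` proportional to
`coulombDensity V χ n` times Lebesgue measure, with total mass normalized to one. -/
def coulombGas (V : ℝ → ℝ) (χ : ℝ) (n : ℕ) : Measure (Fin n → ℂ) :=
  (∫⁻ x : Fin n → ℂ, ENNReal.ofReal (coulombDensity V χ n x))⁻¹ •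
    (volume : Measure (Fin n → ℂ)).withDensity
      (fun x => ENNReal.ofReal (coulombDensity V χ n x))

/-- Point configurations on `X`, seen as counting measures: measures that take values in
`{0, 1, 2, …, ∞}` and are finite on compact sets. -/
structure PointConfig (X : Type*) [TopologicalSpace X] [MeasurableSpace X] where
  toMeasure : Measure X
  finite_of_isCompact : ∀ K : Set X, IsCompact K → toMeasure K < ∞
  integer_valued : ∀ s : Set X, MeasurableSet s → ∃ m : ℕ∞, toMeasure s = (m : ℝ≥0∞)

namespace PointConfig

variable {X : Type*} [TopologicalSpace X] [MeasurableSpace X]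

/-- The vague topology: the coarsest one for which `ξ ↦ ∑_{x ∈ ξ} f x` is continuous for every
continuous compactly supported `f`. -/
instance : TopologicalSpace (PointConfig X) :=
  TopologicalSpace.induced
    (fun ξ (f : CompactlySupportedContinuousMap X ℝ) => ∫ x, f x ∂ξ.toMeasure) inferInstance

instance : MeasurableSpace (PointConfig X) := borel _

instance : BorelSpace (PointConfig X) := ⟨rfl⟩

end PointConfig

/-- `P` is the law of a determinantal point process on `X` associated to the reference measure `μ`
and to the kernel `K`: the process is almost surely simple and, for every `m`,
`det (K (x_i, x_j))_{i,j ≤ m}` is its `m`-th correlation function, i.e. it is nonnegative and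
`𝔼 [#(ξ ∩ A_1) ⋯ #(ξ ∩ A_m)] = ∫_{A_1 × ⋯ × A_m} det (K (x_i, x_j)) dμ^m`
for pairwise disjoint measurable sets `A_1, …, A_m`. -/
structure IsDeterminantal {X : Type*} [TopologicalSpace X] [MeasurableSpace X]
    (P : Measure (PointConfig X)) (μ : Measure X) (K : X → X → ℂ) : Prop where
  measurable_kernel : Measurable (Function.uncurry K)
  simple : ∀ᵐ ξ ∂P, ∀ x : X, ξ.toMeasure {x} ≤ 1
  det_nonneg : ∀ m : ℕ, ∀ᵐ x ∂(Measure.pi fun _ : Fin m => μ),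
    (Matrix.of fun i j => K (x i) (x j)).det.im = 0 ∧
      0 ≤ (Matrix.of fun i j => K (x i) (x j)).det.re
  correlation : ∀ (m : ℕ) (A : Fin m → Set X), (∀ i, MeasurableSet (A i)) →
    Pairwise (Function.onFun Disjoint A) →
    ∫⁻ ξ, ∏ i, ξ.toMeasure (A i) ∂P =
      ∫⁻ x in Set.univ.pi A, ENNReal.ofReal (Matrix.of fun i j => K (x i) (x j)).det.re
        ∂(Measure.pi fun _ : Fin m => μ)

/-- The complement in `ℂ` of the closed disk of radius `R` centered at zero. -/
def Exterior (R : ℝ) : Set ℂ := {z | R < ‖z‖}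

theorem measurableSet_exterior (R : ℝ) : MeasurableSet (Exterior R) :=
  (isOpen_lt continuous_const continuous_norm).measurableSet

theorem sum_dirac_apply_eq_natCast {n : ℕ} (x : Fin n → ℂ) {s : Set ℂ} (hs : MeasurableSet s) :
    ∃ m : ℕ, (∑ k, Measure.dirac (x k)) s = (m : ℝ≥0∞) := by
  classical
  refine ⟨∑ k, if x k ∈ s then 1 else 0, ?_⟩
  simp only [Measure.coe_finsetSum, Finset.sum_apply, Measure.dirac_apply' _ hs,
    Set.indicator_apply, Pi.one_apply]
  push_cast
  rfl

/-- The configuration `{x_k : |x_k| > R}` of the particles outside the closed disk of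
radius `R`. -/
def outerConfig (R : ℝ) {n : ℕ} (x : Fin n → ℂ) : PointConfig (Exterior R) where
  toMeasure := (∑ k, Measure.dirac (x k)).comap Subtype.val
  finite_of_isCompact := by
    intro K hK
    have hme := MeasurableEmbedding.subtype_coe (measurableSet_exterior R)
    obtain ⟨m, hm⟩ := sum_dirac_apply_eq_natCast x (hme.measurableSet_image.2 hK.measurableSet)
    rw [hme.comap_apply, hm]
    exact ENNReal.natCast_lt_top m
  integer_valued := by
    intro s hs
    have hme := MeasurableEmbedding.subtype_coe (measurableSet_exterior R)
    obtain ⟨m, hm⟩ := sum_dirac_apply_eq_natCast x (hme.measurableSet_image.2 hs)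
    exact ⟨m, by rw [hme.comap_apply, hm]; simp⟩

/-- Lebesgue measure on the complement of the closed disk of radius `R`. -/
def lebesgueExterior (R : ℝ) : Measure (Exterior R) :=
  (volume : Measure ℂ).comap Subtype.val

/-- The kernel
`K(z, w) = 1 / (π |z w̄|^(χ+1)) ∑_{k ≥ 0} (k + χ) R^(2k+2χ) / (z w̄)^k`. -/
def kernelB (χ R : ℝ) (z w : Exterior R) : ℂ :=
  ((1 / (Real.pi * ‖(z : ℂ) * star (w : ℂ)‖ ^ (χ + 1)) : ℝ) : ℂ) *
    ∑' k : ℕ, (((k + χ) * R ^ (2 * (k : ℝ) + 2 * χ) : ℝ) : ℂ) / ((z : ℂ) * star (w : ℂ)) ^ k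

/-- The set of moduli of the points of a configuration. -/
def moduli {R : ℝ} (ξ : PointConfig (Exterior R)) : Set ℝ :=
  {r | ∃ z : Exterior R, ξ.toMeasure {z} ≠ 0 ∧ ‖(z : ℂ)‖ = r}

/-- `max {|x_1|, …, |x_n|}` (and `0` for `n = 0`). -/
def maxModulus {n : ℕ} (x : Fin n → ℂ) : ℝ := ⨆ k, ‖x k‖

end

/-! The gas is an orthogonal polynomial ensemble. Up to normalisation its density is the squared
modulus of the Slater determinant of the functions z^k e^{-(n+χ)V(|z|)}, k < n, which are orthogonal
because the weight is radial. Andréief's identity then expresses the factorial moments of the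
particles as determinants of the projection kernel `kernelN` (`integral_sum_embedding_mul_det`).

For |z| ≥ R one has V = log, so the monomial of degree n-1-k has weight |z|^{-2(k+χ)-2}, whatever n
is. Almost everywhere in the disk |z| ≤ R one has V > log, and the weight tends to zero. Hence the
mass of this monomial tends to `tailMass χ k R` and never lies below it
(`IsCirclePotential.tendsto_monomialMass`, `IsCirclePotential.tailMass_le_monomialMass`). With
degrees counted from the top and a unimodular cocycle removed, `kernelN` becomes a series that
converges to `kernelB` by dominated convergence (`tendsto_kernelT`). Hadamard's inequality bounds
all the determinants by products of a density that does not depend on n and has finite mass at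
positive distance from the disk (`det_kernelN_re_le`).

Convergence of correlations becomes convergence in law in `PointConfig.le_liminf_measure_of_isOpen`.
A vaguely open set is approximated from inside by events that prescribe which small cells of a
compact window are occupied. As long as no cell has two points, the indicator of such an event is a
multilinear polynomial in the counts of disjoint cells, and the expectation of this polynomial is a
combination of correlations, which converges. Multiple occupation is negligible, uniformly in n,
because the dominating intensity has no atoms.

For the maximum, the monomials stay orthogonal on a disk of radius t, so the probability that all
moduli are at most t is the product of the fractions of the masses inside that disk
(`coulombGas_forall_norm_le`); its limit is the infinite product. The void probabilities of the
limiting process follow from the convergence in law, since meeting an open set and avoiding a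
compact set are open conditions. Letting t decrease to R shows that the process is almost surely
nonempty. It has finitely many points at positive distance from the disk, hence a point of maximal
modulus.

The limiting process itself is built by compactness. Labelling the outer particles by an annulus and
a rank turns each gas into a law on ℂ^{ℕ×ℕ}. These laws are tight, and a subsequential limit has the
required correlations (`familyCorr_eq_corrB`) because tuples with large ranks carry little mass.
Simplicity holds because the second correlation function vanishes on the diagonal. -/

noncomputable section

set_option linter.unusedSectionVars false

/-! ### Hadamard's inequality and Andréief's identity. -/

section Determinants

open Matrix ComplexConjugate
open scoped ComplexOrder

/-- A Hadamard inequality: the determinant of a positive semidefinite matrix is at most the product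
of any positive upper bounds of its diagonal entries. -/
theorem Matrix.PosSemidef.det_re_le_prod {m : ℕ} {M : Matrix (Fin m) (Fin m) ℂ}
    (hM : M.PosSemidef) {d : Fin m → ℝ} (hd : ∀ i, 0 < d i) (hMd : ∀ i, (M i i).re ≤ d i) :
    M.det.re ≤ ∏ i, d i := by
  -- Scaling row and column i by d_i^{-1/2} reduces the claim to a matrix with diagonal entries at
  -- most one.
  set s : Fin m → ℂ := fun i => ((Real.sqrt (d i))⁻¹ : ℝ) with hs
  have hN : (diagonal s * M * (diagonal s)ᴴ).PosSemidef := hM.mul_mul_conjTranspose_same _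
  set N := diagonal s * M * (diagonal s)ᴴ with hNdef
  have hstar : (diagonal s)ᴴ = diagonal s := by
    rw [diagonal_conjTranspose]; congr 1; ext i; simp [hs]
  have hsd : ∀ i, s i * s i = ((d i)⁻¹ : ℝ) := by
    intro i
    simp only [hs]
    rw [← Complex.ofReal_mul, ← mul_inv, Real.mul_self_sqrt (hd i).le]
  have hNii : ∀ i, (N i i).re ≤ 1 := by
    intro i
    have : N i i = ((d i)⁻¹ : ℝ) * M i i := by
      rw [hNdef, hstar, mul_diagonal, diagonal_mul, ← hsd i]; ring
    rw [this, Complex.re_ofReal_mul, inv_mul_le_iff₀ (hd i)]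
    simpa using hMd i
  have hdet : N.det = ((∏ i, d i)⁻¹ : ℝ) * M.det := by
    rw [hNdef, hstar, det_mul, det_mul, det_diagonal, mul_right_comm, ← Finset.prod_mul_distrib]
    simp_rw [hsd]
    push_cast
    rw [Finset.prod_inv_distrib]
  have hle : N.det.re ≤ 1 := by
    have h1 := hN.1.det_eq_prod_eigenvalues
    have h2 := hN.1.trace_eq_sum_eigenvalues
    have h3 : (∑ i, hN.1.eigenvalues i) ≤ m := by
      have : (∑ i, hN.1.eigenvalues i) = N.trace.re := by rw [h2]; simp
      rw [this, Matrix.trace, Complex.re_sum]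
      calc ∑ i, (N.diag i).re ≤ ∑ i : Fin m, (1 : ℝ) := Finset.sum_le_sum fun i _ => hNii i
        _ = m := by simp
    have h4 : N.det.re = ∏ i, hN.1.eigenvalues i := by
      rw [h1]; exact (congrArg Complex.re (Complex.ofReal_prod _ _).symm).trans (Complex.ofReal_re _)
    rw [h4]
    -- The arithmetic-geometric inequality in the form λ ≤ e^{λ-1}: the product of the eigenvalues
    -- is at most the exponential of the trace minus m.
    calc ∏ i, hN.1.eigenvalues i ≤ ∏ i, Real.exp (hN.1.eigenvalues i - 1) :=
          Finset.prod_le_prod (fun i _ => hN.eigenvalues_nonneg i)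
            (fun i _ => by have := Real.add_one_le_exp (hN.1.eigenvalues i - 1); linarith)
      _ = Real.exp (∑ i, hN.1.eigenvalues i - m) := by
          rw [← Real.exp_sum, Finset.sum_sub_distrib]; simp
      _ ≤ 1 := by rw [Real.exp_le_one_iff]; linarith
  rw [hdet, Complex.re_ofReal_mul, inv_mul_le_iff₀ (Finset.prod_pos fun i _ => hd i)] at hle
  simpa using hle

theorem Equiv.Perm.viaFintypeEmbedding_injective {α β : Type*} [Fintype α] [DecidableEq β]
    (f : α ↪ β) : Function.Injective fun π : Equiv.Perm α => π.viaFintypeEmbedding f := by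
  intro π π' h
  ext a
  apply f.injective
  have := congrArg (fun ρ : Equiv.Perm β => ρ (f a)) h
  simpa using this

theorem Equiv.Perm.exists_viaFintypeEmbedding_eq {α β : Type*} [Fintype α] [DecidableEq β]
    (f : α ↪ β) {ρ : Equiv.Perm β} (h : ∀ b, b ∉ Set.range f → ρ b = b) :
    ∃ π : Equiv.Perm α, π.viaFintypeEmbedding f = ρ := by
  have hmem : ∀ b, ρ b ∈ Set.range f ↔ b ∈ Set.range f := by
    intro b
    symm
    constructor
    · intro hb
      by_contra hc
      have := h _ hc
      rw [ρ.injective this] at hc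
      exact hc hb
    · intro hb
      by_contra hc
      rw [h _ hc] at hb
      exact hc hb
  refine ⟨(Equiv.ofInjective f f.injective).permCongr.symm (ρ.subtypePerm hmem), ?_⟩
  ext b
  by_cases hb : b ∈ Set.range f
  · obtain ⟨a, rfl⟩ := hb
    rw [Equiv.Perm.viaFintypeEmbedding_apply_image]
    simp only [Equiv.permCongr_symm_apply]
    have := Equiv.apply_ofInjective_symm f.injective
      (ρ.subtypePerm hmem (Equiv.ofInjective f f.injective a))
    rw [this]
    simp
  · rw [Equiv.Perm.viaFintypeEmbedding_apply_notMem_range _ _ hb, h b hb]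

variable {m n : ℕ}

/-- Write τ = σρ. A factor with index l outside the range of f vanishes unless ρ fixes l, so only
those ρ survive that come from a permutation π of `Fin m`, and the two signs multiply to the sign of
π. -/
theorem sum_perm_perm_eq_sum_perm_fixing (A : Fin m → Fin n → Fin n → ℂ) (f : Fin m ↪ Fin n)
    (B : Fin n → Fin n → Fin n → ℂ) (hB : ∀ i, B (f i) = A i)
    (hB' : ∀ l, l ∉ Set.range f → ∀ j k, B l j k = if j = k then 1 else 0) :
    ∑ σ : Equiv.Perm (Fin n), ∑ τ : Equiv.Perm (Fin n),
      ((Equiv.Perm.sign σ : ℤ) : ℂ) * ((Equiv.Perm.sign τ : ℤ) : ℂ) * ∏ l, B l (σ l) (τ l) =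
    ∑ σ : Equiv.Perm (Fin n), ∑ π : Equiv.Perm (Fin m),
      ((Equiv.Perm.sign π : ℤ) : ℂ) * ∏ i, A i (σ (f i)) (σ (f (π i))) := by
  refine Finset.sum_congr rfl fun σ _ => ?_
  rw [← Equiv.sum_comp (Equiv.mulLeft σ)]
  symm
  refine Fintype.sum_of_injective (fun π : Equiv.Perm (Fin m) => π.viaFintypeEmbedding f)
    (Equiv.Perm.viaFintypeEmbedding_injective f) _ _ ?_ ?_
  · intro ρ hρ
    obtain ⟨b, hb, hne⟩ : ∃ b, b ∉ Set.range f ∧ ρ b ≠ b := by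
      by_contra hc
      push Not at hc
      exact hρ (Equiv.Perm.exists_viaFintypeEmbedding_eq f hc)
    rw [Finset.prod_eq_zero (Finset.mem_univ b), mul_zero]
    rw [hB' b hb, if_neg]
    simpa using hne.symm
  · intro π
    have hs : ((Equiv.Perm.sign σ : ℤ) : ℂ) *
        ((Equiv.Perm.sign (σ * π.viaFintypeEmbedding f) : ℤ) : ℂ) = (Equiv.Perm.sign π : ℤ) := by
      rw [Equiv.Perm.sign_mul, Equiv.Perm.viaFintypeEmbedding_sign]
      rcases Int.units_eq_one_or (Equiv.Perm.sign σ) with h | h <;> simp [h]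
    simp only [Equiv.coe_mulLeft]
    rw [hs]
    congr 1
    refine Fintype.prod_of_injective f f.injective _ _ ?_ ?_
    · intro l hl
      rw [hB' l hl, if_pos]
      simp [Equiv.Perm.viaFintypeEmbedding_apply_notMem_range _ _ hl]
    · intro i
      simp [hB]

/-- Composition with σ permutes the embeddings, so σ drops out. Maps g that are not injective may be
added freely, because their sum over π is a determinant with two equal rows. -/
theorem sum_embedding_sum_perm_comp (A : Fin m → Fin n → Fin n → ℂ) (σ : Equiv.Perm (Fin n)) :
    ∑ f : Fin m ↪ Fin n, ∑ π : Equiv.Perm (Fin m),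
      ((Equiv.Perm.sign π : ℤ) : ℂ) * ∏ i, A i (σ (f i)) (σ (f (π i))) =
    ∑ g : Fin m → Fin n, ∑ π : Equiv.Perm (Fin m),
      ((Equiv.Perm.sign π : ℤ) : ℂ) * ∏ i, A i (g i) (g (π i)) := by
  rw [← Equiv.sum_comp (Equiv.embeddingCongr (Equiv.refl (Fin m)) σ.symm)]
  refine Fintype.sum_of_injective (fun f : Fin m ↪ Fin n => (f : Fin m → Fin n))
    DFunLike.coe_injective _ _ ?_ ?_
  · intro g hg
    have hni : ¬ Function.Injective g := fun h => hg ⟨⟨g, h⟩, rfl⟩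
    rw [Function.Injective] at hni
    push Not at hni
    obtain ⟨a, b, hab, hne⟩ := hni
    have : (Matrix.of fun j i => A i (g i) (g j)).det = 0 :=
      Matrix.det_zero_of_row_eq hne (by ext i; simp [hab])
    rw [← this, Matrix.det_apply]
    simp [Units.smul_def]
  · intro f
    simp

variable {Ω : Type*} [MeasurableSpace Ω] {ν : Measure Ω} [SigmaFinite ν]

/-- Andréief's identity, with a test function for each variable. -/
theorem integral_prod_mul_det_mul_conj_det (φ : Fin n → Ω → ℂ) (G : Fin n → Ω → ℂ)
    (hG : ∀ l j k, Integrable (fun z => G l z * (φ j z * conj (φ k z))) ν) :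
    Integrable (fun x : Fin n → Ω => (∏ l, G l (x l)) * ((Matrix.of fun k i => φ k (x i)).det *
        conj (Matrix.of fun k i => φ k (x i)).det)) (Measure.pi fun _ => ν) ∧
    ∫ x : Fin n → Ω, (∏ l, G l (x l)) * ((Matrix.of fun k i => φ k (x i)).det *
        conj (Matrix.of fun k i => φ k (x i)).det) ∂(Measure.pi fun _ => ν) =
      ∑ σ : Equiv.Perm (Fin n), ∑ τ : Equiv.Perm (Fin n),
        ((Equiv.Perm.sign σ : ℤ) : ℂ) * ((Equiv.Perm.sign τ : ℤ) : ℂ) *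
          ∏ l, ∫ z, G l z * (φ (σ l) z * conj (φ (τ l) z)) ∂ν := by
  have key : ∀ x : Fin n → Ω, (∏ l, G l (x l)) * ((Matrix.of fun k i => φ k (x i)).det *
        conj (Matrix.of fun k i => φ k (x i)).det) =
      ∑ σ : Equiv.Perm (Fin n), ∑ τ : Equiv.Perm (Fin n),
        ((Equiv.Perm.sign σ : ℤ) : ℂ) * ((Equiv.Perm.sign τ : ℤ) : ℂ) *
          ∏ l, G l (x l) * (φ (σ l) (x l) * conj (φ (τ l) (x l))) := by
    intro x
    rw [Matrix.det_apply, map_sum, Finset.sum_mul_sum, Finset.mul_sum]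
    refine Finset.sum_congr rfl fun σ _ => ?_
    rw [Finset.mul_sum]
    refine Finset.sum_congr rfl fun τ _ => ?_
    simp only [Units.smul_def, zsmul_eq_mul, map_mul, map_prod, Matrix.of_apply, map_intCast,
      Finset.prod_mul_distrib]
    ring
  have hint : ∀ σ τ : Equiv.Perm (Fin n), Integrable (fun x : Fin n → Ω =>
      ((Equiv.Perm.sign σ : ℤ) : ℂ) * ((Equiv.Perm.sign τ : ℤ) : ℂ) *
          ∏ l, G l (x l) * (φ (σ l) (x l) * conj (φ (τ l) (x l)))) (Measure.pi fun _ => ν) := by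
    intro σ τ
    exact (Integrable.fintype_prod (fun l => hG l (σ l) (τ l))).const_mul _
  simp_rw [key]
  refine ⟨integrable_finsetSum _ fun σ _ => integrable_finsetSum _ fun τ _ => hint σ τ, ?_⟩
  rw [integral_finsetSum _ fun σ _ => integrable_finsetSum _ fun τ _ => hint σ τ]
  refine Finset.sum_congr rfl fun σ _ => ?_
  rw [integral_finsetSum _ fun τ _ => hint σ τ]
  refine Finset.sum_congr rfl fun τ _ => ?_
  rw [integral_const_mul]
  congr 1
  exact integral_fintype_prod_eq_prod (fun l z => G l z * (φ (σ l) z * conj (φ (τ l) z)))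

/-- The integral of the determinant of a finite rank kernel against a product of test functions. -/
theorem integral_prod_mul_det_kernel (φ : Fin n → Ω → ℂ) (g : Fin m → Ω → ℂ)
    (hg : ∀ i j k, Integrable (fun z => g i z * (φ j z * conj (φ k z))) ν) :
    Integrable (fun x : Fin m → Ω => (∏ i, g i (x i)) *
      (Matrix.of fun i j => ∑ k, φ k (x i) * conj (φ k (x j))).det) (Measure.pi fun _ => ν) ∧
    ∫ x : Fin m → Ω, (∏ i, g i (x i)) *
      (Matrix.of fun i j => ∑ k, φ k (x i) * conj (φ k (x j))).det ∂(Measure.pi fun _ => ν) =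
    ∑ f : Fin m → Fin n, ∑ π : Equiv.Perm (Fin m),
      ((Equiv.Perm.sign π : ℤ) : ℂ) *
        ∏ i, ∫ z, g i z * (φ (f i) z * conj (φ (f (π i)) z)) ∂ν := by
  have key : ∀ x : Fin m → Ω, (∏ i, g i (x i)) *
      (Matrix.of fun i j => ∑ k, φ k (x i) * conj (φ k (x j))).det =
      ∑ f : Fin m → Fin n, ∑ π : Equiv.Perm (Fin m), ((Equiv.Perm.sign π : ℤ) : ℂ) *
        ∏ i, g i (x i) * (φ (f i) (x i) * conj (φ (f (π i)) (x i))) := by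
    intro x
    rw [← Matrix.det_transpose, Matrix.det_apply, Finset.mul_sum, Finset.sum_comm]
    rw [← Equiv.sum_comp (Equiv.inv (Equiv.Perm (Fin m)))]
    refine Finset.sum_congr rfl fun π _ => ?_
    simp only [Matrix.transpose_apply, Matrix.of_apply, Units.smul_def, zsmul_eq_mul,
      Finset.prod_univ_sum, Equiv.inv_apply, Equiv.Perm.sign_inv, Finset.mul_sum,
      Fintype.piFinset_univ]
    refine Finset.sum_congr rfl fun f _ => ?_
    simp only [Finset.prod_mul_distrib]
    rw [← Equiv.prod_comp π (fun i => conj (φ (f i) (x (π⁻¹ i))))]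
    simp only [Equiv.Perm.coe_inv, Equiv.symm_apply_apply]
    ring
  have hint : ∀ (f : Fin m → Fin n) (π : Equiv.Perm (Fin m)), Integrable (fun x : Fin m → Ω =>
      ((Equiv.Perm.sign π : ℤ) : ℂ) *
          ∏ i, g i (x i) * (φ (f i) (x i) * conj (φ (f (π i)) (x i)))) (Measure.pi fun _ => ν) :=
    fun f π => (Integrable.fintype_prod (fun i => hg i (f i) (f (π i)))).const_mul _
  simp_rw [key]
  refine ⟨integrable_finsetSum _ fun σ _ => integrable_finsetSum _ fun τ _ => hint σ τ, ?_⟩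
  rw [integral_finsetSum _ fun σ _ => integrable_finsetSum _ fun τ _ => hint σ τ]
  refine Finset.sum_congr rfl fun f _ => ?_
  rw [integral_finsetSum _ fun π _ => hint f π]
  refine Finset.sum_congr rfl fun π _ => ?_
  rw [integral_const_mul]
  congr 1
  exact integral_fintype_prod_eq_prod (fun i z => g i z * (φ (f i) z * conj (φ (f (π i)) z)))

/-- The factorial moments of an orthogonal polynomial ensemble are given by determinants of its
kernel. -/
theorem integral_sum_embedding_mul_det (φ : Fin n → Ω → ℂ)
    (hφ : ∀ j k, Integrable (fun z => φ j z * conj (φ k z)) ν)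
    (hON : ∀ j k, ∫ z, φ j z * conj (φ k z) ∂ν = if j = k then 1 else 0) (g : Fin m → Ω → ℂ)
    (hg : ∀ i j k, Integrable (fun z => g i z * (φ j z * conj (φ k z))) ν) :
    Integrable (fun x : Fin n → Ω => (∑ f : Fin m ↪ Fin n, ∏ i, g i (x (f i))) *
      ((Matrix.of fun k i => φ k (x i)).det * conj (Matrix.of fun k i => φ k (x i)).det))
      (Measure.pi fun _ => ν) ∧
    ∫ x : Fin n → Ω, (∑ f : Fin m ↪ Fin n, ∏ i, g i (x (f i))) *
      ((Matrix.of fun k i => φ k (x i)).det * conj (Matrix.of fun k i => φ k (x i)).det)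
      ∂(Measure.pi fun _ => ν) =
    (n.factorial : ℂ) * ∫ x : Fin m → Ω, (∏ i, g i (x i)) *
      (Matrix.of fun i j => ∑ k, φ k (x i) * conj (φ k (x j))).det ∂(Measure.pi fun _ => ν) := by
  classical
  -- The m test functions are spread over the n particles, with 1 at the particles that f misses, so
  -- that Andréief's identity applies to each f separately.
  let G : (Fin m ↪ Fin n) → Fin n → Ω → ℂ := fun f l z =>
    if h : ∃ i, f i = l then g h.choose z else 1
  have hGf : ∀ (f : Fin m ↪ Fin n) i, G f (f i) = g i := by
    intro f i
    ext z
    have h : ∃ i', f i' = f i := ⟨i, rfl⟩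
    simp only [G, dif_pos h]
    rw [f.injective h.choose_spec]
  have hGn : ∀ (f : Fin m ↪ Fin n) l, l ∉ Set.range f → G f l = fun _ => 1 := by
    intro f l hl
    ext z
    have h : ¬ ∃ i, f i = l := fun ⟨i, hi⟩ => hl ⟨i, hi⟩
    simp only [G, dif_neg h]
  have hGint : ∀ f l j k, Integrable (fun z => G f l z * (φ j z * conj (φ k z))) ν := by
    intro f l j k
    by_cases hl : l ∈ Set.range f
    · obtain ⟨i, rfl⟩ := hl
      rw [hGf]; exact hg i j k
    · rw [hGn f l hl]; simpa using hφ j k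
  have hprod : ∀ (f : Fin m ↪ Fin n) (x : Fin n → Ω),
      ∏ i, g i (x (f i)) = ∏ l, G f l (x l) := by
    intro f x
    refine Fintype.prod_of_injective f f.injective _ _ ?_ ?_
    · intro l hl; rw [hGn f l hl]
    · intro i; rw [hGf]
  have hA := fun f : Fin m ↪ Fin n => integral_prod_mul_det_mul_conj_det (ν := ν) φ (G f) (hGint f)
  simp_rw [Finset.sum_mul, hprod]
  refine ⟨integrable_finsetSum _ fun f _ => (hA f).1, ?_⟩
  rw [integral_finsetSum _ fun f _ => (hA f).1, (integral_prod_mul_det_kernel φ g hg).2]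
  set A : Fin m → Fin n → Fin n → ℂ := fun i j k => ∫ z, g i z * (φ j z * conj (φ k z)) ∂ν with hAdef
  have step : ∀ f : Fin m ↪ Fin n, ∫ x : Fin n → Ω, (∏ l, G f l (x l)) *
      ((Matrix.of fun k i => φ k (x i)).det * conj (Matrix.of fun k i => φ k (x i)).det)
      ∂(Measure.pi fun _ => ν) = ∑ σ : Equiv.Perm (Fin n), ∑ π : Equiv.Perm (Fin m),
      ((Equiv.Perm.sign π : ℤ) : ℂ) * ∏ i, A i (σ (f i)) (σ (f (π i))) := by
    intro f
    rw [(hA f).2]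
    refine sum_perm_perm_eq_sum_perm_fixing A f
      (fun l j k => ∫ z, G f l z * (φ j z * conj (φ k z)) ∂ν) ?_ ?_
    · intro i; simp only [hGf, hAdef]
    · intro l hl j k
      rw [hGn f l hl]; simpa using hON j k
  simp_rw [step]
  -- Once the sum over f is inside, it no longer depends on σ; the n! permutations give the factor
  -- n!.
  rw [Finset.sum_comm]
  simp_rw [sum_embedding_sum_perm_comp]
  rw [Finset.sum_const, Finset.card_univ, Fintype.card_perm, Fintype.card_fin, nsmul_eq_mul]

end Determinants

/-! ### Radial integrals in the plane. -/

section RadialIntegrals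

open ComplexConjugate

/-- Since 1 + |z| ≤ 2 max(1, |z|), both bounds are dominated by a multiple of (1 + |z|)^{-(2+2χ)},
which is integrable in dimension two. -/
theorem integrable_of_norm_le_rpow {χ : ℝ} (hχ : 0 < χ) {f : ℂ → ℝ}
    (hf : AEStronglyMeasurable f volume) (h0 : ∀ z, 0 ≤ f z) {C : ℝ} (h1 : ∀ z, ‖z‖ ≤ 1 → f z ≤ C)
    (h2 : ∀ z, 1 ≤ ‖z‖ → f z ≤ C * ‖z‖ ^ (-(2 + 2 * χ))) : Integrable f := by
  have hC : 0 ≤ C := (h0 0).trans (h1 0 (by simp))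
  have hb : Integrable (fun z : ℂ => C * 2 ^ (2 + 2 * χ) * (1 + ‖z‖) ^ (-(2 + 2 * χ))) := by
    refine (integrable_one_add_norm ?_).const_mul _
    rw [Complex.finrank_real_complex]; push_cast; linarith
  refine hb.mono' hf (Eventually.of_forall fun z => ?_)
  rw [Real.norm_eq_abs, abs_of_nonneg (h0 z)]
  have hz := norm_nonneg z
  have key : ∀ r : ℝ, 0 < r → 1 + ‖z‖ ≤ 2 * r →
      C * r ^ (-(2 + 2 * χ)) ≤ C * 2 ^ (2 + 2 * χ) * (1 + ‖z‖) ^ (-(2 + 2 * χ)) := by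
    intro r hr hle
    rw [mul_assoc]
    refine mul_le_mul_of_nonneg_left ?_ hC
    have : (2 * r) ^ (-(2 + 2 * χ)) ≤ (1 + ‖z‖) ^ (-(2 + 2 * χ)) :=
      Real.rpow_le_rpow_of_nonpos (by linarith) hle (by linarith)
    rw [Real.mul_rpow (by norm_num) hr.le] at this
    have h2 : (2 : ℝ) ^ (2 + 2 * χ) * 2 ^ (-(2 + 2 * χ)) = 1 := by
      rw [← Real.rpow_add (by norm_num)]; simp
    calc r ^ (-(2 + 2 * χ)) = 2 ^ (2 + 2 * χ) * (2 ^ (-(2 + 2 * χ)) * r ^ (-(2 + 2 * χ))) := by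
          rw [← mul_assoc, h2, one_mul]
      _ ≤ _ := mul_le_mul_of_nonneg_left this (by positivity)
  rcases le_total ‖z‖ 1 with h | h
  · have := key 1 one_pos (by linarith)
    simp only [Real.one_rpow, mul_one] at this
    exact (h1 z h).trans this
  · exact (h2 z h).trans (key ‖z‖ (by linarith) (by linarith))

/-- The rotation by the angle π/(j-k) preserves Lebesgue measure and changes the sign of the
integrand, so the integral equals its opposite. No integrability is needed. -/
theorem integral_radial_mul_pow_mul_conj_pow (g : ℝ → ℂ) {j k : ℕ} (hjk : j ≠ k) :
    ∫ z : ℂ, g ‖z‖ * (z ^ j * conj (z ^ k)) = 0 := by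
  set d : ℝ := (j : ℝ) - k with hd
  have hd0 : d ≠ 0 := by
    rw [hd, sub_ne_zero]; exact_mod_cast hjk
  set a : Circle := Circle.exp (Real.pi / d) with ha
  have hrot : ∀ z : ℂ, g ‖rotation a z‖ * ((rotation a z) ^ j * conj ((rotation a z) ^ k)) =
      -(g ‖z‖ * (z ^ j * conj (z ^ k))) := by
    intro z
    have h1 : (a : ℂ) ^ j * conj ((a : ℂ) ^ k) = -1 := by
      rw [ha, Circle.coe_exp, map_pow, ← Complex.exp_conj, ← Complex.exp_nat_mul,
        ← Complex.exp_nat_mul, ← Complex.exp_add, ← Complex.exp_pi_mul_I]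
      congr 1
      simp only [map_mul, Complex.conj_ofReal, Complex.conj_I]
      have : ((j : ℂ) - k) ≠ 0 := by
        rw [sub_ne_zero]; exact_mod_cast hjk
      rw [hd]
      push_cast
      field_simp
      try ring
    rw [LinearIsometryEquiv.norm_map, rotation_apply, mul_pow, mul_pow, map_mul]
    linear_combination (g ‖z‖ * (z ^ j * conj (z ^ k))) * h1
  have h := ((rotation a).measurePreserving).integral_comp
    (rotation a).toHomeomorph.measurableEmbedding (fun z : ℂ => g ‖z‖ * (z ^ j * conj (z ^ k)))
  simp only [hrot, integral_neg] at h
  have h2 : (2 : ℂ) * ∫ z : ℂ, g ‖z‖ * (z ^ j * conj (z ^ k)) = 0 := by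
    linear_combination -h
  simpa using h2

theorem setIntegral_norm_rpow_eq {s t : ℝ} (hs : 0 < s) (ht : 0 < t) :
    ∫ z in {z : ℂ | t < ‖z‖}, ‖z‖ ^ (-(2 * s) - 2) = Real.pi * t ^ (-(2 * s)) / s := by
  have hm : MeasurableSet {z : ℂ | t < ‖z‖} :=
    (isOpen_lt continuous_const continuous_norm).measurableSet
  rw [← integral_indicator hm]
  have h1 : ({z : ℂ | t < ‖z‖}.indicator fun z => ‖z‖ ^ (-(2 * s) - 2)) =
      fun z => (Set.Ioi t).indicator (fun r : ℝ => r ^ (-(2 * s) - 2)) ‖z‖ := by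
    ext z
    simp [Set.indicator_apply]
  rw [h1, integral_fun_norm_addHaar volume]
  have h2 : ∫ y in Set.Ioi (0 : ℝ), y ^ (Module.finrank ℝ ℂ - 1) •
      (Set.Ioi t).indicator (fun r : ℝ => r ^ (-(2 * s) - 2)) y = t ^ (-(2 * s)) / (2 * s) := by
    have : ∀ y : ℝ, y ^ (Module.finrank ℝ ℂ - 1) •
        (Set.Ioi t).indicator (fun r : ℝ => r ^ (-(2 * s) - 2)) y =
        (Set.Ioi t).indicator (fun r : ℝ => r ^ (-(2 * s) - 1)) y := by
      intro y
      rw [Complex.finrank_real_complex]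
      by_cases hy : t < y
      · have hy0 : 0 < y := ht.trans hy
        simp only [Set.indicator_apply, Set.mem_Ioi, hy, if_true, smul_eq_mul, pow_one,
          show 2 - 1 = 1 from rfl]
        rw [← Real.rpow_one_add' hy0.le (by linarith)]
        congr 1; ring
      · simp [hy]
    simp_rw [this]
    rw [setIntegral_indicator measurableSet_Ioi, Set.inter_eq_right.2 (Set.Ioi_subset_Ioi ht.le),
      integral_Ioi_rpow_of_lt (by linarith) ht]
    rw [show -(2 * s) - 1 + 1 = -(2 * s) by ring, neg_div_neg_eq]
  rw [h2, Complex.finrank_real_complex, Measure.real, Complex.volume_ball]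
  simp
  field_simp

end RadialIntegrals

/-! ### Masses of the monomials and their limits. -/

section Weights

variable {V : ℝ → ℝ} {χ R : ℝ}

theorem IsCirclePotential.continuous_comp_norm (hV : IsCirclePotential V) :
    Continuous fun z : ℂ => V ‖z‖ :=
  hV.continuousOn.comp_continuous continuous_norm fun z => norm_nonneg z

theorem IsCirclePotential.nonneg (hV : IsCirclePotential V) {r : ℝ} (hr : 0 ≤ r) : 0 ≤ V r :=
  (le_max_left _ _).trans (hV.lower_bound r hr)

theorem IsCirclePotential.log_le (hV : IsCirclePotential V) {r : ℝ} (hr : 0 ≤ r) :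
    Real.log r ≤ V r :=
  (le_max_right _ _).trans (hV.lower_bound r hr)

/-- The radial weight `r^(2k) exp (-2 (n + χ) V r)`. -/
def radialWeight (V : ℝ → ℝ) (χ : ℝ) (n k : ℕ) (r : ℝ) : ℝ :=
  r ^ (2 * k) * Real.exp (-2 * (n + χ) * V r)

/-- The squared norm of the monomial `z^k` in the weighted space. -/
def monomialMass (V : ℝ → ℝ) (χ : ℝ) (n k : ℕ) : ℝ := ∫ z : ℂ, radialWeight V χ n k ‖z‖

theorem radialWeight_nonneg (V : ℝ → ℝ) (χ : ℝ) (n k : ℕ) {r : ℝ} (hr : 0 ≤ r) :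
    0 ≤ radialWeight V χ n k r := mul_nonneg (pow_nonneg hr _) (Real.exp_pos _).le

theorem IsCirclePotential.continuous_radialWeight (hV : IsCirclePotential V) (n k : ℕ) :
    Continuous fun z : ℂ => radialWeight V χ n k ‖z‖ := by
  have h := hV.continuous_comp_norm
  exact (continuous_norm.pow _).mul (Real.continuous_exp.comp (continuous_const.mul h))

theorem IsCirclePotential.radialWeight_le_one (hV : IsCirclePotential V) (hχ : 0 < χ) {n k : ℕ}
    (hk : k < n) {r : ℝ} (hr : 0 ≤ r) : radialWeight V χ n k r ≤ 1 := by
  unfold radialWeight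
  have hkn : (k : ℝ) + 1 ≤ n := by exact_mod_cast hk
  have hVr := hV.nonneg hr
  rcases eq_or_lt_of_le hr with h0 | h0
  · subst h0
    refine mul_le_one₀ (pow_le_one₀ le_rfl zero_le_one) (Real.exp_pos _).le ?_
    rw [Real.exp_le_one_iff]
    nlinarith
  · have hlog := hV.log_le hr
    have : r ^ (2 * k) = Real.exp (2 * k * Real.log r) := by
      rw [show (2 : ℝ) * k * Real.log r = ((2 * k : ℕ) : ℝ) * Real.log r by push_cast; ring,
        Real.exp_nat_mul, Real.exp_log h0]
    rw [this, ← Real.exp_add, Real.exp_le_one_iff]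
    have hk0 : (0 : ℝ) ≤ k := Nat.cast_nonneg k
    nlinarith [mul_le_mul_of_nonneg_left hlog hk0]

/-- Counting degrees from the top makes n cancel: 2(n-1-k) - 2(n+χ) = -2(k+χ) - 2. -/
theorem radialWeight_eq_rpow (χ : ℝ) {n k : ℕ} (hk : k < n) {r : ℝ} (hr : 0 < r)
    (hVr : V r = Real.log r) :
    radialWeight V χ n (n - 1 - k) r = r ^ (-(2 * (k + χ)) - 2) := by
  unfold radialWeight
  rw [hVr, Real.rpow_def_of_pos hr]
  have : r ^ (2 * (n - 1 - k)) = Real.exp (Real.log r * (2 * ((n : ℝ) - 1 - k))) := by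
    rw [show Real.log r * (2 * ((n : ℝ) - 1 - k)) = ((2 * (n - 1 - k) : ℕ) : ℝ) * Real.log r by
      rw [Nat.cast_mul, Nat.cast_sub (by omega), Nat.cast_sub (by omega)]; push_cast; ring,
      Real.exp_nat_mul, Real.exp_log hr]
  rw [this, ← Real.exp_add]
  congr 1
  ring

theorem IsCirclePotential.radialWeight_le_rpow (hV : IsCirclePotential V) (hχ : 0 < χ) {n k : ℕ}
    (hk : k < n) {r : ℝ} (hr : 1 ≤ r) : radialWeight V χ n k r ≤ r ^ (-(2 + 2 * χ)) := by
  unfold radialWeight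
  have h0 : 0 < r := by linarith
  have hkn : (k : ℝ) + 1 ≤ n := by exact_mod_cast hk
  have hk0 : (0 : ℝ) ≤ k := Nat.cast_nonneg k
  have hlog := hV.log_le h0.le
  have hl0 := Real.log_nonneg hr
  rw [Real.rpow_def_of_pos h0]
  have : r ^ (2 * k) = Real.exp (2 * k * Real.log r) := by
    rw [show (2 : ℝ) * k * Real.log r = ((2 * k : ℕ) : ℝ) * Real.log r by push_cast; ring,
      Real.exp_nat_mul, Real.exp_log h0]
  rw [this, ← Real.exp_add, Real.exp_le_exp]
  have h1 : ((n : ℝ) + χ) * Real.log r ≤ (n + χ) * V r :=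
    mul_le_mul_of_nonneg_left hlog (by linarith)
  have h2 : ((k : ℝ) + 1) * Real.log r ≤ n * Real.log r := mul_le_mul_of_nonneg_right hkn hl0
  nlinarith

theorem IsCirclePotential.integrable_radialWeight (hV : IsCirclePotential V) (hχ : 0 < χ) {n k : ℕ}
    (hk : k < n) : Integrable fun z : ℂ => radialWeight V χ n k ‖z‖ := by
  refine integrable_of_norm_le_rpow hχ (hV.continuous_radialWeight n k).aestronglyMeasurable
    (fun z => radialWeight_nonneg _ _ _ _ (norm_nonneg z)) (C := 1) ?_ ?_
  · intro z _; exact hV.radialWeight_le_one hχ hk (norm_nonneg z)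
  · intro z hz; rw [one_mul]; exact hV.radialWeight_le_rpow hχ hk hz

/-- The limit of the mass of the monomial `z^(n-1-k)` outside the disk of radius `t`. -/
def tailMass (χ : ℝ) (k : ℕ) (t : ℝ) : ℝ := Real.pi * t ^ (-(2 * (k + χ))) / (k + χ)

theorem tailMass_pos (hχ : 0 < χ) (k : ℕ) {t : ℝ} (ht : 0 < t) : 0 < tailMass χ k t := by
  have : (0 : ℝ) ≤ k := Nat.cast_nonneg k
  unfold tailMass
  have := Real.pi_pos
  have := Real.rpow_pos_of_pos ht (-(2 * (k + χ)))
  positivity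

theorem setIntegral_radialWeight_eq (hχ : 0 < χ) (hR : 1 ≤ R)
    (hV_eq : ∀ r, R ≤ r → V r = Real.log r) {n k : ℕ} (hk : k < n) {t : ℝ} (ht : R ≤ t) :
    ∫ z in {z : ℂ | t < ‖z‖}, radialWeight V χ n (n - 1 - k) ‖z‖ = tailMass χ k t := by
  have hm : MeasurableSet {z : ℂ | t < ‖z‖} :=
    (isOpen_lt continuous_const continuous_norm).measurableSet
  have hk0 : (0 : ℝ) ≤ k := Nat.cast_nonneg k
  unfold tailMass
  rw [← setIntegral_norm_rpow_eq (by linarith : 0 < (k : ℝ) + χ) (by linarith : 0 < t)]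
  refine setIntegral_congr_fun hm fun z hz => ?_
  have hz' : t < ‖z‖ := hz
  exact radialWeight_eq_rpow χ hk (by linarith) (hV_eq _ (by linarith))

theorem IsCirclePotential.monomialMass_eq_add (hV : IsCirclePotential V) (hχ : 0 < χ) (hR : 1 ≤ R)
    (hV_eq : ∀ r, R ≤ r → V r = Real.log r) {n k : ℕ} (hk : k < n) {t : ℝ} (ht : R ≤ t) :
    monomialMass V χ n (n - 1 - k) =
      (∫ z in {z : ℂ | ‖z‖ ≤ t}, radialWeight V χ n (n - 1 - k) ‖z‖) + tailMass χ k t := by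
  have hm : MeasurableSet {z : ℂ | ‖z‖ ≤ t} :=
    (isClosed_le continuous_norm continuous_const).measurableSet
  have hc : {z : ℂ | ‖z‖ ≤ t}ᶜ = {z | t < ‖z‖} := by ext z; simp
  rw [monomialMass, ← integral_add_compl hm (hV.integrable_radialWeight hχ (by omega)), hc,
    setIntegral_radialWeight_eq hχ hR hV_eq hk ht]

/-- The mass inside the disk is dropped. The bound is uniform in n and supplies the domination for
the kernels and for the infinite product. -/
theorem IsCirclePotential.tailMass_le_monomialMass (hV : IsCirclePotential V) (hχ : 0 < χ)
    (hR : 1 ≤ R) (hV_eq : ∀ r, R ≤ r → V r = Real.log r) {n k : ℕ} (hk : k < n) :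
    tailMass χ k R ≤ monomialMass V χ n (n - 1 - k) := by
  rw [hV.monomialMass_eq_add hχ hR hV_eq hk le_rfl]
  have : 0 ≤ ∫ z in {z : ℂ | ‖z‖ ≤ R}, radialWeight V χ n (n - 1 - k) ‖z‖ :=
    integral_nonneg fun z => radialWeight_nonneg _ _ _ _ (norm_nonneg z)
  linarith

theorem IsCirclePotential.monomialMass_pos (hV : IsCirclePotential V) (hχ : 0 < χ)
    (hR : 1 ≤ R) (hV_eq : ∀ r, R ≤ r → V r = Real.log r) {n k : ℕ} (hk : k < n) :
    0 < monomialMass V χ n k := by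
  have h := hV.tailMass_le_monomialMass hχ hR hV_eq (n := n) (k := n - 1 - k) (by omega)
  rw [show n - 1 - (n - 1 - k) = k by omega] at h
  exact (tailMass_pos hχ _ (by linarith)).trans_le h

/-- Up to a factor at most one, the weight is q^{n-1-k} with q = (r e^{-V(r)})². Here q < 1 because
V > log at r, which fails at r = 1 and at r = R. -/
theorem IsCirclePotential.tendsto_radialWeight (hV : IsCirclePotential V) (hχ : 0 < χ)
    (hV_gt : ∀ r, 1 < r → r < R → Real.log r < V r) (k : ℕ) {r : ℝ} (hr0 : 0 ≤ r) (hrR : r < R)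
    (hr1 : r ≠ 1) : Tendsto (fun n : ℕ => radialWeight V χ n (n - 1 - k) r) atTop (𝓝 0) := by
  have hlt : r * Real.exp (-V r) < 1 := by
    rcases eq_or_lt_of_le hr0 with h0 | h0
    · rw [← h0]; simp
    have hl : Real.log r < V r := by
      rcases lt_or_gt_of_ne hr1 with h | h
      · exact (Real.log_neg h0 h).trans_le (hV.nonneg hr0)
      · exact hV_gt r h hrR
    calc r * Real.exp (-V r) = Real.exp (Real.log r + -V r) := by rw [Real.exp_add, Real.exp_log h0]
      _ < 1 := by rw [Real.exp_lt_one_iff]; linarith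
  have hq0 : 0 ≤ r * Real.exp (-V r) := by positivity
  set q := (r * Real.exp (-V r)) ^ 2 with hq
  have hq1 : q < 1 := by rw [hq]; exact pow_lt_one₀ hq0 hlt (by norm_num)
  have hlim : Tendsto (fun n : ℕ => q ^ (n - 1 - k)) atTop (𝓝 0) := by
    have := tendsto_pow_atTop_nhds_zero_of_lt_one (by positivity) hq1
    refine this.comp ?_
    simp_rw [Nat.sub_sub]
    exact tendsto_sub_atTop_nat _
  refine squeeze_zero' (Eventually.of_forall fun n => radialWeight_nonneg _ _ _ _ hr0) ?_ hlim
  filter_upwards [eventually_gt_atTop k] with n hn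
  have hVr := hV.nonneg hr0
  have h1 : radialWeight V χ n (n - 1 - k) r =
      q ^ (n - 1 - k) * Real.exp (-2 * (k + 1 + χ) * V r) := by
    rw [hq, ← pow_mul, mul_pow, radialWeight, mul_assoc (r ^ _), ← Real.exp_nat_mul, ← Real.exp_add]
    congr 2
    rw [Nat.cast_mul, Nat.cast_sub (by omega), Nat.cast_sub (by omega)]; push_cast; ring
  rw [h1]
  refine mul_le_of_le_one_right (by positivity) ?_
  rw [Real.exp_le_one_iff]
  have : (0 : ℝ) ≤ k := Nat.cast_nonneg k
  nlinarith

/-- The mass outside the disk is exactly the limit. The mass inside tends to zero by dominated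
convergence: the weight is at most one, and the circles of radii 1 and R are null. -/
theorem IsCirclePotential.tendsto_monomialMass (hV : IsCirclePotential V) (hχ : 0 < χ)
    (hR : 1 ≤ R) (hV_eq : ∀ r, R ≤ r → V r = Real.log r)
    (hV_gt : ∀ r, 1 < r → r < R → Real.log r < V r) (k : ℕ) :
    Tendsto (fun n : ℕ => monomialMass V χ n (n - 1 - k)) atTop (𝓝 (tailMass χ k R)) := by
  have hinner : Tendsto (fun n : ℕ => ∫ z in {z : ℂ | ‖z‖ ≤ R}, radialWeight V χ n (n - 1 - k) ‖z‖)
      atTop (𝓝 (∫ z in {z : ℂ | ‖z‖ ≤ R}, (0 : ℝ))) := by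
    refine tendsto_integral_filter_of_dominated_convergence (fun _ => 1) ?_ ?_ ?_ ?_
    · exact Eventually.of_forall fun n => (hV.continuous_radialWeight n _).aestronglyMeasurable
    · filter_upwards [eventually_gt_atTop k] with n hn
      refine Eventually.of_forall fun z => ?_
      rw [Real.norm_eq_abs, abs_of_nonneg (radialWeight_nonneg _ _ _ _ (norm_nonneg z))]
      exact hV.radialWeight_le_one hχ (by omega) (norm_nonneg z)
    · have : {z : ℂ | ‖z‖ ≤ R} = Metric.closedBall 0 R := by ext z; simp
      rw [this]
      refine integrableOn_const ?_
      exact (isCompact_closedBall (0 : ℂ) R).measure_lt_top.ne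
    · have h1 : ∀ᵐ z : ℂ, z ∉ Metric.sphere (0 : ℂ) 1 :=
        measure_eq_zero_iff_ae_notMem.1 (Measure.addHaar_sphere _ _ _)
      have h2 : ∀ᵐ z : ℂ, z ∉ Metric.sphere (0 : ℂ) R :=
        measure_eq_zero_iff_ae_notMem.1 (Measure.addHaar_sphere _ _ _)
      have hm : MeasurableSet {z : ℂ | ‖z‖ ≤ R} :=
        (isClosed_le continuous_norm continuous_const).measurableSet
      rw [ae_restrict_iff' hm]
      filter_upwards [h1, h2] with z hz1 hz2 hz
      have hz' : ‖z‖ ≤ R := hz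
      simp only [mem_sphere_zero_iff_norm] at hz1 hz2
      exact hV.tendsto_radialWeight hχ hV_gt k (norm_nonneg z) (lt_of_le_of_ne hz' hz2) hz1
  rw [integral_zero] at hinner
  have := hinner.add_const (tailMass χ k R)
  rw [zero_add] at this
  refine this.congr' ?_
  filter_upwards [eventually_gt_atTop k] with n hn
  rw [hV.monomialMass_eq_add hχ hR hV_eq hn le_rfl]

end Weights

/-! ### The gas as an orthogonal polynomial ensemble. -/

section Ensemble

open ComplexConjugate
open scoped ComplexOrder

variable {V : ℝ → ℝ} {χ R : ℝ}

/-- The orthonormal weighted monomials. -/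
def weightedMonomial (V : ℝ → ℝ) (χ : ℝ) (n k : ℕ) (z : ℂ) : ℂ :=
  ((Real.sqrt (monomialMass V χ n k))⁻¹ : ℝ) * (((Real.exp (-(n + χ) * V ‖z‖) : ℝ) : ℂ) * z ^ k)

/-- The kernel of the orthogonal projection on the weighted monomials. -/
def kernelN (V : ℝ → ℝ) (χ : ℝ) (n : ℕ) (z w : ℂ) : ℂ :=
  ∑ k : Fin n, weightedMonomial V χ n k z * conj (weightedMonomial V χ n k w)

theorem weightedMonomial_mul_conj (V : ℝ → ℝ) (χ : ℝ) (n j k : ℕ) (z w : ℂ) :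
    weightedMonomial V χ n j z * conj (weightedMonomial V χ n k w) =
      (((Real.sqrt (monomialMass V χ n j))⁻¹ * (Real.sqrt (monomialMass V χ n k))⁻¹ *
        (Real.exp (-(n + χ) * V ‖z‖) * Real.exp (-(n + χ) * V ‖w‖)) : ℝ) : ℂ) *
        (z ^ j * conj (w ^ k)) := by
  unfold weightedMonomial
  simp only [map_mul, Complex.conj_ofReal]
  push_cast
  ring

theorem IsCirclePotential.continuous_weightedMonomial (hV : IsCirclePotential V) (n k : ℕ) :
    Continuous (weightedMonomial V χ n k) := by
  have h := hV.continuous_comp_norm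
  unfold weightedMonomial
  exact continuous_const.mul ((Complex.continuous_ofReal.comp
    (Real.continuous_exp.comp (continuous_const.mul h))).mul (continuous_id.pow _))

theorem norm_weightedMonomial_sq {n k : ℕ} (hm : 0 < monomialMass V χ n k) (z : ℂ) :
    ‖weightedMonomial V χ n k z‖ ^ 2 = (monomialMass V χ n k)⁻¹ * radialWeight V χ n k ‖z‖ := by
  unfold weightedMonomial radialWeight
  rw [norm_mul, norm_mul, Complex.norm_real, Complex.norm_real, norm_pow, Real.norm_eq_abs,
    Real.norm_eq_abs, abs_of_pos (Real.exp_pos _), mul_pow, mul_pow, sq_abs, inv_pow,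
    Real.sq_sqrt hm.le, ← Real.exp_nat_mul, ← pow_mul]
  rw [show ((2 : ℕ) : ℝ) * (-(n + χ) * V ‖z‖) = -2 * (n + χ) * V ‖z‖ by push_cast; ring]
  ring

theorem IsCirclePotential.integrable_weightedMonomial_mul_conj (hV : IsCirclePotential V)
    (hχ : 0 < χ) (hR : 1 ≤ R) (hV_eq : ∀ r, R ≤ r → V r = Real.log r) {n j k : ℕ} (hj : j < n)
    (hk : k < n) :
    Integrable fun z => weightedMonomial V χ n j z * conj (weightedMonomial V χ n k z) := by
  have hmj := hV.monomialMass_pos hχ hR hV_eq hj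
  have hmk := hV.monomialMass_pos hχ hR hV_eq hk
  have hcj := hV.continuous_weightedMonomial (χ := χ) n j
  have hck := hV.continuous_weightedMonomial (χ := χ) n k
  refine (((hV.integrable_radialWeight hχ hj).const_mul (monomialMass V χ n j)⁻¹).add
    ((hV.integrable_radialWeight hχ hk).const_mul (monomialMass V χ n k)⁻¹)).mono'
    (hcj.mul (Complex.continuous_conj.comp hck)).aestronglyMeasurable
    (Eventually.of_forall fun z => ?_)
  rw [norm_mul, RCLike.norm_conj]
  simp only [Pi.add_apply]
  rw [← norm_weightedMonomial_sq hmj, ← norm_weightedMonomial_sq hmk]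
  nlinarith [sq_nonneg (‖weightedMonomial V χ n j z‖ - ‖weightedMonomial V χ n k z‖),
    norm_nonneg (weightedMonomial V χ n j z), norm_nonneg (weightedMonomial V χ n k z)]

/-- Weighted monomials are orthogonal for every radial weight. -/
theorem integral_indicator_weightedMonomial_of_ne (V : ℝ → ℝ) (χ : ℝ) (n : ℕ) {j k : ℕ}
    (hjk : j ≠ k) (S : Set ℝ) :
    ∫ z, S.indicator (fun _ => (1 : ℂ)) ‖z‖ *
      (weightedMonomial V χ n j z * conj (weightedMonomial V χ n k z)) = 0 := by
  rw [← integral_radial_mul_pow_mul_conj_pow (fun r => S.indicator (fun _ => (1 : ℂ)) r *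
    (((Real.sqrt (monomialMass V χ n j))⁻¹ * (Real.sqrt (monomialMass V χ n k))⁻¹ *
        (Real.exp (-(n + χ) * V r) * Real.exp (-(n + χ) * V r)) : ℝ) : ℂ)) hjk]
  simp_rw [weightedMonomial_mul_conj, mul_assoc]

theorem integral_weightedMonomial_mul_conj_self {n k : ℕ}
    (hm : 0 < monomialMass V χ n k) {S : Set ℝ} :
    ∫ z, S.indicator (fun _ => (1 : ℂ)) ‖z‖ *
      (weightedMonomial V χ n k z * conj (weightedMonomial V χ n k z)) =
    (((monomialMass V χ n k)⁻¹ *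
      ∫ z : ℂ, S.indicator (fun r => radialWeight V χ n k r) ‖z‖ : ℝ) : ℂ) := by
  rw [← integral_const_mul, ← integral_complex_ofReal]
  congr 1
  ext z
  rw [Complex.mul_conj, Complex.normSq_eq_norm_sq, norm_weightedMonomial_sq hm]
  by_cases h : ‖z‖ ∈ S <;> simp [h]

theorem IsCirclePotential.integral_weightedMonomial_mul_conj (hV : IsCirclePotential V)
    (hχ : 0 < χ) (hR : 1 ≤ R) (hV_eq : ∀ r, R ≤ r → V r = Real.log r) {n : ℕ} (j k : Fin n) :
    ∫ z, weightedMonomial V χ n j z * conj (weightedMonomial V χ n k z) =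
      if j = k then 1 else 0 := by
  split_ifs with h
  · subst h
    have hm := hV.monomialMass_pos hχ hR hV_eq j.2
    have := integral_weightedMonomial_mul_conj_self hm (S := Set.univ)
    simp only [Set.indicator_univ, one_mul] at this
    rw [this, show (∫ z : ℂ, radialWeight V χ n j ‖z‖) = monomialMass V χ n j from rfl,
      inv_mul_cancel₀ hm.ne']
    simp
  · have := integral_indicator_weightedMonomial_of_ne V χ n (j := j) (k := k)
      (by simpa [Fin.ext_iff] using h) Set.univ
    simpa using this

/-- The Slater determinant of the weighted monomials. -/
def slaterDet (V : ℝ → ℝ) (χ : ℝ) (n : ℕ) (x : Fin n → ℂ) : ℂ :=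
  (Matrix.of fun (k i : Fin n) => weightedMonomial V χ n k (x i)).det

theorem IsCirclePotential.continuous_slaterDet (hV : IsCirclePotential V) (n : ℕ) :
    Continuous (slaterDet V χ n) := by
  refine Continuous.matrix_det (continuous_matrix fun k i => ?_)
  exact (hV.continuous_weightedMonomial n k).comp (continuous_apply i)

/-- The Slater determinant is a Vandermonde determinant times one factor per row, the inverse square
root of a mass, and one per column, the weight of a particle. -/
theorem IsCirclePotential.coulombDensity_eq (hV : IsCirclePotential V) (hχ : 0 < χ) (hR : 1 ≤ R)
    (hV_eq : ∀ r, R ≤ r → V r = Real.log r) {n : ℕ} (x : Fin n → ℂ) :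
    coulombDensity V χ n x =
      (∏ k : Fin n, monomialMass V χ n k) * ‖slaterDet V χ n x‖ ^ 2 := by
  have hdet : slaterDet V χ n x = (∏ k : Fin n, ((Real.sqrt (monomialMass V χ n k))⁻¹ : ℝ) : ℂ) *
      ((∏ i, ((Real.exp (-(n + χ) * V ‖x i‖) : ℝ) : ℂ)) *
        ∏ i : Fin n, ∏ j ∈ Finset.Ioi i, (x j - x i)) := by
    rw [← Matrix.det_vandermonde, ← Matrix.det_transpose, ← Matrix.det_mul_row,
      ← Matrix.det_mul_column]
    rfl
  rw [hdet, norm_mul, norm_mul, mul_pow, mul_pow, norm_prod, norm_prod, norm_prod]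
  simp_rw [norm_prod, Complex.norm_real]
  have h1 : (∏ k : Fin n, monomialMass V χ n k) *
      (∏ k : Fin n, ‖(Real.sqrt (monomialMass V χ n k))⁻¹‖) ^ 2 = 1 := by
    rw [← Finset.prod_pow, ← Finset.prod_mul_distrib]
    refine Finset.prod_eq_one fun k _ => ?_
    have hm := hV.monomialMass_pos hχ hR hV_eq k.2
    rw [norm_inv, Real.norm_eq_abs, inv_pow, sq_abs, Real.sq_sqrt hm.le, mul_inv_cancel₀ hm.ne']
  rw [← mul_assoc, h1, one_mul, coulombDensity, mul_comm]
  congr 1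
  · rw [← Finset.prod_pow, Finset.mul_sum, Real.exp_sum]
    refine Finset.prod_congr rfl fun i _ => ?_
    rw [Real.norm_eq_abs, sq_abs, ← Real.exp_nat_mul]
    congr 1; push_cast; ring
  · rw [← Finset.prod_pow]
    refine Finset.prod_congr rfl fun i _ => ?_
    rw [← Finset.prod_pow]
    refine Finset.prod_congr rfl fun j _ => ?_
    rw [norm_sub_rev]

theorem posSemidef_kernelN (V : ℝ → ℝ) (χ : ℝ) (n : ℕ) {m : ℕ} (x : Fin m → ℂ) :
    (Matrix.of fun i j => kernelN V χ n (x i) (x j)).PosSemidef := by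
  have : (Matrix.of fun i j => kernelN V χ n (x i) (x j)) =
      (Matrix.of fun (i : Fin m) (k : Fin n) => weightedMonomial V χ n k (x i)) *
      (Matrix.of fun (i : Fin m) (k : Fin n) => weightedMonomial V χ n k (x i)).conjTranspose := by
    ext i j
    simp [Matrix.mul_apply, kernelN]
  rw [this]
  exact Matrix.posSemidef_self_mul_conjTranspose _

theorem det_kernelN_re_nonneg (V : ℝ → ℝ) (χ : ℝ) (n : ℕ) {m : ℕ} (x : Fin m → ℂ) :
    0 ≤ (Matrix.of fun i j => kernelN V χ n (x i) (x j)).det.re :=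
  (Complex.le_def.1 (posSemidef_kernelN V χ n x).det_nonneg).1

theorem det_kernelN_im (V : ℝ → ℝ) (χ : ℝ) (n : ℕ) {m : ℕ} (x : Fin m → ℂ) :
    (Matrix.of fun i j => kernelN V χ n (x i) (x j)).det.im = 0 :=
  (Complex.le_def.1 (posSemidef_kernelN V χ n x).det_nonneg).2.symm

theorem lintegral_ofReal_re_eq {α : Type*} [MeasurableSpace α] {μ : Measure α} {f : α → ℂ}
    (hf : Integrable f μ) (h : ∀ x, 0 ≤ (f x).re) :
    ∫⁻ x, ENNReal.ofReal (f x).re ∂μ = ENNReal.ofReal (∫ x, f x ∂μ).re := by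
  rw [← ofReal_integral_eq_lintegral_ofReal (f := fun x => (f x).re) hf.re (Eventually.of_forall h)]
  exact congrArg _ (integral_re hf)

/-- `integral_sum_embedding_mul_det` for indicator functions. Both sides are integrals of
nonnegative reals, so the complex identity passes to extended nonnegative integrals. -/
theorem IsCirclePotential.lintegral_slaterDet (hV : IsCirclePotential V) (hχ : 0 < χ) (hR : 1 ≤ R)
    (hV_eq : ∀ r, R ≤ r → V r = Real.log r) {n m : ℕ} {C : Fin m → Set ℂ}
    (hC : ∀ i, MeasurableSet (C i)) :
    ∫⁻ x : Fin n → ℂ, (∑ f : Fin m ↪ Fin n, ∏ i, (C i).indicator (fun _ => (1 : ℝ≥0∞)) (x (f i))) *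
      ENNReal.ofReal (‖slaterDet V χ n x‖ ^ 2) =
    n.factorial * ∫⁻ x in Set.univ.pi C, ENNReal.ofReal
      (Matrix.of fun i j => kernelN V χ n (x i) (x j)).det.re
        ∂(Measure.pi fun _ : Fin m => (volume : Measure ℂ)) := by
  have hφ : ∀ j k : Fin n, Integrable (fun z => weightedMonomial V χ n j z *
      conj (weightedMonomial V χ n k z)) := fun j k =>
    hV.integrable_weightedMonomial_mul_conj hχ hR hV_eq j.2 k.2
  have hg : ∀ (i : Fin m) (j k : Fin n), Integrable (fun z =>
      (C i).indicator (fun _ => (1 : ℂ)) z * (weightedMonomial V χ n j z *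
      conj (weightedMonomial V χ n k z))) := by
    intro i j k
    refine ((hφ j k).indicator (hC i)).congr (Eventually.of_forall fun z => ?_)
    by_cases h : z ∈ C i <;> simp [h]
  have main := integral_sum_embedding_mul_det (ν := (volume : Measure ℂ))
    (fun k : Fin n => weightedMonomial V χ n k) hφ
    (hV.integral_weightedMonomial_mul_conj hχ hR hV_eq)
    (fun i => (C i).indicator (fun _ => (1 : ℂ))) hg
  have hker := (integral_prod_mul_det_kernel (ν := (volume : Measure ℂ))
    (fun k : Fin n => weightedMonomial V χ n k) (fun i => (C i).indicator (fun _ => (1 : ℂ))) hg).1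
  obtain ⟨hint, heq⟩ := main
  have hL : ∀ x : Fin n → ℂ,
      (∑ f : Fin m ↪ Fin n, ∏ i, (C i).indicator (fun _ => (1 : ℝ≥0∞)) (x (f i))) *
      ENNReal.ofReal (‖slaterDet V χ n x‖ ^ 2) = ENNReal.ofReal
      (((∑ f : Fin m ↪ Fin n, ∏ i, (C i).indicator (fun _ => (1 : ℂ)) (x (f i))) *
      ((Matrix.of fun k i : Fin n => weightedMonomial V χ n k (x i)).det *
        conj (Matrix.of fun k i : Fin n => weightedMonomial V χ n k (x i)).det)).re) ∧
      0 ≤ (((∑ f : Fin m ↪ Fin n, ∏ i, (C i).indicator (fun _ => (1 : ℂ)) (x (f i))) *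
      ((Matrix.of fun k i : Fin n => weightedMonomial V χ n k (x i)).det *
        conj (Matrix.of fun k i : Fin n => weightedMonomial V χ n k (x i)).det)).re) := by
    intro x
    have h1 : (∑ f : Fin m ↪ Fin n, ∏ i, (C i).indicator (fun _ => (1 : ℂ)) (x (f i))) =
        ((∑ f : Fin m ↪ Fin n, ∏ i, (C i).indicator (fun _ => (1 : ℝ)) (x (f i)) : ℝ) : ℂ) := by
      push_cast
      refine Finset.sum_congr rfl fun f _ => Finset.prod_congr rfl fun i _ => ?_
      by_cases h : x (f i) ∈ C i <;> simp [h]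
    have hprod : ∀ f : Fin m ↪ Fin n, 0 ≤ ∏ i, (C i).indicator (fun _ => (1 : ℝ)) (x (f i)) :=
      fun f => Finset.prod_nonneg fun i _ => Set.indicator_nonneg (fun _ _ => zero_le_one) _
    have h2 : (∑ f : Fin m ↪ Fin n, ∏ i, (C i).indicator (fun _ => (1 : ℝ≥0∞)) (x (f i))) =
        ENNReal.ofReal (∑ f : Fin m ↪ Fin n,
          ∏ i, (C i).indicator (fun _ => (1 : ℝ)) (x (f i))) := by
      rw [ENNReal.ofReal_sum_of_nonneg fun f _ => hprod f]
      refine Finset.sum_congr rfl fun f _ => ?_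
      rw [ENNReal.ofReal_prod_of_nonneg fun i _ => Set.indicator_nonneg (fun _ _ => zero_le_one) _]
      refine Finset.prod_congr rfl fun i _ => ?_
      by_cases h : x (f i) ∈ C i <;> simp [h]
    have hs : 0 ≤ ∑ f : Fin m ↪ Fin n, ∏ i, (C i).indicator (fun _ => (1 : ℝ)) (x (f i)) :=
      Finset.sum_nonneg fun f _ => hprod f
    rw [h1, h2, Complex.mul_conj, Complex.normSq_eq_norm_sq, ← Complex.ofReal_mul,
      Complex.ofReal_re, ENNReal.ofReal_mul hs]
    exact ⟨rfl, by positivity⟩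
  simp_rw [fun x => (hL x).1]
  rw [show (volume : Measure (Fin n → ℂ)) = Measure.pi fun _ => volume from rfl,
    lintegral_ofReal_re_eq hint fun x => (hL x).2, heq]
  have hR1 : ∀ x : Fin m → ℂ, (∏ i, (C i).indicator (fun _ => (1 : ℂ)) (x i)) *
      (Matrix.of fun i j => ∑ k : Fin n, weightedMonomial V χ n k (x i) *
        conj (weightedMonomial V χ n k (x j))).det =
      (Set.univ.pi C).indicator
        (fun x => (Matrix.of fun i j => kernelN V χ n (x i) (x j)).det) x := by
    intro x
    by_cases h : x ∈ Set.univ.pi C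
    · rw [Set.indicator_of_mem h, Finset.prod_eq_one, one_mul]
      · rfl
      · intro i _
        rw [Set.indicator_of_mem (h i (Set.mem_univ i))]
    · rw [Set.indicator_of_notMem h]
      simp only [Set.mem_univ_pi, not_forall] at h
      obtain ⟨i, hi⟩ := h
      rw [Finset.prod_eq_zero (Finset.mem_univ i) (Set.indicator_of_notMem hi _), zero_mul]
  simp_rw [hR1] at hker ⊢
  have hpi : MeasurableSet (Set.univ.pi C) := MeasurableSet.univ_pi hC
  rw [integral_indicator hpi]
  rw [integrable_indicator_iff hpi] at hker
  rw [show ((n.factorial : ℂ)) = ((n.factorial : ℝ) : ℂ) by push_cast; rfl, Complex.re_ofReal_mul,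
    ENNReal.ofReal_mul (Nat.cast_nonneg _), ENNReal.ofReal_natCast,
    lintegral_ofReal_re_eq hker fun x => det_kernelN_re_nonneg V χ n x]

theorem IsCirclePotential.lintegral_norm_slaterDet_sq (hV : IsCirclePotential V) (hχ : 0 < χ)
    (hR : 1 ≤ R) (hV_eq : ∀ r, R ≤ r → V r = Real.log r) (n : ℕ) :
    ∫⁻ x : Fin n → ℂ, ENNReal.ofReal (‖slaterDet V χ n x‖ ^ 2) = n.factorial := by
  -- For m = 0 there is one empty tuple, and the empty determinant is one, so only the factor n!
  -- remains.
  have := hV.lintegral_slaterDet hχ hR hV_eq (n := n) (m := 0) (C := fun _ => ∅) (by simp)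
  simpa [Set.univ_pi_eq_empty_iff] using this

/-- The normalising constant is n! times the product of the masses; that product also appears in the
density and cancels. -/
theorem IsCirclePotential.coulombGas_eq (hV : IsCirclePotential V) (hχ : 0 < χ)
    (hR : 1 ≤ R) (hV_eq : ∀ r, R ≤ r → V r = Real.log r) (n : ℕ) :
    coulombGas V χ n = (n.factorial : ℝ≥0∞)⁻¹ • (volume : Measure (Fin n → ℂ)).withDensity
      (fun x => ENNReal.ofReal (‖slaterDet V χ n x‖ ^ 2)) := by
  have hpos : 0 < ∏ k : Fin n, monomialMass V χ n k :=
    Finset.prod_pos fun k _ => hV.monomialMass_pos hχ hR hV_eq k.2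
  have hmeas : Measurable fun x : Fin n → ℂ => ENNReal.ofReal (‖slaterDet V χ n x‖ ^ 2) :=
    ((hV.continuous_slaterDet n).norm.pow 2).measurable.ennreal_ofReal
  have hd : (fun x : Fin n → ℂ => ENNReal.ofReal (coulombDensity V χ n x)) =
      ENNReal.ofReal (∏ k : Fin n, monomialMass V χ n k) •
        fun x => ENNReal.ofReal (‖slaterDet V χ n x‖ ^ 2) := by
    ext x
    rw [hV.coulombDensity_eq hχ hR hV_eq, ENNReal.ofReal_mul hpos.le]
    rfl
  have hc0 : ENNReal.ofReal (∏ k : Fin n, monomialMass V χ n k) ≠ 0 := by simpa using hpos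
  unfold coulombGas
  rw [hd, withDensity_smul _ hmeas]
  have hint : ∫⁻ x, (ENNReal.ofReal (∏ k : Fin n, monomialMass V χ n k) •
      fun x : Fin n → ℂ => ENNReal.ofReal (‖slaterDet V χ n x‖ ^ 2)) x =
      ENNReal.ofReal (∏ k : Fin n, monomialMass V χ n k) *
        ∫⁻ x : Fin n → ℂ, ENNReal.ofReal (‖slaterDet V χ n x‖ ^ 2) := lintegral_const_mul _ hmeas
  rw [hint, hV.lintegral_norm_slaterDet_sq hχ hR hV_eq, smul_smul,
    ENNReal.mul_inv (Or.inl hc0) (Or.inl ENNReal.ofReal_ne_top), mul_comm, ← mul_assoc,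
    ENNReal.mul_inv_cancel hc0 ENNReal.ofReal_ne_top, one_mul]

theorem IsCirclePotential.lintegral_coulombGas (hV : IsCirclePotential V) (hχ : 0 < χ)
    (hR : 1 ≤ R) (hV_eq : ∀ r, R ≤ r → V r = Real.log r) (n : ℕ) {F : (Fin n → ℂ) → ℝ≥0∞}
    (hF : Measurable F) :
    ∫⁻ x, F x ∂(coulombGas V χ n) =
      (n.factorial : ℝ≥0∞)⁻¹ * ∫⁻ x, F x * ENNReal.ofReal (‖slaterDet V χ n x‖ ^ 2) := by
  have hmeas : Measurable fun x : Fin n → ℂ => ENNReal.ofReal (‖slaterDet V χ n x‖ ^ 2) :=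
    ((hV.continuous_slaterDet n).norm.pow 2).measurable.ennreal_ofReal
  rw [hV.coulombGas_eq hχ hR hV_eq, lintegral_smul_measure,
    lintegral_withDensity_eq_lintegral_mul _ hmeas hF, smul_eq_mul]
  exact congrArg _ (lintegral_congr fun x => mul_comm _ _)

theorem factorial_inv_mul_cancel (n : ℕ) :
    (n.factorial : ℝ≥0∞)⁻¹ * n.factorial = 1 :=
  ENNReal.inv_mul_cancel (by exact_mod_cast n.factorial_ne_zero) (ENNReal.natCast_ne_top _)

theorem IsCirclePotential.isProbabilityMeasure_coulombGas (hV : IsCirclePotential V) (hχ : 0 < χ)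
    (hR : 1 ≤ R) (hV_eq : ∀ r, R ≤ r → V r = Real.log r) (n : ℕ) :
    IsProbabilityMeasure (coulombGas V χ n) := by
  constructor
  rw [← lintegral_one, hV.lintegral_coulombGas hχ hR hV_eq n measurable_const]
  simp only [one_mul]
  rw [hV.lintegral_norm_slaterDet_sq hχ hR hV_eq, factorial_inv_mul_cancel]

/-- The factorial moments of the Coulomb gas. -/
theorem IsCirclePotential.lintegral_coulombGas_sum_embedding (hV : IsCirclePotential V)
    (hχ : 0 < χ) (hR : 1 ≤ R) (hV_eq : ∀ r, R ≤ r → V r = Real.log r) {n m : ℕ}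
    {C : Fin m → Set ℂ} (hC : ∀ i, MeasurableSet (C i)) :
    ∫⁻ x : Fin n → ℂ, (∑ f : Fin m ↪ Fin n, ∏ i, (C i).indicator (fun _ => (1 : ℝ≥0∞)) (x (f i)))
      ∂(coulombGas V χ n) =
    ∫⁻ x in Set.univ.pi C, ENNReal.ofReal
      (Matrix.of fun i j => kernelN V χ n (x i) (x j)).det.re
        ∂(Measure.pi fun _ : Fin m => (volume : Measure ℂ)) := by
  rw [hV.lintegral_coulombGas hχ hR hV_eq, hV.lintegral_slaterDet hχ hR hV_eq hC, ← mul_assoc,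
    factorial_inv_mul_cancel, one_mul]
  refine Finset.measurable_sum _ fun f _ => Finset.measurable_prod _ fun i _ => ?_
  exact (measurable_const.indicator (hC i)).comp (measurable_pi_apply _)

end Ensemble

/-! ### Convergence and domination of the kernels. -/

section KernelLimit

open ComplexConjugate

variable {V : ℝ → ℝ} {χ R : ℝ}

/-- The kernel `kernelN` outside the disk of radius `R`, up to a unimodular cocycle. -/
def kernelT (V : ℝ → ℝ) (χ : ℝ) (n : ℕ) (z w : ℂ) : ℂ :=
  ((‖z * conj w‖ ^ (-(χ + 1)) : ℝ) : ℂ) *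
    ∑' k : ℕ, if k < n then (((monomialMass V χ n (n - 1 - k))⁻¹ : ℝ) : ℂ) / (z * conj w) ^ k else 0

theorem kernelT_eq_sum_range (V : ℝ → ℝ) (χ : ℝ) (n : ℕ) (z w : ℂ) :
    kernelT V χ n z w = ((‖z * conj w‖ ^ (-(χ + 1)) : ℝ) : ℂ) *
      ∑ k ∈ Finset.range n, (((monomialMass V χ n (n - 1 - k))⁻¹ : ℝ) : ℂ) / (z * conj w) ^ k := by
  unfold kernelT
  congr 1
  rw [tsum_eq_sum (s := Finset.range n)]
  · exact Finset.sum_congr rfl fun k hk => if_pos (Finset.mem_range.1 hk)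
  · intro k hk
    exact if_neg (by simpa using hk)

/-- The unimodular cocycle relating `kernelN` and `kernelT`. -/
def phase (n : ℕ) (z : ℂ) : ℂ := z ^ (n - 1) / ((‖z‖ ^ (n - 1) : ℝ) : ℂ)

theorem phase_mul_conj (n : ℕ) {z : ℂ} (hz : z ≠ 0) : phase n z * conj (phase n z) = 1 := by
  rw [Complex.mul_conj, Complex.normSq_eq_norm_sq, phase, norm_div, norm_pow, Complex.norm_real,
    norm_pow, norm_norm, div_self (pow_ne_zero _ (norm_ne_zero_iff.2 hz))]
  simp

/-- Where V = log, the weight of each point is |z|^{-(χ+1)} |z|^{-(n-1)}. Reversing the order of the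
monomials factors out z^{n-1} and the conjugate of w^{n-1}, and these powers divided by their moduli
are pure phases. -/
theorem kernelN_eq_phase_mul_kernelT (hV : IsCirclePotential V) (hχ : 0 < χ) (hR : 1 ≤ R)
    (hV_eq : ∀ r, R ≤ r → V r = Real.log r) (n : ℕ) {z w : ℂ} (hz : R < ‖z‖) (hw : R < ‖w‖) :
    kernelN V χ n z w = phase n z * kernelT V χ n z w * conj (phase n w) := by
  have hz0 : 0 < ‖z‖ := by linarith
  have hw0 : 0 < ‖w‖ := by linarith
  have hzne : z ≠ 0 := norm_pos_iff.1 hz0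
  have hwne : w ≠ 0 := norm_pos_iff.1 hw0
  have hcw : conj w ≠ 0 := (map_ne_zero _).2 hwne
  rw [kernelT_eq_sum_range, kernelN, Fin.sum_univ_eq_sum_range (fun k =>
    weightedMonomial V χ n k z * conj (weightedMonomial V χ n k w)), ← Finset.sum_range_reflect,
    Finset.mul_sum, Finset.mul_sum, Finset.sum_mul]
  refine Finset.sum_congr rfl fun k hk => ?_
  have hk' : k < n := Finset.mem_range.1 hk
  have hm := hV.monomialMass_pos hχ hR hV_eq (n := n) (k := n - 1 - k) (by omega)
  rw [weightedMonomial_mul_conj, hV_eq _ hz.le, hV_eq _ hw.le, ← mul_inv,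
    Real.mul_self_sqrt hm.le]
  have he : ∀ r : ℝ, 0 < r →
      Real.exp (-(n + χ) * Real.log r) = r ^ (-(χ + 1)) * (r ^ (n - 1))⁻¹ := by
    intro r hr
    rw [← Real.rpow_natCast, ← Real.rpow_neg hr.le, ← Real.rpow_add hr, Real.rpow_def_of_pos hr]
    congr 1
    rw [Nat.cast_sub (by omega)]
    push_cast
    ring
  rw [he _ hz0, he _ hw0, norm_mul, RCLike.norm_conj, Real.mul_rpow hz0.le hw0.le, phase, phase,
    map_div₀, Complex.conj_ofReal]
  have hsplit : z ^ (n - 1 - k) * conj (w ^ (n - 1 - k)) =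
      z ^ (n - 1) * conj (w ^ (n - 1)) / (z * conj w) ^ k := by
    rw [eq_div_iff (pow_ne_zero _ (mul_ne_zero hzne hcw)), map_pow, map_pow, ← mul_pow, ← mul_pow,
      ← pow_add]
    congr 1; omega
  rw [hsplit]
  push_cast
  field_simp

theorem det_kernelN_eq_det_kernelT (hV : IsCirclePotential V) (hχ : 0 < χ) (hR : 1 ≤ R)
    (hV_eq : ∀ r, R ≤ r → V r = Real.log r) (n : ℕ) {m : ℕ} {x : Fin m → ℂ}
    (hx : ∀ i, R < ‖x i‖) :
    (Matrix.of fun i j => kernelN V χ n (x i) (x j)).det =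
      (Matrix.of fun i j => kernelT V χ n (x i) (x j)).det := by
  have h : (Matrix.of fun i j => kernelN V χ n (x i) (x j)) = Matrix.of fun i j =>
      conj (phase n (x j)) *
        (Matrix.of fun i j => phase n (x i) * (Matrix.of fun i j => kernelT V χ n (x i) (x j)) i j)
          i j := by
    ext i j
    simp only [Matrix.of_apply]
    rw [kernelN_eq_phase_mul_kernelT hV hχ hR hV_eq n (hx i) (hx j), mul_comm]
  rw [h, Matrix.det_mul_row, Matrix.det_mul_column, ← mul_assoc, ← Finset.prod_mul_distrib,
    Finset.prod_eq_one, one_mul]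
  intro i _
  rw [mul_comm]
  exact phase_mul_conj n (norm_pos_iff.1 (by linarith [hx i]))

theorem tailMass_inv (χ : ℝ) (k : ℕ) (hR : 1 ≤ R) :
    (tailMass χ k R)⁻¹ = (k + χ) * R ^ (2 * (k : ℝ) + 2 * χ) / Real.pi := by
  unfold tailMass
  rw [Real.rpow_neg (by linarith), inv_div, show 2 * (k : ℝ) + 2 * χ = 2 * (k + χ) by ring]
  have : (0 : ℝ) < R ^ (2 * (k + χ)) := Real.rpow_pos_of_pos (by linarith) _
  have := Real.pi_pos
  field_simp

/-- Up to a constant the terms are (k + χ) q^k with q = R²/s < 1. -/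
theorem summable_tailMass_inv (hχ : 0 < χ) (hR : 1 ≤ R) {s : ℝ} (hs : R ^ 2 < s) :
    Summable fun k : ℕ => (tailMass χ k R)⁻¹ / s ^ k := by
  have hR2 : 0 < R ^ 2 := by positivity
  have hs0 : 0 < s := hR2.trans hs
  have hq0 : 0 ≤ R ^ 2 / s := by positivity
  have hq1 : ‖R ^ 2 / s‖ < 1 := by
    rw [Real.norm_eq_abs, abs_of_nonneg hq0]; exact (div_lt_one hs0).2 hs
  have h1 := summable_pow_mul_geometric_of_norm_lt_one 1 hq1
  have h2 := (summable_geometric_of_norm_lt_one hq1).mul_left χ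
  refine ((h1.add h2).mul_left (R ^ (2 * χ) / Real.pi)).congr fun k => ?_
  rw [tailMass_inv χ k hR, Real.rpow_add (by linarith), div_pow, ← pow_mul,
    show (R : ℝ) ^ (2 * (k : ℝ)) = R ^ (2 * k) by rw [← Real.rpow_natCast]; push_cast; rfl]
  field_simp

theorem kernelB_eq (χ : ℝ) (hR : 1 ≤ R) (z w : Exterior R) :
    kernelB χ R z w = ((‖(z : ℂ) * conj (w : ℂ)‖ ^ (-(χ + 1)) : ℝ) : ℂ) *
      ∑' k : ℕ, (((tailMass χ k R)⁻¹ : ℝ) : ℂ) / ((z : ℂ) * conj (w : ℂ)) ^ k := by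
  unfold kernelB
  simp_rw [tailMass_inv χ _ hR]
  rw [Real.rpow_neg (norm_nonneg _)]
  have : ∀ k : ℕ, ((((k : ℝ) + χ) * R ^ (2 * (k : ℝ) + 2 * χ) / Real.pi : ℝ) : ℂ) /
      ((z : ℂ) * conj (w : ℂ)) ^ k = ((Real.pi : ℝ) : ℂ)⁻¹ *
      (((((k : ℝ) + χ) * R ^ (2 * (k : ℝ) + 2 * χ) : ℝ) : ℂ) / ((z : ℂ) * conj (w : ℂ)) ^ k) := by
    intro k
    push_cast
    ring
  simp_rw [this, tsum_mul_left]
  simp only [RCLike.star_def]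
  push_cast
  ring

theorem sq_lt_norm_mul_conj (hR : 1 ≤ R) {z w : ℂ} (hz : R < ‖z‖) (hw : R < ‖w‖) :
    R ^ 2 < ‖z * conj w‖ := by
  rw [norm_mul, RCLike.norm_conj]; nlinarith

/-- Dominated convergence for series: the coefficients converge with the masses and are at most 1 /
`tailMass χ k R`, and |z w| > R² makes the dominating series summable. -/
theorem tendsto_kernelT (hV : IsCirclePotential V) (hχ : 0 < χ) (hR : 1 ≤ R)
    (hV_eq : ∀ r, R ≤ r → V r = Real.log r)
    (hV_gt : ∀ r, 1 < r → r < R → Real.log r < V r) (z w : Exterior R) :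
    Tendsto (fun n => kernelT V χ n z w) atTop (𝓝 (kernelB χ R z w)) := by
  rw [kernelB_eq χ hR]
  refine Tendsto.const_mul _ ?_
  refine tendsto_tsum_of_dominated_convergence
    (summable_tailMass_inv hχ hR (sq_lt_norm_mul_conj hR z.2 w.2)) ?_ ?_
  · intro k
    have h1 := (hV.tendsto_monomialMass hχ hR hV_eq hV_gt k).inv₀
      (tailMass_pos hχ k (by linarith)).ne'
    have h2 : Tendsto (fun n : ℕ => (((monomialMass V χ n (n - 1 - k))⁻¹ : ℝ) : ℂ) /
        ((z : ℂ) * conj (w : ℂ)) ^ k) atTop (𝓝 ((((tailMass χ k R)⁻¹ : ℝ) : ℂ) /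
        ((z : ℂ) * conj (w : ℂ)) ^ k)) :=
      ((Complex.continuous_ofReal.tendsto _).comp h1).div_const _
    refine h2.congr' ?_
    filter_upwards [eventually_gt_atTop k] with n hn
    rw [if_pos hn]
  · refine Eventually.of_forall fun n k => ?_
    split_ifs with hk
    · rw [norm_div, norm_pow, Complex.norm_real, Real.norm_eq_abs, abs_of_pos
        (inv_pos.2 (hV.monomialMass_pos hχ hR hV_eq (by omega)))]
      gcongr
      · exact tailMass_pos hχ k (by linarith)
      · exact hV.tailMass_le_monomialMass hχ hR hV_eq hk
    · rw [norm_zero]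
      have := tailMass_pos hχ k (t := R) (by linarith)
      positivity

/-- The density `K(z, z)` of the first correlation measure of the limiting process. -/
def densityB (χ R : ℝ) (z : ℂ) : ℝ :=
  ‖z‖ ^ (-(2 * (χ + 1))) * ∑' k : ℕ, (tailMass χ k R)⁻¹ / (‖z‖ ^ 2) ^ k

theorem densityB_pos (hχ : 0 < χ) (hR : 1 ≤ R) {z : ℂ} (hz : R < ‖z‖) : 0 < densityB χ R z := by
  have hz0 : 0 < ‖z‖ := by linarith
  have ht := fun k => tailMass_pos hχ k (t := R) (by linarith)
  refine mul_pos (Real.rpow_pos_of_pos hz0 _) ?_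
  refine (summable_tailMass_inv hχ hR (by nlinarith)).tsum_pos (fun k => ?_) 0 ?_
  · have := ht k; positivity
  · have := ht 0; positivity

theorem kernelT_self_re_le (hV : IsCirclePotential V) (hχ : 0 < χ) (hR : 1 ≤ R)
    (hV_eq : ∀ r, R ≤ r → V r = Real.log r) (n : ℕ) {z : ℂ} (hz : R < ‖z‖) :
    (kernelT V χ n z z).re ≤ densityB χ R z := by
  have hz0 : 0 < ‖z‖ := by linarith
  have ht := fun k => tailMass_pos hχ k (t := R) (by linarith)
  have h : kernelT V χ n z z = ((‖z‖ ^ (-(2 * (χ + 1))) *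
      ∑ k ∈ Finset.range n, (monomialMass V χ n (n - 1 - k))⁻¹ / (‖z‖ ^ 2) ^ k : ℝ) : ℂ) := by
    rw [kernelT_eq_sum_range, Complex.mul_conj, Complex.normSq_eq_norm_sq, Complex.norm_real,
      Real.norm_eq_abs, abs_of_nonneg (by positivity), ← Real.rpow_natCast, ← Real.rpow_mul hz0.le]
    push_cast
    rw [show (2 : ℝ) * -(χ + 1) = -(2 * (χ + 1)) by ring]
  rw [h, Complex.ofReal_re, densityB]
  refine mul_le_mul_of_nonneg_left ?_ (by positivity)
  calc _ ≤ ∑ k ∈ Finset.range n, (tailMass χ k R)⁻¹ / (‖z‖ ^ 2) ^ k := by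
        refine Finset.sum_le_sum fun k hk => ?_
        gcongr
        · exact ht k
        · exact hV.tailMass_le_monomialMass hχ hR hV_eq (Finset.mem_range.1 hk)
    _ ≤ _ := (summable_tailMass_inv hχ hR (by nlinarith)).sum_le_tsum _ fun k _ => by
        have := ht k; positivity

/-- Hadamard's inequality, the cocycle having no effect on the diagonal. The majorant does not
depend on n, so it dominates the correlation functions of all orders uniformly in n. -/
theorem det_kernelN_re_le (hV : IsCirclePotential V) (hχ : 0 < χ) (hR : 1 ≤ R)
    (hV_eq : ∀ r, R ≤ r → V r = Real.log r) (n : ℕ) {m : ℕ} {x : Fin m → ℂ}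
    (hx : ∀ i, R < ‖x i‖) :
    (Matrix.of fun i j => kernelN V χ n (x i) (x j)).det.re ≤ ∏ i, densityB χ R (x i) := by
  refine (posSemidef_kernelN V χ n x).det_re_le_prod (fun i => densityB_pos hχ hR (hx i)) ?_
  intro i
  rw [Matrix.of_apply, kernelN_eq_phase_mul_kernelT hV hχ hR hV_eq n (hx i) (hx i),
    mul_right_comm, phase_mul_conj n (norm_pos_iff.1 (by linarith [hx i])), one_mul]
  exact kernelT_self_re_le hV hχ hR hV_eq n (hx i)

theorem tendsto_det_kernelN (hV : IsCirclePotential V) (hχ : 0 < χ) (hR : 1 ≤ R)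
    (hV_eq : ∀ r, R ≤ r → V r = Real.log r)
    (hV_gt : ∀ r, 1 < r → r < R → Real.log r < V r) {m : ℕ} (x : Fin m → Exterior R) :
    Tendsto (fun n => (Matrix.of fun i j => kernelN V χ n (x i) (x j)).det) atTop
      (𝓝 (Matrix.of fun i j => kernelB χ R (x i) (x j)).det) := by
  have h : ∀ n, (Matrix.of fun i j => kernelN V χ n (x i) (x j)).det =
      (Matrix.of fun i j => kernelT V χ n (x i) (x j)).det := fun n =>
    det_kernelN_eq_det_kernelT (x := fun i => (x i : ℂ)) hV hχ hR hV_eq n fun i => (x i).2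
  simp_rw [h]
  have hc : Continuous fun M : Matrix (Fin m) (Fin m) ℂ => M.det :=
    Continuous.matrix_det continuous_id
  refine (hc.tendsto _).comp ?_
  exact tendsto_pi_nhds.2 fun i => tendsto_pi_nhds.2 fun j =>
    tendsto_kernelT hV hχ hR hV_eq hV_gt (x i) (x j)

theorem measurable_kernelT (V : ℝ → ℝ) (χ : ℝ) (n : ℕ) :
    Measurable fun p : ℂ × ℂ => kernelT V χ n p.1 p.2 := by
  simp only [kernelT_eq_sum_range]
  have h : Measurable fun p : ℂ × ℂ => p.1 * conj p.2 :=
    measurable_fst.mul (Complex.continuous_conj.measurable.comp measurable_snd)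
  refine (Complex.measurable_ofReal.comp (h.norm.pow_const _)).mul ?_
  refine Finset.measurable_sum _ fun k _ => ?_
  exact measurable_const.div (h.pow_const _)

theorem Measurable.comp_subtype_coe_prod {α : Type*} [MeasurableSpace α] {S : Set α}
    {f : α → α → ℂ} (hf : Measurable fun p : α × α => f p.1 p.2) :
    Measurable fun p : S × S => f p.1 p.2 := by
  have h : Measurable fun p : S × S => ((p.1 : α), (p.2 : α)) :=
    (measurable_subtype_coe.comp measurable_fst).prodMk
      (measurable_subtype_coe.comp measurable_snd)
  exact hf.comp h

theorem measurable_kernelB (hV : IsCirclePotential V) (hχ : 0 < χ) (hR : 1 ≤ R)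
    (hV_eq : ∀ r, R ≤ r → V r = Real.log r)
    (hV_gt : ∀ r, 1 < r → r < R → Real.log r < V r) :
    Measurable (Function.uncurry (kernelB χ R)) := by
  have h2 : ∀ n, Measurable fun p : Exterior R × Exterior R => kernelT V χ n p.1 p.2 :=
    fun n => (measurable_kernelT V χ n).comp_subtype_coe_prod
  have h3 : Tendsto (fun n (p : Exterior R × Exterior R) => kernelT V χ n p.1 p.2) atTop
      (𝓝 fun p => kernelB χ R p.1 p.2) :=
    tendsto_pi_nhds.2 fun p => tendsto_kernelT hV hχ hR hV_eq hV_gt p.1 p.2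
  exact measurable_of_tendsto_metrizable h2 h3

/-- Beyond radius ρ the series in `densityB` is at most its value at ρ, and |z|^{-2-2χ} is
integrable at infinity. -/
theorem setLIntegral_densityB_lt_top (hχ : 0 < χ) (hR : 1 ≤ R) {ρ : ℝ} (hρ : R < ρ) :
    ∫⁻ z in {z : ℂ | ρ < ‖z‖}, ENNReal.ofReal (densityB χ R z) < ∞ := by
  have hm : MeasurableSet {z : ℂ | ρ < ‖z‖} :=
    (isOpen_lt continuous_const continuous_norm).measurableSet
  have ht := fun k => tailMass_pos hχ k (t := R) (by linarith)
  have hsum := summable_tailMass_inv hχ hR (by nlinarith : R ^ 2 < ρ ^ 2)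
  set C : ℝ := ∑' k : ℕ, (tailMass χ k R)⁻¹ / (ρ ^ 2) ^ k with hC
  have hC0 : 0 ≤ C := tsum_nonneg fun k => by have := ht k; positivity
  let f : ℂ → ℝ := {z : ℂ | ρ < ‖z‖}.indicator fun z => ‖z‖ ^ (-(2 + 2 * χ)) * C
  have hf0 : ∀ z, 0 ≤ f z := fun z => Set.indicator_nonneg (fun z _ => by positivity) z
  have hfint : Integrable f := by
    refine integrable_of_norm_le_rpow hχ ?_ hf0 (C := C) ?_ ?_
    · exact (((measurable_norm.pow_const _).mul_const _).indicator hm).aestronglyMeasurable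
    · intro z hz
      have : z ∉ {z : ℂ | ρ < ‖z‖} := by
        simp only [Set.mem_ofPred_eq, not_lt]; linarith
      simp only [f, Set.indicator_of_notMem this]
      exact hC0
    · intro z _
      refine (Set.indicator_le_self' (fun z _ => by positivity) z).trans_eq (mul_comm _ _)
  calc ∫⁻ z in {z : ℂ | ρ < ‖z‖}, ENNReal.ofReal (densityB χ R z)
      ≤ ∫⁻ z in {z : ℂ | ρ < ‖z‖}, ENNReal.ofReal (f z) := by
        refine setLIntegral_mono' hm fun z hz => ENNReal.ofReal_le_ofReal ?_
        have hz' : ρ < ‖z‖ := hz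
        simp only [f, Set.indicator_of_mem hz, densityB]
        rw [show -(2 * (χ + 1)) = -(2 + 2 * χ) by ring]
        refine mul_le_mul_of_nonneg_left ?_ (by positivity)
        refine (summable_tailMass_inv hχ hR (by nlinarith)).tsum_le_tsum (fun k => ?_) hsum
        have := ht k
        have h0 : 0 < ρ := by linarith
        gcongr
    _ ≤ ∫⁻ z, ENNReal.ofReal (f z) := setLIntegral_le_lintegral _ _
    _ < ∞ := hfint.lintegral_lt_top

end KernelLimit

/-! ### Distribution function of the maximal modulus. -/

section MaxModulus

open ComplexConjugate

variable {V : ℝ → ℝ} {χ R : ℝ}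

/-- The monomials stay orthogonal on the disk of radius t, so in Andréief's identity only σ = τ
contributes. Each of the n! permutations gives the product of the fractions of the masses inside the
disk, as if the moduli were independent. -/
theorem coulombGas_forall_norm_le (hV : IsCirclePotential V) (hχ : 0 < χ) (hR : 1 ≤ R)
    (hV_eq : ∀ r, R ≤ r → V r = Real.log r) (n : ℕ) {t : ℝ} (ht : R ≤ t) :
    (coulombGas V χ n).real {x | ∀ i, ‖x i‖ ≤ t} =
      ∏ k ∈ Finset.range n, (1 - tailMass χ k t / monomialMass V χ n (n - 1 - k)) := by
  have hφ : ∀ j k : Fin n, Integrable (fun z => weightedMonomial V χ n j z *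
      conj (weightedMonomial V χ n k z)) := fun j k =>
    hV.integrable_weightedMonomial_mul_conj hχ hR hV_eq j.2 k.2
  have hmt : MeasurableSet {z : ℂ | ‖z‖ ≤ t} :=
    (isClosed_le continuous_norm continuous_const).measurableSet
  have hg : ∀ (i j k : Fin n), Integrable (fun z : ℂ =>
      (Set.Iic t).indicator (fun _ => (1 : ℂ)) ‖z‖ * (weightedMonomial V χ n j z *
      conj (weightedMonomial V χ n k z))) := by
    intro i j k
    refine ((hφ j k).indicator hmt).congr (Eventually.of_forall fun z => ?_)
    by_cases h : ‖z‖ ≤ t <;> simp [h]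
  obtain ⟨hint, heq⟩ := integral_prod_mul_det_mul_conj_det (ν := (volume : Measure ℂ))
    (fun k : Fin n => weightedMonomial V χ n k)
    (fun _ z => (Set.Iic t).indicator (fun _ => (1 : ℂ)) ‖z‖) hg
  set p : ℕ → ℝ := fun k => (monomialMass V χ n k)⁻¹ *
      ∫ z : ℂ, (Set.Iic t).indicator (fun r => radialWeight V χ n k r) ‖z‖ with hp
  have hpe : ∀ j k : Fin n, ∫ z : ℂ, (Set.Iic t).indicator (fun _ => (1 : ℂ)) ‖z‖ *
      (weightedMonomial V χ n j z * conj (weightedMonomial V χ n k z)) =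
      if j = k then ((p k : ℝ) : ℂ) else 0 := by
    intro j k
    split_ifs with h
    · subst h
      exact integral_weightedMonomial_mul_conj_self (hV.monomialMass_pos hχ hR hV_eq j.2)
    · exact integral_indicator_weightedMonomial_of_ne V χ n (by simpa [Fin.ext_iff] using h) _
  have hval : ∑ σ : Equiv.Perm (Fin n), ∑ τ : Equiv.Perm (Fin n),
      ((Equiv.Perm.sign σ : ℤ) : ℂ) * ((Equiv.Perm.sign τ : ℤ) : ℂ) *
        ∏ l, (if σ l = τ l then ((p (τ l) : ℝ) : ℂ) else 0) =
      ((n.factorial * ∏ k : Fin n, p k : ℝ) : ℂ) := by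
    have : ∀ σ : Equiv.Perm (Fin n), ∑ τ : Equiv.Perm (Fin n),
        ((Equiv.Perm.sign σ : ℤ) : ℂ) * ((Equiv.Perm.sign τ : ℤ) : ℂ) *
        ∏ l, (if σ l = τ l then ((p (τ l) : ℝ) : ℂ) else 0) = ((∏ k : Fin n, p k : ℝ) : ℂ) := by
      intro σ
      rw [Finset.sum_eq_single σ]
      · simp only [if_true]
        rw [Equiv.prod_comp σ (fun k : Fin n => ((p k : ℝ) : ℂ))]
        rcases Int.units_eq_one_or (Equiv.Perm.sign σ) with h | h <;> simp [h]
      · intro τ _ hτ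
        obtain ⟨l, hl⟩ : ∃ l, σ l ≠ τ l := by
          by_contra hc
          push Not at hc
          exact hτ (Equiv.ext fun l => (hc l).symm)
        rw [Finset.prod_eq_zero (Finset.mem_univ l) (if_neg hl), mul_zero]
      · simp
    simp_rw [this]
    simp [Fintype.card_perm]
  simp_rw [hpe] at heq
  rw [hval] at heq
  have hset : MeasurableSet {x : Fin n → ℂ | ∀ i, ‖x i‖ ≤ t} := by
    have : {x : Fin n → ℂ | ∀ i, ‖x i‖ ≤ t} = Set.univ.pi fun _ => {z : ℂ | ‖z‖ ≤ t} := by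
      ext x; simp
    rw [this]
    exact MeasurableSet.univ_pi fun _ => hmt
  have hprob : coulombGas V χ n {x | ∀ i, ‖x i‖ ≤ t} = ENNReal.ofReal (∏ k : Fin n, p k) := by
    rw [← lintegral_indicator_one hset, hV.lintegral_coulombGas hχ hR hV_eq n
      (measurable_one.indicator hset)]
    have hL : ∀ x : Fin n → ℂ, {x : Fin n → ℂ | ∀ i, ‖x i‖ ≤ t}.indicator 1 x *
        ENNReal.ofReal (‖slaterDet V χ n x‖ ^ 2) = ENNReal.ofReal
        ((∏ l, (Set.Iic t).indicator (fun _ => (1 : ℂ)) ‖x l‖) *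
        ((Matrix.of fun k i : Fin n => weightedMonomial V χ n k (x i)).det *
        conj (Matrix.of fun k i : Fin n => weightedMonomial V χ n k (x i)).det)).re ∧
        0 ≤ ((∏ l, (Set.Iic t).indicator (fun _ => (1 : ℂ)) ‖x l‖) *
        ((Matrix.of fun k i : Fin n => weightedMonomial V χ n k (x i)).det *
        conj (Matrix.of fun k i : Fin n => weightedMonomial V χ n k (x i)).det)).re := by
      intro x
      rw [Complex.mul_conj, Complex.normSq_eq_norm_sq]
      by_cases h : ∀ i, ‖x i‖ ≤ t
      · rw [Set.indicator_of_mem (by exact h), Finset.prod_eq_one, Pi.one_apply, one_mul, one_mul,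
          Complex.ofReal_re]
        · exact ⟨rfl, by positivity⟩
        · intro l _
          rw [Set.indicator_of_mem (by exact h l)]
      · rw [Set.indicator_of_notMem (by exact h)]
        push Not at h
        obtain ⟨i, hi⟩ := h
        have hi' : ‖x i‖ ∉ Set.Iic t := by simpa using hi
        rw [Finset.prod_eq_zero (Finset.mem_univ i) (Set.indicator_of_notMem hi' _)]
        simp
    simp_rw [fun x => (hL x).1]
    rw [show (volume : Measure (Fin n → ℂ)) = Measure.pi fun _ => volume from rfl,
      lintegral_ofReal_re_eq hint fun x => (hL x).2, heq, Complex.ofReal_re,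
      ENNReal.ofReal_mul (Nat.cast_nonneg _), ENNReal.ofReal_natCast, ← mul_assoc,
      factorial_inv_mul_cancel, one_mul]
  have hp0 : 0 ≤ ∏ k : Fin n, p k := by
    refine Finset.prod_nonneg fun k _ => mul_nonneg
      (inv_nonneg.2 (hV.monomialMass_pos hχ hR hV_eq k.2).le) (integral_nonneg fun z => ?_)
    exact Set.indicator_apply_nonneg fun _ => radialWeight_nonneg _ _ _ _ (norm_nonneg z)
  rw [Measure.real, hprob, ENNReal.toReal_ofReal hp0, Fin.prod_univ_eq_prod_range,
    ← Finset.prod_range_reflect]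
  refine Finset.prod_congr rfl fun k hk => ?_
  have hk' : k < n := Finset.mem_range.1 hk
  have hm := hV.monomialMass_pos hχ hR hV_eq (n := n) (k := n - 1 - k) (by omega)
  have hadd := hV.monomialMass_eq_add hχ hR hV_eq hk' ht
  have hind : ∫ z : ℂ, (Set.Iic t).indicator (fun r => radialWeight V χ n (n - 1 - k) r) ‖z‖ =
      ∫ z in {z : ℂ | ‖z‖ ≤ t}, radialWeight V χ n (n - 1 - k) ‖z‖ := by
    rw [← integral_indicator hmt]
    rfl
  simp only [hp]
  rw [hind, eq_sub_of_add_eq hadd.symm]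
  field_simp

theorem summable_rpow_div (χ : ℝ) (hR : 1 ≤ R) {t : ℝ} (ht : R < t) :
    Summable fun k : ℕ => (R / t) ^ (2 * (k : ℝ) + 2 * χ) := by
  have ht0 : 0 < t := by linarith
  have hq0 : 0 < R / t := by positivity
  have hq1 : R / t < 1 := (div_lt_one ht0).2 ht
  have : ∀ k : ℕ, (R / t) ^ (2 * (k : ℝ) + 2 * χ) = ((R / t) ^ 2) ^ k * (R / t) ^ (2 * χ) := by
    intro k
    rw [Real.rpow_add hq0, ← pow_mul, ← Real.rpow_natCast]
    push_cast; rfl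
  simp_rw [this]
  exact (summable_geometric_of_lt_one (by positivity)
    (pow_lt_one₀ hq0.le hq1 (by norm_num))).mul_right _

theorem multipliable_one_sub_rpow (χ : ℝ) (hR : 1 ≤ R) {t : ℝ} (ht : R ≤ t) :
    Multipliable (fun k : ℕ => 1 - (R / t) ^ (2 * (k : ℝ) + 2 * χ)) := by
  rcases eq_or_lt_of_le ht with h | h
  · subst h
    have : (fun k : ℕ => 1 - (R / R) ^ (2 * (k : ℝ) + 2 * χ)) = fun _ => 0 := by
      ext k; rw [div_self (by linarith)]; simp
    rw [this]
    exact (hasProd_zero_of_exists_eq_zero ⟨0, rfl⟩).multipliable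
  · have := multipliable_one_add_of_summable (f := fun k : ℕ => -(R / t) ^ (2 * (k : ℝ) + 2 * χ))
      (by simpa using (summable_rpow_div χ hR h).norm)
    simpa [sub_eq_add_neg] using this

theorem tailMass_div_tailMass (hχ : 0 < χ) (hR : 1 ≤ R) {t : ℝ} (ht : R ≤ t) (k : ℕ) :
    tailMass χ k t / tailMass χ k R = (R / t) ^ (2 * (k : ℝ) + 2 * χ) := by
  have hk0 : (0 : ℝ) ≤ k := Nat.cast_nonneg k
  have h1 : (0 : ℝ) < R ^ (2 * (k + χ)) := Real.rpow_pos_of_pos (by linarith) _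
  have h2 : (0 : ℝ) < t ^ (2 * (k + χ)) := Real.rpow_pos_of_pos (by linarith) _
  have h3 : 0 < k + χ := by linarith
  have := Real.pi_pos
  rw [show 2 * (k : ℝ) + 2 * χ = 2 * (k + χ) by ring, Real.div_rpow (by linarith) (by linarith)]
  unfold tailMass
  rw [Real.rpow_neg (by linarith), Real.rpow_neg (by linarith)]
  field_simp

/-- For t > R this is dominated convergence for products, with the summable bound (R/t)^{2k+2χ}. For
t = R this bound is not summable, but the factor k = 0 alone tends to zero while the others stay in
[0, 1]. -/
theorem tendsto_coulombGas_forall_norm_le (hV : IsCirclePotential V) (hχ : 0 < χ) (hR : 1 ≤ R)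
    (hV_eq : ∀ r, R ≤ r → V r = Real.log r)
    (hV_gt : ∀ r, 1 < r → r < R → Real.log r < V r) {t : ℝ} (ht : R ≤ t) :
    Tendsto (fun n => (coulombGas V χ n).real {x | ∀ i, ‖x i‖ ≤ t}) atTop
      (𝓝 (∏' k : ℕ, (1 - (R / t) ^ (2 * (k : ℝ) + 2 * χ)))) := by
  simp_rw [fun n => coulombGas_forall_norm_le hV hχ hR hV_eq n ht]
  have hmass := fun (n k : ℕ) (h : k < n) =>
    hV.monomialMass_pos hχ hR hV_eq (n := n) (k := n - 1 - k) (by omega)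
  have htail := fun k : ℕ => tailMass_pos hχ k (t := t) (by linarith)
  have htailR := fun k : ℕ => tailMass_pos hχ k (t := R) (by linarith)
  have hratio : ∀ n k : ℕ, k < n → 0 ≤ tailMass χ k t / monomialMass V χ n (n - 1 - k) ∧
      tailMass χ k t / monomialMass V χ n (n - 1 - k) ≤ (R / t) ^ (2 * (k : ℝ) + 2 * χ) := by
    intro n k hk
    refine ⟨div_nonneg (htail k).le (hmass n k hk).le, ?_⟩
    rw [← tailMass_div_tailMass hχ hR ht]
    exact div_le_div_of_nonneg_left (htail k).le (htailR k)
      (hV.tailMass_le_monomialMass hχ hR hV_eq hk)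
  have hlim : ∀ k : ℕ, Tendsto (fun n : ℕ => tailMass χ k t / monomialMass V χ n (n - 1 - k)) atTop
      (𝓝 ((R / t) ^ (2 * (k : ℝ) + 2 * χ))) := by
    intro k
    rw [← tailMass_div_tailMass hχ hR ht]
    exact tendsto_const_nhds.div (hV.tendsto_monomialMass hχ hR hV_eq hV_gt k) (htailR k).ne'
  have hle1 : ∀ k : ℕ, (R / t) ^ (2 * (k : ℝ) + 2 * χ) ≤ 1 := by
    intro k
    refine Real.rpow_le_one (div_nonneg (by linarith) (by linarith))
      ((div_le_one (by linarith)).2 ht) (by positivity)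
  rcases eq_or_lt_of_le ht with h | h
  · subst h
    have hz : (∏' k : ℕ, (1 - (R / R) ^ (2 * (k : ℝ) + 2 * χ))) = 0 := by
      have : (fun k : ℕ => 1 - (R / R) ^ (2 * (k : ℝ) + 2 * χ)) = fun _ => 0 := by
        ext k; rw [div_self (by linarith)]; simp
      rw [this]
      exact tprod_of_exists_eq_zero ⟨0, rfl⟩
    rw [hz]
    have h0 := (hlim 0).const_sub 1
    rw [div_self (by linarith), Real.one_rpow, sub_self] at h0
    refine squeeze_zero' (Eventually.of_forall fun n => ?_) ?_ h0
    · refine Finset.prod_nonneg fun k hk => ?_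
      have := hratio n k (Finset.mem_range.1 hk)
      linarith [hle1 k]
    · filter_upwards [eventually_gt_atTop 0] with n hn
      rw [← Finset.mul_prod_erase _ _ (Finset.mem_range.2 hn)]
      have h1 := hratio n 0 hn
      refine mul_le_of_le_one_right (by linarith [hle1 0]) ?_
      refine Finset.prod_le_one (fun k hk => ?_) (fun k hk => ?_)
      · have := hratio n k (Finset.mem_range.1 (Finset.mem_of_mem_erase hk))
        linarith [hle1 k]
      · have := hratio n k (Finset.mem_range.1 (Finset.mem_of_mem_erase hk))
        linarith
  · have key := tendsto_tprod_one_add_of_dominated_convergence (𝓕 := atTop)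
      (f := fun (n k : ℕ) => if k < n then -(tailMass χ k t / monomialMass V χ n (n - 1 - k)) else 0)
      (g := fun k : ℕ => -(R / t) ^ (2 * (k : ℝ) + 2 * χ)) (summable_rpow_div χ hR h) ?_ ?_
    · simp only [← sub_eq_add_neg] at key
      refine key.congr fun n => ?_
      rw [tprod_eq_prod (s := Finset.range n)]
      · refine Finset.prod_congr rfl fun k hk => ?_
        rw [if_pos (Finset.mem_range.1 hk), sub_eq_add_neg]
      · intro k hk
        rw [if_neg (by simpa using hk), add_zero]
    · intro k
      refine (hlim k).neg.congr' ?_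
      filter_upwards [eventually_gt_atTop k] with n hn
      rw [if_pos hn]
    · refine Eventually.of_forall fun n k => ?_
      have h0 : 0 ≤ (R / t) ^ (2 * (k : ℝ) + 2 * χ) :=
        Real.rpow_nonneg (div_nonneg (by linarith) (by linarith)) _
      split_ifs with hk
      · rw [norm_neg, Real.norm_eq_abs, abs_of_nonneg (hratio n k hk).1]
        exact (hratio n k hk).2
      · simpa using h0

end MaxModulus

/-! ### Partitions of compact sets into small cells. -/

section Cells

variable {X : Type*} [MetricSpace X] [SecondCountableTopology X] [Nonempty X]

theorem exists_dist_denseSeq_lt (k : ℕ) (x : X) :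
    ∃ i, dist x (TopologicalSpace.denseSeq X i) < 1 / ((k : ℝ) + 1) := by
  have h := (TopologicalSpace.denseRange_denseSeq X).exists_dist_lt x
    (Nat.one_div_pos_of_nat (α := ℝ) (n := k))
  exact h

open Classical in
/-- The index of the first point of a dense sequence at distance less than `1 / (k + 1)`. -/
def cellIndex (k : ℕ) (x : X) : ℕ := Nat.find (exists_dist_denseSeq_lt k x)

theorem dist_lt_of_cellIndex_eq {k : ℕ} {x y : X} (h : cellIndex k x = cellIndex k y) :
    dist x y < 2 / ((k : ℝ) + 1) := by
  classical
  have hx := Nat.find_spec (exists_dist_denseSeq_lt k x)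
  have hy := Nat.find_spec (exists_dist_denseSeq_lt k y)
  change dist x (TopologicalSpace.denseSeq X (cellIndex k x)) < _ at hx
  change dist y (TopologicalSpace.denseSeq X (cellIndex k y)) < _ at hy
  rw [h] at hx
  calc dist x y ≤ _ := dist_triangle_right x y _
    _ < 1 / ((k : ℝ) + 1) + 1 / ((k : ℝ) + 1) := add_lt_add hx hy
    _ = _ := by ring

theorem measurable_cellIndex [MeasurableSpace X] [BorelSpace X] (k : ℕ) :
    Measurable (cellIndex (X := X) k) := by
  classical
  refine measurable_find (exists_dist_denseSeq_lt k) fun i => ?_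
  exact (isOpen_lt (continuous_id.dist continuous_const) continuous_const).measurableSet

theorem exists_forall_cellIndex_lt {K : Set X} (hK : IsCompact K) (k : ℕ) :
    ∃ N, ∀ x ∈ K, cellIndex k x < N := by
  classical
  obtain ⟨t, ht⟩ := hK.elim_finite_subcover
    (fun i => Metric.ball (TopologicalSpace.denseSeq X i) (1 / ((k : ℝ) + 1)))
    (fun i => Metric.isOpen_ball) (fun x _ => by
      obtain ⟨i, hi⟩ := exists_dist_denseSeq_lt k x
      exact Set.mem_iUnion.2 ⟨i, hi⟩)
  refine ⟨t.sup id + 1, fun x hx => ?_⟩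
  obtain ⟨i, hi, hxi⟩ := Set.mem_iUnion₂.1 (ht hx)
  have h1 : cellIndex k x ≤ i := Nat.find_min' _ hxi
  have h2 : i ≤ t.sup id := Finset.le_sup (f := id) hi
  omega

/-- A bound on the indices of the cells that meet a compact set. -/
def cellBound (l : CompactExhaustion X) (i k : ℕ) : ℕ :=
  (exists_forall_cellIndex_lt (l.isCompact i) k).choose

/-- The part in the compact set `l i` of a cell of mesh `2 / (k + 1)`. -/
def cell (l : CompactExhaustion X) (i k j : ℕ) : Set X := l i ∩ cellIndex k ⁻¹' {j}

theorem measurableSet_cell [MeasurableSpace X] [BorelSpace X] (l : CompactExhaustion X)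
    (i k j : ℕ) : MeasurableSet (cell l i k j) :=
  (l.isCompact i).measurableSet.inter (measurable_cellIndex k (measurableSet_singleton j))

theorem disjoint_cell (l : CompactExhaustion X) (i k : ℕ) {j j' : ℕ} (h : j ≠ j') :
    Disjoint (cell l i k j) (cell l i k j') := by
  refine Set.disjoint_left.2 fun x hx hx' => h ?_
  exact hx.2.symm.trans hx'.2

theorem biUnion_cell (l : CompactExhaustion X) (i k : ℕ) :
    ⋃ j ∈ Finset.range (cellBound l i k), cell l i k j = l i := by
  refine Set.Subset.antisymm (Set.iUnion₂_subset fun j _ => Set.inter_subset_left) fun x hx => ?_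
  refine Set.mem_iUnion₂.2 ⟨cellIndex k x, Finset.mem_range.2 ?_, hx, rfl⟩
  exact (exists_forall_cellIndex_lt (l.isCompact i) k).choose_spec x hx

theorem cell_eq_empty (l : CompactExhaustion X) {i k j : ℕ} (h : cellBound l i k ≤ j) :
    cell l i k j = ∅ := by
  refine Set.eq_empty_of_forall_notMem fun x hx => ?_
  have := (exists_forall_cellIndex_lt (l.isCompact i) k).choose_spec x hx.1
  have h2 : cellIndex k x = j := hx.2
  rw [h2] at this
  exact absurd h (not_le.2 this)

end Cells

/-! ### Vague topology and measurability of counts. -/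

namespace PointConfig

variable {X : Type*} [MetricSpace X] [SecondCountableTopology X] [Nonempty X]
  [MeasurableSpace X] [BorelSpace X]

theorem exists_natCast_eq {ξ : PointConfig X} {s : Set X} (hs : MeasurableSet s)
    (hfin : ξ.toMeasure s < ∞) : ∃ m : ℕ, ξ.toMeasure s = m := by
  obtain ⟨m, hm⟩ := ξ.integer_valued s hs
  rw [hm] at hfin ⊢
  cases m with
  | top => simp at hfin
  | coe m => exact ⟨m, rfl⟩

theorem toMeasure_cell_lt_top (ξ : PointConfig X) (l : CompactExhaustion X) (i k j : ℕ) :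
    ξ.toMeasure (cell l i k j) < ∞ :=
  (measure_mono Set.inter_subset_left).trans_lt (ξ.finite_of_isCompact _ (l.isCompact i))

instance isLocallyFinite (ξ : PointConfig X) [LocallyCompactSpace X] :
    IsLocallyFiniteMeasure ξ.toMeasure :=
  ⟨fun x => by
    obtain ⟨K, hK, hx⟩ := exists_compact_mem_nhds x
    exact ⟨K, hx, ξ.finite_of_isCompact K hK⟩⟩

/-- On each cell f is within η of its value at a chosen point, so for either configuration the
integral over the cell is within η times the count of that value times the count. The counts agree,
hence the factor 2. -/
theorem abs_integral_sub_le (l : CompactExhaustion X) {i k : ℕ} {f : X → ℝ} (hf : Continuous f)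
    (hsupp : tsupport f ⊆ l i) {η : ℝ} (hη : ∀ x y, cellIndex k x = cellIndex k y →
      |f x - f y| ≤ η) {ξ ξ' : PointConfig X}
    (h : ∀ j, ξ'.toMeasure (cell l i k j) = ξ.toMeasure (cell l i k j)) :
    |∫ x, f x ∂ξ'.toMeasure - ∫ x, f x ∂ξ.toMeasure| ≤ 2 * η * (ξ.toMeasure (l i)).toReal := by
  have hint : ∀ ζ : PointConfig X, ∀ j, IntegrableOn f (cell l i k j) ζ.toMeasure := by
    intro ζ j
    obtain ⟨C, hC⟩ := (l.isCompact i).exists_bound_of_continuousOn hf.continuousOn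
    refine Measure.integrableOn_of_bounded (ζ.toMeasure_cell_lt_top l i k j).ne
      hf.aestronglyMeasurable (M := C) ?_
    rw [ae_restrict_iff' (measurableSet_cell l i k j)]
    exact Eventually.of_forall fun x hx => hC x hx.1
  have hdec : ∀ ζ : PointConfig X, ∫ x, f x ∂ζ.toMeasure =
      ∑ j ∈ Finset.range (cellBound l i k), ∫ x in cell l i k j, f x ∂ζ.toMeasure := by
    intro ζ
    rw [← integral_biUnion_finset _ (fun j _ => measurableSet_cell l i k j)
      (fun j _ j' _ hjj => disjoint_cell l i k hjj) (fun j _ => hint ζ j), biUnion_cell,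
      setIntegral_eq_integral_of_forall_compl_eq_zero]
    intro x hx
    exact image_eq_zero_of_notMem_tsupport fun hc => hx (hsupp hc)
  have happ : ∀ (ζ : PointConfig X) (j : ℕ) (a : X), a ∈ cell l i k j →
      |∫ x in cell l i k j, f x ∂ζ.toMeasure - f a * (ζ.toMeasure (cell l i k j)).toReal| ≤
        η * (ζ.toMeasure (cell l i k j)).toReal := by
    intro ζ j a ha
    have hfin := ζ.toMeasure_cell_lt_top l i k j
    have h1 : ∫ x in cell l i k j, (f x - f a) ∂ζ.toMeasure =
        ∫ x in cell l i k j, f x ∂ζ.toMeasure - f a * (ζ.toMeasure (cell l i k j)).toReal := by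
      rw [integral_sub (hint ζ j) (integrableOn_const hfin.ne), setIntegral_const, smul_eq_mul,
        Measure.real, mul_comm]
    rw [← h1]
    exact norm_setIntegral_le_of_norm_le_const (μ := ζ.toMeasure) (f := fun x => f x - f a)
      (C := η) hfin fun x hx => hη x a (hx.2.trans ha.2.symm)
  have hsum : (ξ.toMeasure (l i)).toReal =
      ∑ j ∈ Finset.range (cellBound l i k), (ξ.toMeasure (cell l i k j)).toReal := by
    rw [← biUnion_cell l i k, measure_biUnion_finset
      (fun j _ j' _ hjj => disjoint_cell l i k hjj) (fun j _ => measurableSet_cell l i k j),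
      ENNReal.toReal_sum fun j _ => (ξ.toMeasure_cell_lt_top l i k j).ne]
  rw [hdec, hdec, ← Finset.sum_sub_distrib, hsum, Finset.mul_sum]
  refine (Finset.abs_sum_le_sum_abs _ _).trans (Finset.sum_le_sum fun j _ => ?_)
  rcases (cell l i k j).eq_empty_or_nonempty with he | ⟨a, ha⟩
  · simp [he]
  · have h1 := happ ξ j a ha
    have h2 := happ ξ' j a ha
    rw [h j] at h2
    rw [abs_le] at h1 h2 ⊢
    constructor <;> linarith

/-- An open set of configurations contains, with each configuration, all those with the same counts
in sufficiently small cells of a sufficiently large compact set. -/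
theorem eventually_forall_mem_of_isOpen (l : CompactExhaustion X) {G : Set (PointConfig X)}
    (hG : IsOpen G) {ξ : PointConfig X} (hξ : ξ ∈ G) :
    ∀ᶠ i in atTop, ∀ᶠ k in atTop, ∀ ξ' : PointConfig X,
      (∀ j, ξ'.toMeasure (cell l i k j) = ξ.toMeasure (cell l i k j)) → ξ' ∈ G := by
  obtain ⟨U, hU, rfl⟩ := isOpen_induced_iff.1 hG
  obtain ⟨I, u, hu, hIU⟩ := isOpen_pi_iff.1 hU _ hξ
  have key : ∀ f ∈ I, ∀ᶠ i in atTop, ∀ᶠ k in atTop, ∀ ξ' : PointConfig X,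
      (∀ j, ξ'.toMeasure (cell l i k j) = ξ.toMeasure (cell l i k j)) →
      ∫ x, f x ∂ξ'.toMeasure ∈ u f := by
    intro f hf
    obtain ⟨ε, hε, hball⟩ := Metric.isOpen_iff.1 (hu f hf).1 _ (hu f hf).2
    have hfc : HasCompactSupport f := f.hasCompactSupport
    obtain ⟨i0, hi0⟩ := l.exists_superset_of_isCompact hfc.isCompact
    filter_upwards [eventually_ge_atTop i0] with i hi
    have hsupp : tsupport f ⊆ l i := hi0.trans (l.subset hi)
    have huc : UniformContinuous f := hfc.uniformContinuous_of_continuous f.continuous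
    set M := (ξ.toMeasure (l i)).toReal with hM
    have hM0 : 0 ≤ M := ENNReal.toReal_nonneg
    -- This choice makes 2ηM less than ε, also when M = 0.
    set η := ε / (2 * (M + 1)) with hη
    have hη0 : 0 < η := by positivity
    obtain ⟨δ, hδ, hfd⟩ := Metric.uniformContinuous_iff.1 huc η hη0
    have hlim : Tendsto (fun k : ℕ => 2 / ((k : ℝ) + 1)) atTop (𝓝 0) := by
      have := (tendsto_one_div_add_atTop_nhds_zero_nat (𝕜 := ℝ)).const_mul 2
      simpa [div_eq_mul_inv] using this
    filter_upwards [hlim.eventually (gt_mem_nhds hδ)] with k hk ξ' hξ'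
    apply hball
    have hb := abs_integral_sub_le (k := k) l f.continuous hsupp (η := η) (fun x y hxy =>
      (hfd ((dist_lt_of_cellIndex_eq hxy).trans hk)).le) hξ'
    rw [Metric.mem_ball, Real.dist_eq]
    refine hb.trans_lt ?_
    rw [← hM, hη]
    have : 2 * (ε / (2 * (M + 1))) * M = ε * (M / (M + 1)) := by field_simp
    rw [this]
    refine mul_lt_of_lt_one_right hε ?_
    rw [div_lt_one (by linarith)]; linarith
  have key2 := (eventually_all_finset I).2 key
  filter_upwards [key2] with i hi
  have key3 := (eventually_all_finset I).2 hi
  filter_upwards [key3] with k hk ξ' hξ'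
  exact hIU fun f hf => hk f hf ξ' hξ'

variable [LocallyCompactSpace X]

/-- A map into configurations is measurable as soon as all the counts are. -/
theorem measurable_of_measurable_apply {Y : Type*} [MeasurableSpace Y] {g : Y → PointConfig X}
    (hg : ∀ A, MeasurableSet A → Measurable fun y => (g y).toMeasure A) : Measurable g := by
  have l : CompactExhaustion X := default
  refine measurable_of_isOpen fun G hG => ?_
  let E : ∀ i k : ℕ, (Fin (cellBound l i k) → ℕ) → Set (PointConfig X) := fun i k c =>
    {ξ | ∀ j : Fin (cellBound l i k), ξ.toMeasure (cell l i k j) = c j}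
  -- Cell counts are finite families of integers, so this union is countable: every open set is a
  -- countable union of events that depend only on finitely many counts.
  have hGE : g ⁻¹' G = ⋃ (i : ℕ) (k : ℕ) (c : Fin (cellBound l i k) → ℕ) (_ : E i k c ⊆ G),
      g ⁻¹' E i k c := by
    ext y
    simp only [Set.mem_iUnion, Set.mem_preimage]
    constructor
    · intro hy
      obtain ⟨i, hi⟩ := (eventually_forall_mem_of_isOpen l hG hy).exists
      obtain ⟨k, hk⟩ := hi.exists
      choose c hc using fun j : Fin (cellBound l i k) => exists_natCast_eq
        (measurableSet_cell l i k j) ((g y).toMeasure_cell_lt_top l i k j)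
      refine ⟨i, k, c, fun ξ' hξ' => hk ξ' fun j => ?_, hc⟩
      by_cases hj : j < cellBound l i k
      · exact (hξ' ⟨j, hj⟩).trans (hc ⟨j, hj⟩).symm
      · rw [cell_eq_empty l (not_lt.1 hj)]; simp
    · rintro ⟨i, k, c, hc, hy⟩
      exact hc hy
  rw [hGE]
  refine MeasurableSet.iUnion fun i => MeasurableSet.iUnion fun k => MeasurableSet.iUnion fun c =>
    MeasurableSet.iUnion fun _ => ?_
  have : g ⁻¹' E i k c = ⋂ j : Fin (cellBound l i k),
      (fun y => (g y).toMeasure (cell l i k j)) ⁻¹' {(c j : ℝ≥0∞)} := by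
    ext y; simp [E]
  rw [this]
  exact MeasurableSet.iInter fun j => hg _ (measurableSet_cell l i k j) (measurableSet_singleton _)

theorem continuous_integral (f : CompactlySupportedContinuousMap X ℝ) :
    Continuous fun ξ : PointConfig X => ∫ x, f x ∂ξ.toMeasure :=
  continuous_pi_iff.1 (continuous_induced_dom : Continuous
    fun (ξ : PointConfig X) (g : CompactlySupportedContinuousMap X ℝ) => ∫ x, g x ∂ξ.toMeasure) f

/-- The number of points in an open set is a measurable function of the configuration. -/
theorem measurable_apply_of_isOpen {U : Set X} (hU : IsOpen U) :
    Measurable fun ξ : PointConfig X => ξ.toMeasure U := by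
  have l : CompactExhaustion X := default
  obtain ⟨F, hFc, hFU, hFun, hFm⟩ := hU.exists_iUnion_isClosed
  let C : ℕ → Set X := fun i => F i ∩ l i
  have hCc : ∀ i, IsCompact (C i) := fun i => (l.isCompact i).inter_left (hFc i)
  have hCU : ∀ i, C i ⊆ U := fun i => Set.inter_subset_left.trans (hFU i)
  have hCm : Monotone C := fun i j hij => Set.inter_subset_inter (hFm hij) (l.subset hij)
  have hCun : ⋃ i, C i = U := by
    refine Set.Subset.antisymm (Set.iUnion_subset hCU) fun x hx => ?_
    rw [← hFun] at hx
    obtain ⟨i, hi⟩ := Set.mem_iUnion.1 hx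
    obtain ⟨j, hj⟩ := l.exists_mem x
    exact Set.mem_iUnion.2 ⟨max i j, hFm (le_max_left _ _) hi, l.subset (le_max_right _ _) hj⟩
  choose f hf1 hf0 hfc hf01 using fun i =>
    exists_continuous_one_zero_of_isCompact (hCc i) hU.isClosed_compl
      (Set.disjoint_compl_right_iff_subset.2 (hCU i))
  let φ : ℕ → CompactlySupportedContinuousMap X ℝ := fun i => ⟨f i, hfc i⟩
  -- Urysohn functions between the compact sets `C i` and U squeeze the count of U between
  -- `ξ.toMeasure (C i)` and itself.
  have hlow : ∀ (ξ : PointConfig X) i, ξ.toMeasure (C i) ≤ ENNReal.ofReal (∫ x, φ i x ∂ξ.toMeasure) ∧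
      ENNReal.ofReal (∫ x, φ i x ∂ξ.toMeasure) ≤ ξ.toMeasure U := by
    intro ξ i
    have hint : Integrable (φ i) ξ.toMeasure :=
      (φ i).continuous.integrable_of_hasCompactSupport (φ i).hasCompactSupport
    rw [ofReal_integral_eq_lintegral_ofReal hint (Eventually.of_forall fun x => (hf01 i x).1)]
    constructor
    · rw [← lintegral_indicator_one (hCc i).measurableSet]
      refine lintegral_mono fun x => ?_
      by_cases hx : x ∈ C i
      · rw [Set.indicator_of_mem hx, Pi.one_apply]
        have : φ i x = 1 := hf1 i hx
        rw [this]; simp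
      · rw [Set.indicator_of_notMem hx]; exact bot_le
    · rw [← lintegral_indicator_one hU.measurableSet]
      refine lintegral_mono fun x => ?_
      by_cases hx : x ∈ U
      · rw [Set.indicator_of_mem hx, Pi.one_apply]
        rw [ENNReal.ofReal_le_one]
        exact (hf01 i x).2
      · have : φ i x = 0 := hf0 i hx
        rw [this]; simp
  refine measurable_of_tendsto_metrizable (f := fun i ξ => ENNReal.ofReal (∫ x, φ i x ∂ξ.toMeasure))
    (fun i => (continuous_integral (φ i)).measurable.ennreal_ofReal) ?_
  rw [tendsto_pi_nhds]
  intro ξ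
  have h1 : Tendsto (fun i => ξ.toMeasure (C i)) atTop (𝓝 (ξ.toMeasure U)) := by
    rw [← hCun]; exact tendsto_measure_iUnion_atTop hCm
  exact tendsto_of_tendsto_of_tendsto_of_le_of_le h1 tendsto_const_nhds (fun i => (hlow ξ i).1)
    (fun i => (hlow ξ i).2)

/-- The counts are measurable functions of the configuration. -/
theorem measurable_apply {A : Set X} (hA : MeasurableSet A) :
    Measurable fun ξ : PointConfig X => ξ.toMeasure A := by
  have l : CompactExhaustion X := default
  have hfin : ∀ (ξ : PointConfig X) i (s : Set X), ξ.toMeasure (s ∩ interior (l i)) ≠ ∞ := by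
    intro ξ i s
    exact ((measure_mono (Set.inter_subset_right.trans interior_subset)).trans_lt
      (ξ.finite_of_isCompact _ (l.isCompact i))).ne
  -- Intersecting with the interior of a compact set makes all counts finite, so complements become
  -- subtractions in the π-λ argument.
  have hloc : ∀ (i : ℕ) (A : Set X), MeasurableSet A →
      Measurable fun ξ : PointConfig X => ξ.toMeasure (A ∩ interior (l i)) := by
    intro i A hA
    have hI : MeasurableSet (interior (l i)) := isOpen_interior.measurableSet
    have hgen : ‹MeasurableSpace X› = MeasurableSpace.generateFrom {s : Set X | IsOpen s} :=
      BorelSpace.measurable_eq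
    have hpi : IsPiSystem {s : Set X | IsOpen s} := isPiSystem_isOpen
    induction A, hA using MeasurableSpace.induction_on_inter hgen hpi with
    | empty => simp
    | basic U hU => exact measurable_apply_of_isOpen (IsOpen.inter hU isOpen_interior)
    | compl A hA ih =>
      have hA' : MeasurableSet A := hA
      have : (fun ξ : PointConfig X => ξ.toMeasure (Aᶜ ∩ interior (l i))) = fun ξ =>
          ξ.toMeasure (interior (l i)) - ξ.toMeasure (A ∩ interior (l i)) := by
        ext ξ
        rw [← measure_sdiff Set.inter_subset_right (hA'.inter hI).nullMeasurableSet (hfin ξ i A)]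
        congr 1
        ext x; simp; tauto
      rw [this]
      exact (measurable_apply_of_isOpen isOpen_interior).sub ih
    | iUnion s hd hs ih =>
      have : (fun ξ : PointConfig X => ξ.toMeasure ((⋃ n, s n) ∩ interior (l i))) = fun ξ =>
          ∑' n, ξ.toMeasure (s n ∩ interior (l i)) := by
        ext ξ
        rw [Set.iUnion_inter, measure_iUnion
          (fun a b hab => (hd hab).mono Set.inter_subset_left Set.inter_subset_left)
          (fun n => (hs n).inter hI)]
      rw [this]
      exact Measurable.tsum ih
  have hmono : Monotone fun i => A ∩ interior (l i) := fun i j hij =>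
    Set.inter_subset_inter_right _ (interior_mono (l.subset hij))
  have hun : ⋃ i, A ∩ interior (l i) = A := by
    rw [← Set.inter_iUnion, Set.inter_eq_left]
    intro x _
    obtain ⟨i, hi⟩ := l.exists_mem x
    exact Set.mem_iUnion.2 ⟨i + 1, l.subset_interior_succ i hi⟩
  have : (fun ξ : PointConfig X => ξ.toMeasure A) = fun ξ =>
      ⨆ i, ξ.toMeasure (A ∩ interior (l i)) := by
    ext ξ
    rw [← hmono.measure_iUnion, hun]
  rw [this]
  exact Measurable.iSup fun i => hloc i A hA

end PointConfig

/-! ### Factorial moment measures and their convergence. -/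

section CorrelationMeasures

theorem lintegral_prod_pi_fin {X : Type*} [MeasurableSpace X] {m : ℕ} (μ : Measure X)
    [SigmaFinite μ] {f : Fin m → X → ℝ≥0∞} (hf : ∀ i, Measurable (f i)) :
    ∫⁻ x, ∏ i, f i (x i) ∂(Measure.pi fun _ : Fin m => μ) = ∏ i, ∫⁻ x, f i x ∂μ := by
  induction m with
  | zero => simp
  | succ m ih =>
    have h := (measurePreserving_piFinSuccAbove (fun _ : Fin (m + 1) => μ) 0)
    have h2 := h.lintegral_comp (f := fun p => f 0 p.1 * ∏ i : Fin m, f i.succ (p.2 i)) (by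
      refine ((hf 0).comp measurable_fst).mul (Finset.measurable_prod _ fun i _ => ?_)
      exact (hf i.succ).comp ((measurable_pi_apply i).comp measurable_snd))
    rw [Fin.prod_univ_succ, ← ih fun i => hf i.succ,
      ← lintegral_prod_mul (hf 0).aemeasurable
        (Finset.measurable_prod _ fun i _ => (hf i.succ).comp (measurable_pi_apply i)).aemeasurable,
      ← h2]
    refine lintegral_congr fun x => ?_
    rw [Fin.prod_univ_succ]
    simp [MeasurableEquiv.piFinSuccAbove, Fin.tail, Fin.insertNthEquiv]

variable {V : ℝ → ℝ} {χ R : ℝ}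

theorem isOpen_exterior (R : ℝ) : IsOpen (Exterior R) := isOpen_lt continuous_const continuous_norm

theorem map_lebesgueExterior (R : ℝ) :
    (lebesgueExterior R).map Subtype.val = (volume : Measure ℂ).restrict (Exterior R) := by
  rw [lebesgueExterior, (MeasurableEmbedding.subtype_coe (measurableSet_exterior R)).map_comap,
    Subtype.range_coe]

instance (R : ℝ) : SigmaFinite (lebesgueExterior R) :=
  SigmaFinite.of_map _ measurable_subtype_coe.aemeasurable (by
    rw [map_lebesgueExterior]; infer_instance)

instance (R : ℝ) : NullSingletonClass (lebesgueExterior R) := by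
  refine ⟨fun x => ?_⟩
  rw [lebesgueExterior,
    (MeasurableEmbedding.subtype_coe (measurableSet_exterior R)).comap_apply]
  simp

instance (R : ℝ) : LocallyCompactSpace (Exterior R) := (isOpen_exterior R).locallyCompactSpace

instance (R : ℝ) : Nonempty (Exterior R) :=
  ⟨⟨((|R| + 1 : ℝ) : ℂ), by
    change R < ‖((|R| + 1 : ℝ) : ℂ)‖
    rw [Complex.norm_real, Real.norm_of_nonneg (by positivity)]
    linarith [le_abs_self R]⟩⟩

/-- The points of a family in `Exterior R`, seen in `ℂ`. -/
def valPi {R : ℝ} {m : ℕ} (x : Fin m → Exterior R) : Fin m → ℂ := fun i => x i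

theorem isOpenEmbedding_valPi {R : ℝ} {m : ℕ} : IsOpenEmbedding (valPi (R := R) (m := m)) :=
  IsOpenEmbedding.piMap fun _ => (isOpen_exterior R).isOpenEmbedding_subtypeVal

theorem measurableEmbedding_valPi {R : ℝ} {m : ℕ} :
    MeasurableEmbedding (valPi (R := R) (m := m)) := isOpenEmbedding_valPi.measurableEmbedding

theorem map_valPi {R : ℝ} {m : ℕ} :
    (Measure.pi fun _ : Fin m => lebesgueExterior R).map valPi =
      (Measure.pi fun _ : Fin m => (volume : Measure ℂ)).restrict
        (Set.univ.pi fun _ => Exterior R) := by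
  have : ∀ i : Fin m, SigmaFinite ((lebesgueExterior R).map Subtype.val) := fun _ => by
    rw [map_lebesgueExterior]; infer_instance
  rw [Measure.restrict_pi_pi, ← map_lebesgueExterior]
  exact Measure.pi_map_pi (f := fun _ => Subtype.val) (hμ := this) fun _ => measurable_subtype_coe.aemeasurable

/-- The measure with density `densityB`, which dominates the intensities of the particles. -/
def intensityB (χ R : ℝ) : Measure (Exterior R) :=
  (lebesgueExterior R).withDensity fun z => ENNReal.ofReal (densityB χ R z)

/-- The factorial moment measure of the limiting process. -/
def corrB (χ R : ℝ) (m : ℕ) : Measure (Fin m → Exterior R) :=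
  (Measure.pi fun _ => lebesgueExterior R).withDensity fun x =>
    ENNReal.ofReal (Matrix.of fun i j => kernelB χ R (x i) (x j)).det.re

/-- The factorial moment measure of the particles outside the disk. -/
def corrN (V : ℝ → ℝ) (χ R : ℝ) (n m : ℕ) : Measure (Fin m → Exterior R) :=
  (Measure.pi fun _ => lebesgueExterior R).withDensity fun x =>
    ENNReal.ofReal (Matrix.of fun i j => kernelN V χ n (x i) (x j)).det.re

theorem measurable_densityB (χ R : ℝ) : Measurable (densityB χ R) := by
  unfold densityB
  refine (measurable_norm.pow_const _).mul ?_
  refine Measurable.tsum fun k => ?_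
  exact measurable_const.div ((measurable_norm.pow_const 2).pow_const k)

theorem measurable_densityB_val (χ R : ℝ) :
    Measurable fun z : Exterior R => ENNReal.ofReal (densityB χ R z) :=
  ((measurable_densityB χ R).comp measurable_subtype_coe).ennreal_ofReal

theorem intensityB_lt_top (hχ : 0 < χ) (hR : 1 ≤ R) {ρ : ℝ} (hρ : R < ρ) :
    intensityB χ R {z | ρ < ‖(z : ℂ)‖} < ∞ := by
  have hm : MeasurableSet {z : Exterior R | ρ < ‖(z : ℂ)‖} :=
    (isOpen_lt continuous_const continuous_subtype_val.norm).measurableSet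
  have hm2 : MeasurableSet {z : ℂ | ρ < ‖z‖} :=
    (isOpen_lt continuous_const continuous_norm).measurableSet
  rw [intensityB, withDensity_apply _ hm]
  refine lt_of_le_of_lt ?_ (setLIntegral_densityB_lt_top hχ hR hρ)
  have h := setLIntegral_map (μ := lebesgueExterior R) hm2 (measurable_densityB χ R).ennreal_ofReal
    measurable_subtype_coe
  change _ ≤ _
  refine (h.symm.le).trans ?_
  rw [map_lebesgueExterior]
  exact lintegral_mono' (Measure.restrict_mono_measure Measure.restrict_le_self _) le_rfl

instance : SigmaFinite (intensityB χ R) :=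
  SigmaFinite.withDensity_of_ne_top (Eventually.of_forall fun _ => ENNReal.ofReal_ne_top)

instance : NullSingletonClass (intensityB χ R) :=
  ⟨fun x => withDensity_absolutelyContinuous _ _ (measure_singleton x)⟩

theorem pi_intensityB (χ R : ℝ) (m : ℕ) :
    (Measure.pi fun _ : Fin m => intensityB χ R) =
      (Measure.pi fun _ : Fin m => lebesgueExterior R).withDensity fun x =>
        ∏ i, ENNReal.ofReal (densityB χ R (x i)) := by
  refine Measure.pi_eq fun s hs => ?_
  rw [withDensity_apply _ (MeasurableSet.univ_pi hs)]
  rw [← lintegral_indicator (MeasurableSet.univ_pi hs)]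
  have h : ∀ x : Fin m → Exterior R, (Set.univ.pi s).indicator
      (fun x : Fin m → Exterior R => ∏ i, ENNReal.ofReal (densityB χ R (x i))) x =
      ∏ i, (s i).indicator (fun z : Exterior R => ENNReal.ofReal (densityB χ R z)) (x i) := by
    intro x
    by_cases hx : x ∈ Set.univ.pi s
    · rw [Set.indicator_of_mem hx]
      refine Finset.prod_congr rfl fun i _ => ?_
      rw [Set.indicator_of_mem (hx i (Set.mem_univ i))]
    · rw [Set.indicator_of_notMem hx]
      simp only [Set.mem_univ_pi, not_forall] at hx
      obtain ⟨i, hi⟩ := hx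
      exact (Finset.prod_eq_zero (Finset.mem_univ i) (Set.indicator_of_notMem hi _)).symm
  simp_rw [h]
  rw [lintegral_prod_pi_fin _ fun i => (measurable_densityB_val χ R).indicator (hs i)]
  refine Finset.prod_congr rfl fun i _ => ?_
  rw [lintegral_indicator (hs i), intensityB, withDensity_apply _ (hs i)]

theorem corrN_le (hV : IsCirclePotential V) (hχ : 0 < χ) (hR : 1 ≤ R)
    (hV_eq : ∀ r, R ≤ r → V r = Real.log r) (n m : ℕ) :
    corrN V χ R n m ≤ Measure.pi fun _ => intensityB χ R := by
  rw [pi_intensityB]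
  refine withDensity_mono (Eventually.of_forall fun x => ?_)
  beta_reduce
  rw [← ENNReal.ofReal_prod_of_nonneg fun i _ => (densityB_pos hχ hR (x i).2).le]
  exact ENNReal.ofReal_le_ofReal (det_kernelN_re_le (x := valPi x) hV hχ hR hV_eq n fun i => (x i).2)

theorem det_kernelB_re_le (hV : IsCirclePotential V) (hχ : 0 < χ) (hR : 1 ≤ R)
    (hV_eq : ∀ r, R ≤ r → V r = Real.log r)
    (hV_gt : ∀ r, 1 < r → r < R → Real.log r < V r) {m : ℕ} (x : Fin m → Exterior R) :
    (Matrix.of fun i j => kernelB χ R (x i) (x j)).det.re ≤ ∏ i, densityB χ R (x i) :=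
  le_of_tendsto ((Complex.continuous_re.tendsto _).comp
    (tendsto_det_kernelN hV hχ hR hV_eq hV_gt x)) (Eventually.of_forall fun n =>
      det_kernelN_re_le (x := valPi x) hV hχ hR hV_eq n fun i => (x i).2)

theorem det_kernelB_nonneg (hV : IsCirclePotential V) (hχ : 0 < χ) (hR : 1 ≤ R)
    (hV_eq : ∀ r, R ≤ r → V r = Real.log r)
    (hV_gt : ∀ r, 1 < r → r < R → Real.log r < V r) {m : ℕ} (x : Fin m → Exterior R) :
    (Matrix.of fun i j => kernelB χ R (x i) (x j)).det.im = 0 ∧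
      0 ≤ (Matrix.of fun i j => kernelB χ R (x i) (x j)).det.re := by
  have h := tendsto_det_kernelN hV hχ hR hV_eq hV_gt x
  constructor
  · refine tendsto_nhds_unique ((Complex.continuous_im.tendsto _).comp h) ?_
    refine tendsto_const_nhds.congr fun n => ?_
    exact (det_kernelN_im V χ n (valPi x)).symm
  · exact ge_of_tendsto' ((Complex.continuous_re.tendsto _).comp h) fun n =>
      det_kernelN_re_nonneg V χ n (valPi x)

theorem corrB_le (hV : IsCirclePotential V) (hχ : 0 < χ) (hR : 1 ≤ R)
    (hV_eq : ∀ r, R ≤ r → V r = Real.log r)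
    (hV_gt : ∀ r, 1 < r → r < R → Real.log r < V r) (m : ℕ) :
    corrB χ R m ≤ Measure.pi fun _ => intensityB χ R := by
  rw [pi_intensityB]
  refine withDensity_mono (Eventually.of_forall fun x => ?_)
  beta_reduce
  rw [← ENNReal.ofReal_prod_of_nonneg fun i _ => (densityB_pos hχ hR (x i).2).le]
  exact ENNReal.ofReal_le_ofReal (det_kernelB_re_le hV hχ hR hV_eq hV_gt x)

theorem continuous_det_kernelN (hV : IsCirclePotential V) (χ : ℝ) (n m : ℕ) :
    Continuous fun x : Fin m → ℂ => (Matrix.of fun i j => kernelN V χ n (x i) (x j)).det := by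
  refine Continuous.matrix_det (continuous_matrix fun i j => ?_)
  have h : Continuous fun x : Fin m → ℂ => kernelN V χ n (x i) (x j) := by
    unfold kernelN
    refine continuous_finsetSum Finset.univ fun k _ => ?_
    exact ((hV.continuous_weightedMonomial n k).comp (continuous_apply i)).mul
      (Complex.continuous_conj.comp
        ((hV.continuous_weightedMonomial n k).comp (continuous_apply j)))
  exact h

theorem continuous_valPi {m : ℕ} : Continuous (valPi (R := R) (m := m)) :=
  isOpenEmbedding_valPi.continuous

/-- Dominated convergence: the determinants converge pointwise, and the product of the densities
`densityB` is an integrable majorant on S. -/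
theorem tendsto_corrN (hV : IsCirclePotential V) (hχ : 0 < χ) (hR : 1 ≤ R)
    (hV_eq : ∀ r, R ≤ r → V r = Real.log r)
    (hV_gt : ∀ r, 1 < r → r < R → Real.log r < V r) {m : ℕ} {S : Set (Fin m → Exterior R)}
    (hS : MeasurableSet S) (hfin : (Measure.pi fun _ => intensityB χ R) S < ∞) :
    Tendsto (fun n => corrN V χ R n m S) atTop (𝓝 (corrB χ R m S)) := by
  unfold corrN corrB
  simp_rw [withDensity_apply _ hS]
  rw [pi_intensityB, withDensity_apply _ hS] at hfin
  refine tendsto_lintegral_of_dominated_convergence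
    (fun x => ∏ i, ENNReal.ofReal (densityB χ R (x i))) (fun n => ?_) (fun n => ?_) hfin.ne ?_
  · exact (Complex.measurable_re.comp ((continuous_det_kernelN hV χ n m).comp
      continuous_valPi).measurable).ennreal_ofReal
  · refine Eventually.of_forall fun x => ?_
    beta_reduce
    rw [← ENNReal.ofReal_prod_of_nonneg fun i _ => (densityB_pos hχ hR (x i).2).le]
    exact ENNReal.ofReal_le_ofReal
      (det_kernelN_re_le (x := valPi x) hV hχ hR hV_eq n fun i => (x i).2)
  · exact Eventually.of_forall fun x => ENNReal.tendsto_ofReal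
      ((Complex.continuous_re.tendsto _).comp (tendsto_det_kernelN hV hχ hR hV_eq hV_gt x))

/-- The factorial moment measures of the particles. -/
theorem sum_map_coulombGas (hV : IsCirclePotential V) (hχ : 0 < χ) (hR : 1 ≤ R)
    (hV_eq : ∀ r, R ≤ r → V r = Real.log r) (n m : ℕ) :
    ∑ f : Fin m ↪ Fin n, (coulombGas V χ n).map (fun x i => x (f i)) =
      (Measure.pi fun _ : Fin m => (volume : Measure ℂ)).withDensity fun x =>
        ENNReal.ofReal (Matrix.of fun i j => kernelN V χ n (x i) (x j)).det.re := by
  have := hV.isProbabilityMeasure_coulombGas hχ hR hV_eq n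
  have hmeas : ∀ f : Fin m ↪ Fin n, Measurable fun (x : Fin n → ℂ) i => x (f i) := fun f =>
    measurable_pi_lambda _ fun i => measurable_pi_apply _
  have hbox : ∀ C : Fin m → Set ℂ, (∀ i, MeasurableSet (C i)) →
      (∑ f : Fin m ↪ Fin n, (coulombGas V χ n).map (fun x i => x (f i))) (Set.univ.pi C) =
      ((Measure.pi fun _ : Fin m => (volume : Measure ℂ)).withDensity fun x =>
        ENNReal.ofReal (Matrix.of fun i j => kernelN V χ n (x i) (x j)).det.re) (Set.univ.pi C) := by
    intro C hC
    rw [withDensity_apply _ (MeasurableSet.univ_pi hC),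
      ← hV.lintegral_coulombGas_sum_embedding hχ hR hV_eq hC, lintegral_finsetSum,
      Measure.coe_finsetSum, Finset.sum_apply]
    · refine Finset.sum_congr rfl fun f _ => ?_
      rw [Measure.map_apply (hmeas f) (MeasurableSet.univ_pi hC),
        ← lintegral_indicator_one (hmeas f (MeasurableSet.univ_pi hC))]
      refine lintegral_congr fun x => ?_
      by_cases hx : ∀ i, x (f i) ∈ C i
      · rw [Set.indicator_of_mem (by simpa using hx), Finset.prod_eq_one]
        · rfl
        · exact fun i _ => Set.indicator_of_mem (hx i) _
      · rw [Set.indicator_of_notMem (by simpa using hx)]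
        push Not at hx
        obtain ⟨i, hi⟩ := hx
        exact (Finset.prod_eq_zero (Finset.mem_univ i) (Set.indicator_of_notMem hi _)).symm
    · exact fun f _ => Finset.measurable_prod _ fun i _ =>
        (measurable_const.indicator (hC i)).comp (measurable_pi_apply _)
  refine ext_of_generate_finite _ generateFrom_pi.symm isPiSystem_pi ?_ ?_
  · rintro _ ⟨C, hC, rfl⟩
    exact hbox C fun i => hC i (Set.mem_univ i)
  · have := hbox (fun _ => Set.univ) fun _ => MeasurableSet.univ
    rwa [Set.pi_univ] at this

theorem sum_coulombGas_preimage (hV : IsCirclePotential V) (hχ : 0 < χ) (hR : 1 ≤ R)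
    (hV_eq : ∀ r, R ≤ r → V r = Real.log r) (n : ℕ) {m : ℕ} {S : Set (Fin m → Exterior R)}
    (hS : MeasurableSet S) :
    ∑ f : Fin m ↪ Fin n, coulombGas V χ n {x | (fun i => x (f i)) ∈ valPi '' S} =
      corrN V χ R n m S := by
  have hS2 : MeasurableSet (valPi '' S) := measurableEmbedding_valPi.measurableSet_image.2 hS
  have h := congrArg (fun μ : Measure (Fin m → ℂ) => μ (valPi '' S))
    (sum_map_coulombGas hV hχ hR hV_eq n m)
  simp only [Measure.coe_finsetSum, Finset.sum_apply] at h
  have hmeas : ∀ f : Fin m ↪ Fin n, Measurable fun (x : Fin n → ℂ) i => x (f i) := fun f =>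
    measurable_pi_lambda _ fun i => measurable_pi_apply _
  refine Eq.trans (Finset.sum_congr rfl fun f _ => ?_) (h.trans ?_)
  · rw [Measure.map_apply (hmeas f) hS2]; rfl
  · rw [withDensity_apply _ hS2, corrN, withDensity_apply _ hS]
    have h3 : valPi '' S ⊆ Set.univ.pi fun _ => Exterior R := by
      rintro _ ⟨x, -, rfl⟩ i -
      exact (x i).2
    rw [← Measure.restrict_restrict_of_subset h3, ← map_valPi,
      measurableEmbedding_valPi.restrict_map, measurableEmbedding_valPi.lintegral_map,
      Set.preimage_image_eq _ measurableEmbedding_valPi.injective]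
    rfl

end CorrelationMeasures

/-! ### Occupation events as multilinear polynomials in the counts. -/

section Multilinear

variable {ι : Type*} [Fintype ι] [DecidableEq ι]

/-- The multilinear extension of the indicator function of a family of subsets. -/
def multilinearExt (𝒥 : Finset (Finset ι)) (c : ι → ℝ) : ℝ :=
  ∑ J ∈ 𝒥, (∏ j ∈ J, c j) * ∏ j ∈ Finset.univ \ J, (1 - c j)

/-- Expanding the factors 1 - c_j gives monomials indexed by unions of disjoint sets, hence without
squares. Their expectations are moments of counts of distinct cells, which the correlations
determine. -/
theorem exists_multilinearExt_eq (𝒥 : Finset (Finset ι)) :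
    ∃ a : Finset ι → ℝ, ∀ c : ι → ℝ, multilinearExt 𝒥 c = ∑ S, a S * ∏ j ∈ S, c j := by
  refine ⟨fun S => ∑ J ∈ 𝒥, ∑ T ∈ (Finset.univ \ J).powerset,
    if J ∪ T = S then (-1) ^ T.card else 0, fun c => ?_⟩
  simp_rw [Finset.sum_mul]
  rw [Finset.sum_comm]
  refine Finset.sum_congr rfl fun J _ => ?_
  rw [Finset.sum_comm, Finset.prod_sub]
  rw [Finset.mul_sum]
  refine Finset.sum_congr rfl fun T hT => ?_
  have hd : Disjoint J T := by
    rw [Finset.mem_powerset] at hT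
    exact Finset.disjoint_sdiff.mono_right hT
  rw [Finset.sum_eq_single (J ∪ T)]
  · rw [if_pos rfl, Finset.prod_union hd]
    simp
    ring
  · intro S _ hS
    rw [if_neg hS.symm, zero_mul]
  · simp

/-- Summing absolute values over all subsets gives the product of |c_j| + |1 - c_j|, and for an
integer c this factor is at most 2^c. -/
theorem abs_multilinearExt_le (𝒥 : Finset (Finset ι)) (c : ι → ℕ) :
    |multilinearExt 𝒥 fun j => (c j : ℝ)| ≤ 2 ^ ∑ j, c j := by
  have h1 : ∀ n : ℕ, |(n : ℝ)| + |1 - (n : ℝ)| ≤ 2 ^ n := by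
    intro n
    rcases n with _ | n
    · simp
    · have h := one_add_mul_le_pow (a := (1 : ℝ)) (by norm_num) n
      have h2 : |1 - ((n + 1 : ℕ) : ℝ)| = n := by
        push_cast
        rw [show (1 : ℝ) - (n + 1) = -n by ring, abs_neg, abs_of_nonneg (Nat.cast_nonneg n)]
      rw [h2, abs_of_nonneg (Nat.cast_nonneg _), pow_succ]
      push_cast
      norm_num at h
      linarith
  unfold multilinearExt
  calc _ ≤ ∑ J ∈ 𝒥, (∏ j ∈ J, |(c j : ℝ)|) * ∏ j ∈ Finset.univ \ J, |1 - (c j : ℝ)| := by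
        refine (Finset.abs_sum_le_sum_abs _ _).trans_eq (Finset.sum_congr rfl fun J _ => ?_)
        rw [abs_mul, Finset.abs_prod, Finset.abs_prod]
    _ ≤ ∑ J ∈ Finset.univ.powerset, (∏ j ∈ J, |(c j : ℝ)|) *
          ∏ j ∈ Finset.univ \ J, |1 - (c j : ℝ)| := by
        refine Finset.sum_le_sum_of_subset_of_nonneg (fun J _ => by simp) fun J _ _ => ?_
        positivity
    _ = ∏ j, (|(c j : ℝ)| + |1 - (c j : ℝ)|) := (Finset.prod_add _ _ _).symm
    _ ≤ ∏ j, (2 : ℝ) ^ c j := Finset.prod_le_prod (fun j _ => by positivity) fun j _ => h1 _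
    _ = _ := Finset.prod_pow_eq_pow_sum _ _ _

theorem multilinearExt_of_le_one (𝒥 : Finset (Finset ι)) {c : ι → ℕ} (hc : ∀ j, c j ≤ 1) :
    multilinearExt 𝒥 (fun j => (c j : ℝ)) =
      if Finset.univ.filter (fun j => c j = 1) ∈ 𝒥 then 1 else 0 := by
  have hterm : ∀ J : Finset ι, (∏ j ∈ J, (c j : ℝ)) * ∏ j ∈ Finset.univ \ J, (1 - (c j : ℝ)) =
      if J = Finset.univ.filter (fun j => c j = 1) then 1 else 0 := by
    intro J
    split_ifs with h
    · rw [Finset.prod_eq_one, Finset.prod_eq_one, one_mul]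
      · intro j hj
        have h1 : c j ≠ 1 := by
          rw [h] at hj; simpa using hj
        have h2 := hc j
        have : c j = 0 := by omega
        simp [this]
      · intro j hj
        rw [h] at hj
        have : c j = 1 := by simpa using hj
        simp [this]
    · by_contra hne
      refine h (Finset.ext fun j => ?_)
      obtain ⟨h1, h2⟩ := mul_ne_zero_iff.1 hne
      rw [Finset.prod_ne_zero_iff] at h1 h2
      have hj := hc j
      constructor
      · intro hjJ
        have := h1 j hjJ
        simp only [ne_eq, Nat.cast_eq_zero] at this
        simp; omega
      · intro hj1
        by_contra hjJ
        have := h2 j (by simpa using hjJ)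
        have hj1' : c j = 1 := by simpa using hj1
        simp [hj1'] at this
  unfold multilinearExt
  simp_rw [hterm]
  rw [Finset.sum_ite_eq']

/-- The error made when counts are replaced by occupation numbers. -/
def multiplicityError (c : ι → ℕ) : ℝ := if ∀ j, c j ≤ 1 then 0 else 2 ^ ∑ j, c j

theorem multiplicityError_nonneg (c : ι → ℕ) : 0 ≤ multiplicityError c := by
  unfold multiplicityError; split_ifs <;> positivity

theorem multiplicityError_le (c : ι → ℕ) : multiplicityError c ≤ 2 ^ ∑ j, c j := by
  unfold multiplicityError; split_ifs
  · positivity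
  · exact le_rfl

theorem abs_multilinearExt_sub_le (𝒥 : Finset (Finset ι)) (c : ι → ℕ) :
    |multilinearExt 𝒥 (fun j => (c j : ℝ)) -
      if (∀ j, c j ≤ 1) ∧ Finset.univ.filter (fun j => c j = 1) ∈ 𝒥 then 1 else 0| ≤
        multiplicityError c := by
  unfold multiplicityError
  by_cases hc : ∀ j, c j ≤ 1
  · rw [if_pos hc, multilinearExt_of_le_one 𝒥 hc]
    simp [hc]
  · rw [if_neg hc, if_neg fun h => hc h.1, sub_zero]
    exact abs_multilinearExt_le 𝒥 c

/-- If some cell has two points, the sum of the second factorial powers is at least one. The first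
term then covers a total of at most M points, and 2^N ≤ 4^N / 2^M covers N ≥ M. In expectation, the
second term is small for large M and the first for a fine mesh. -/
theorem multiplicityError_le_add (c : ι → ℕ) (M : ℕ) :
    multiplicityError c ≤ 2 ^ M * ∑ j, ((c j).descFactorial 2 : ℝ) + 4 ^ (∑ j, c j) / 2 ^ M := by
  unfold multiplicityError
  have h2M : (0 : ℝ) < 2 ^ M := by positivity
  split_ifs with hc
  · positivity
  · push Not at hc
    obtain ⟨j, hj⟩ := hc
    set N := ∑ j, c j with hN
    have h1 : (1 : ℝ) ≤ ∑ j, ((c j).descFactorial 2 : ℝ) := by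
      have h3 : (1 : ℕ) ≤ (c j).descFactorial 2 := by
        rw [Nat.one_le_iff_ne_zero, Ne, Nat.descFactorial_eq_zero_iff_lt]; omega
      refine le_trans (by exact_mod_cast h3)
        (Finset.single_le_sum (f := fun j => ((c j).descFactorial 2 : ℝ))
          (fun i _ => Nat.cast_nonneg _) (Finset.mem_univ j))
    rcases le_total N M with h | h
    · have h4 : (2 : ℝ) ^ N ≤ 2 ^ M := pow_le_pow_right₀ (by norm_num) h
      have h5 : (0 : ℝ) ≤ 4 ^ N / 2 ^ M := by positivity
      nlinarith
    · have h4 : (2 : ℝ) ^ N ≤ 4 ^ N / 2 ^ M := by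
        rw [le_div_iff₀ h2M, show (4 : ℝ) = 2 * 2 by norm_num, mul_pow]
        exact mul_le_mul_of_nonneg_left (pow_le_pow_right₀ (by norm_num) h) (by positivity)
      have h5 : (0 : ℝ) ≤ 2 ^ M * ∑ j, ((c j).descFactorial 2 : ℝ) := by positivity
      linarith

end Multilinear

/-! ### Fine cells and exponential moments. -/

section SmallCells

variable {X : Type*} [MetricSpace X] [SecondCountableTopology X] [Nonempty X]
  [MeasurableSpace X] [BorelSpace X]

/-- If all points have measure less than `ε`, so do all the cells of small mesh. -/
theorem eventually_measure_cell_lt (l : CompactExhaustion X) (i : ℕ) {κ : Measure X}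
    [κ.OuterRegular] {ε : ℝ≥0∞} (h : ∀ x, κ {x} < ε) :
    ∀ᶠ k in atTop, ∀ j, κ (cell l i k j) < ε := by
  choose U hU hUo hUε using fun x => Set.exists_isOpen_lt_of_lt {x} ε (h x)
  obtain ⟨δ, hδ, hball⟩ := lebesgue_number_lemma_of_metric (l.isCompact i) hUo
    (fun x _ => Set.mem_iUnion.2 ⟨x, hU x rfl⟩)
  have hlim : Tendsto (fun k : ℕ => 2 / ((k : ℝ) + 1)) atTop (𝓝 0) := by
    have := (tendsto_one_div_add_atTop_nhds_zero_nat (𝕜 := ℝ)).const_mul 2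
    simpa [div_eq_mul_inv] using this
  filter_upwards [hlim.eventually (gt_mem_nhds hδ)] with k hk j
  rcases (cell l i k j).eq_empty_or_nonempty with he | ⟨a, ha⟩
  · rw [he, measure_empty]
    exact lt_of_le_of_lt bot_le (h (Classical.arbitrary X))
  · obtain ⟨x, hx⟩ := hball a ha.1
    refine (measure_mono fun b hb => hx ?_).trans_lt (hUε x)
    exact Metric.mem_ball.2 ((dist_lt_of_cellIndex_eq (hb.2.trans ha.2.symm)).trans hk)

end SmallCells

namespace PointConfig

variable {X : Type*} [MetricSpace X] [SecondCountableTopology X] [Nonempty X]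
  [MeasurableSpace X] [BorelSpace X] [LocallyCompactSpace X]

/-- The number of points of a configuration in a set, if it is finite. -/
def count (ξ : PointConfig X) (A : Set X) : ℕ := ⌊(ξ.toMeasure A).toReal⌋₊

theorem coe_count {ξ : PointConfig X} {A : Set X} (hA : MeasurableSet A)
    (hfin : ξ.toMeasure A < ∞) : (ξ.count A : ℝ≥0∞) = ξ.toMeasure A := by
  obtain ⟨m, hm⟩ := exists_natCast_eq hA hfin
  rw [count, hm]; simp

theorem measurable_count {A : Set X} (hA : MeasurableSet A) :
    Measurable fun ξ : PointConfig X => ξ.count A :=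
  Nat.measurable_floor.comp (measurable_apply hA).ennreal_toReal

theorem coe_count_cell (ξ : PointConfig X) (l : CompactExhaustion X) (i k j : ℕ) :
    (ξ.count (cell l i k j) : ℝ≥0∞) = ξ.toMeasure (cell l i k j) :=
  coe_count (measurableSet_cell l i k j) (ξ.toMeasure_cell_lt_top l i k j)

theorem coe_count_compact (ξ : PointConfig X) (l : CompactExhaustion X) (i : ℕ) :
    (ξ.count (l i) : ℝ≥0∞) = ξ.toMeasure (l i) :=
  coe_count (l.isCompact i).measurableSet (ξ.finite_of_isCompact _ (l.isCompact i))

theorem sum_measure_cell (κ : Measure X) (l : CompactExhaustion X) (i k : ℕ) :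
    ∑ j : Fin (cellBound l i k), κ (cell l i k j) = κ (l i) := by
  rw [Fin.sum_univ_eq_sum_range (fun j => κ (cell l i k j)), ← biUnion_cell l i k,
    measure_biUnion_finset (fun j _ j' _ hjj => disjoint_cell l i k hjj)
      (fun j _ => measurableSet_cell l i k j)]

theorem sum_count_cell (ξ : PointConfig X) (l : CompactExhaustion X) (i k : ℕ) :
    ∑ j : Fin (cellBound l i k), ξ.count (cell l i k j) = ξ.count (l i) := by
  have h : ((∑ j : Fin (cellBound l i k), ξ.count (cell l i k j) : ℕ) : ℝ≥0∞) =
      (ξ.count (l i) : ℝ≥0∞) := by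
    push_cast
    simp_rw [coe_count_cell, coe_count_compact]
    exact sum_measure_cell _ l i k
  exact_mod_cast h

/-- All atoms have mass less than two, so by outer regularity all fine cells do, and counts are
integers. -/
theorem eventually_count_cell_le_one {ξ : PointConfig X} (hξ : ∀ x, ξ.toMeasure {x} ≤ 1)
    (l : CompactExhaustion X) (i : ℕ) :
    ∀ᶠ k in atTop, ∀ j, ξ.count (cell l i k j) ≤ 1 := by
  have h2 : ∀ x, ξ.toMeasure {x} < 2 := fun x => (hξ x).trans_lt (by norm_num)
  filter_upwards [eventually_measure_cell_lt l i h2] with k hk j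
  have h := hk j
  rw [← coe_count_cell] at h
  have : ξ.count (cell l i k j) < 2 := by exact_mod_cast h
  omega

/-- The counts of disjoint sets have the mixed moments `ν`. -/
def HasCorrelations (P : Measure (PointConfig X)) (ν : ∀ m, Measure (Fin m → X)) : Prop :=
  ∀ (m : ℕ) (A : Fin m → Set X), (∀ i, MeasurableSet (A i)) → Pairwise (Function.onFun Disjoint A) →
    ∫⁻ ξ, ∏ i, ξ.toMeasure (A i) ∂P = ν m (Set.univ.pi A)

variable {P : Measure (PointConfig X)} {ν : ∀ m, Measure (Fin m → X)} {κ : Measure X}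

theorem HasCorrelations.lintegral_prod_finset (h : HasCorrelations P ν) {ι : Type*} {Q : ι → Set X}
    (hQ : ∀ j, MeasurableSet (Q j)) (hd : Pairwise (Function.onFun Disjoint Q)) (S : Finset ι) :
    ∫⁻ ξ, ∏ j ∈ S, ξ.toMeasure (Q j) ∂P =
      ν S.card (Set.univ.pi fun i => Q (S.equivFin.symm i)) := by
  rw [← h _ _ (fun i => hQ _) fun i j hij => hd fun hc =>
    hij (S.equivFin.symm.injective (Subtype.ext hc))]
  refine lintegral_congr fun ξ => ?_
  rw [← Finset.prod_coe_sort S fun j => ξ.toMeasure (Q j)]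
  exact (S.equivFin.symm.prod_comp fun j : S => ξ.toMeasure (Q j)).symm

theorem HasCorrelations.lintegral_prod_finset_le [SigmaFinite κ] (h : HasCorrelations P ν)
    (hν : ∀ m, ν m ≤ Measure.pi fun _ => κ) {ι : Type*} {Q : ι → Set X}
    (hQ : ∀ j, MeasurableSet (Q j)) (hd : Pairwise (Function.onFun Disjoint Q)) (S : Finset ι) :
    ∫⁻ ξ, ∏ j ∈ S, ξ.toMeasure (Q j) ∂P ≤ ∏ j ∈ S, κ (Q j) := by
  rw [h.lintegral_prod_finset hQ hd]
  refine (hν _ _).trans_eq ?_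
  rw [Measure.pi_pi, ← Finset.prod_coe_sort S fun j => κ (Q j)]
  exact S.equivFin.symm.prod_comp fun j : S => κ (Q j)

theorem pairwise_disjoint_cell (l : CompactExhaustion X) (i k : ℕ) :
    Pairwise (Function.onFun Disjoint fun j : Fin (cellBound l i k) => cell l i k j) :=
  fun _ _ hjj => disjoint_cell l i k fun hc => hjj (Fin.ext hc)

/-- The product expands over subsets of cells, each bounded by a product of values of κ. Then 1 + x
≤ e^x gives a bound that does not depend on the mesh. -/
theorem HasCorrelations.lintegral_prod_one_add_le [SigmaFinite κ] (h : HasCorrelations P ν)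
    (hν : ∀ m, ν m ≤ Measure.pi fun _ => κ) (l : CompactExhaustion X) (i k : ℕ)
    (hκ : κ (l i) < ∞) :
    ∫⁻ ξ, ∏ j : Fin (cellBound l i k), (1 + ξ.toMeasure (cell l i k j)) ∂P ≤
      ENNReal.ofReal (Real.exp (κ (l i)).toReal) := by
  have hQ : ∀ j : Fin (cellBound l i k), MeasurableSet (cell l i k j) :=
    fun j => measurableSet_cell l i k j
  have hfin : ∀ j : Fin (cellBound l i k), κ (cell l i k j) ≠ ∞ := fun j =>
    ((measure_mono Set.inter_subset_left).trans_lt hκ).ne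
  simp_rw [Finset.prod_one_add]
  rw [lintegral_finsetSum _ fun S _ =>
    Finset.measurable_prod _ fun j _ => measurable_apply (hQ j)]
  calc _ ≤ ∑ S ∈ Finset.univ.powerset, ∏ j ∈ S, κ (cell l i k (j : Fin (cellBound l i k))) :=
        Finset.sum_le_sum fun S _ =>
          h.lintegral_prod_finset_le hν hQ (pairwise_disjoint_cell l i k) S
    _ = ∏ j : Fin (cellBound l i k), (1 + κ (cell l i k j)) := (Finset.prod_one_add _).symm
    _ ≤ ∏ j : Fin (cellBound l i k), ENNReal.ofReal (Real.exp (κ (cell l i k j)).toReal) := by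
        refine Finset.prod_le_prod' fun j _ => ?_
        rw [← ENNReal.ofReal_toReal (hfin j), ← ENNReal.ofReal_one,
          ← ENNReal.ofReal_add zero_le_one ENNReal.toReal_nonneg,
          ENNReal.toReal_ofReal ENNReal.toReal_nonneg]
        refine ENNReal.ofReal_le_ofReal ?_
        linarith [Real.add_one_le_exp (κ (cell l i k j)).toReal]
    _ = _ := by
        rw [← ENNReal.ofReal_prod_of_nonneg fun j _ => (Real.exp_pos _).le, ← Real.exp_sum,
          ← ENNReal.toReal_sum fun j _ => hfin j, sum_measure_cell]

/-- Only moments over disjoint sets are known. For a simple configuration every fine cell has at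
most one point, so the product of the 1 + count is eventually 2 to the total count, and Fatou's
lemma transfers the bound. -/
theorem HasCorrelations.lintegral_two_pow_count_le [SigmaFinite κ] (h : HasCorrelations P ν)
    (hν : ∀ m, ν m ≤ Measure.pi fun _ => κ) (hs : ∀ᵐ ξ ∂P, ∀ x : X, ξ.toMeasure {x} ≤ 1)
    (l : CompactExhaustion X) (i : ℕ) (hκ : κ (l i) < ∞) :
    ∫⁻ ξ, 2 ^ ξ.count (l i) ∂P ≤ ENNReal.ofReal (Real.exp (κ (l i)).toReal) := by
  have hlim : ∀ᵐ ξ ∂P, (2 : ℝ≥0∞) ^ ξ.count (l i) ≤ liminf (fun k =>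
      ∏ j : Fin (cellBound l i k), (1 + ξ.toMeasure (cell l i k j))) atTop := by
    filter_upwards [hs] with ξ hξ
    refine le_liminf_of_le (by isBoundedDefault) ?_
    filter_upwards [eventually_count_cell_le_one hξ l i] with k hk
    rw [← sum_count_cell ξ l i k, ← Finset.prod_pow_eq_pow_sum]
    refine Finset.prod_le_prod' fun j _ => ?_
    rw [← coe_count_cell]
    have := hk j
    interval_cases hc : ξ.count (cell l i k j)
    · simp
    · norm_num
  refine (lintegral_mono_ae hlim).trans ((lintegral_liminf_le fun k => ?_).trans ?_)
  · exact Finset.measurable_prod _ fun j _ =>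
      measurable_const.add (measurable_apply (measurableSet_cell l i k j))
  · refine liminf_le_of_frequently_le' (Frequently.of_forall fun k => ?_)
    exact h.lintegral_prod_one_add_le hν l i k hκ

end PointConfig

/-- The binomial expansion of (3 + 1)^N. It turns factorial moment bounds into an exponential moment
bound. -/
theorem four_pow_eq_tsum_descFactorial (N : ℕ) :
    (4 : ℝ≥0∞) ^ N = ∑' m : ℕ, (N.descFactorial m : ℝ≥0∞) * (3 ^ m / m.factorial) := by
  rw [tsum_eq_sum (s := Finset.range (N + 1))]
  · have h := add_pow (3 : ℝ≥0∞) 1 N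
    rw [show (3 : ℝ≥0∞) + 1 = 4 by norm_num] at h
    rw [h]
    refine Finset.sum_congr rfl fun m _ => ?_
    have hm : (m.factorial : ℝ≥0∞) ≠ 0 := by exact_mod_cast m.factorial_ne_zero
    rw [Nat.descFactorial_eq_factorial_mul_choose, one_pow, mul_one, Nat.cast_mul,
      mul_comm (m.factorial : ℝ≥0∞), mul_assoc,
      ENNReal.mul_div_cancel hm (ENNReal.natCast_ne_top _), mul_comm]
  · intro m hm
    rw [Finset.mem_range, not_lt] at hm
    rw [Nat.descFactorial_eq_zero_iff_lt.2 (by omega)]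
    simp

theorem tsum_pow_mul_pow_div_factorial {t : ℝ≥0∞} (ht : t < ∞) :
    ∑' m : ℕ, t ^ m * (3 ^ m / m.factorial) = ENNReal.ofReal (Real.exp (3 * t.toReal)) := by
  have h : HasSum (fun m : ℕ => (3 * t.toReal) ^ m / m.factorial) (Real.exp (3 * t.toReal)) := by
    rw [Real.exp_eq_exp_ℝ]
    exact NormedSpace.expSeries_div_hasSum_exp _
  rw [← h.tsum_eq, ENNReal.ofReal_tsum_of_nonneg (fun m => by positivity) h.summable]
  refine tsum_congr fun m => ?_
  rw [ENNReal.ofReal_div_of_pos (by positivity), ENNReal.ofReal_pow (by positivity),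
    ENNReal.ofReal_mul (by norm_num), ENNReal.ofReal_toReal ht.ne, ENNReal.ofReal_natCast,
    mul_pow]
  rw [show ENNReal.ofReal 3 = 3 by norm_num, ← mul_div_assoc, mul_comm]

/-! ### From convergence of correlations to convergence in law. -/

namespace PointConfig

variable {X : Type*} [MetricSpace X] [SecondCountableTopology X] [Nonempty X]
  [MeasurableSpace X] [BorelSpace X] [LocallyCompactSpace X]

variable {P : Measure (PointConfig X)} {ν : ∀ m, Measure (Fin m → X)} {κ : Measure X}

/-- The factorial moments of the counts are at most those of a Poisson process. -/
def HasFactorialBound (P : Measure (PointConfig X)) (κ : Measure X) : Prop :=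
  ∀ (m : ℕ) (A : Set X), MeasurableSet A →
    ∫⁻ ξ, ((ξ.count A).descFactorial m : ℝ≥0∞) ∂P ≤ κ A ^ m

theorem HasFactorialBound.lintegral_four_pow_le (h : HasFactorialBound P κ) {A : Set X}
    (hA : MeasurableSet A) (hκ : κ A < ∞) :
    ∫⁻ ξ, 4 ^ ξ.count A ∂P ≤ ENNReal.ofReal (Real.exp (3 * (κ A).toReal)) := by
  simp_rw [four_pow_eq_tsum_descFactorial]
  have hm : ∀ m : ℕ, Measurable fun ξ : PointConfig X =>
      ((ξ.count A).descFactorial m : ℝ≥0∞) := fun m =>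
    (measurable_of_countable fun N : ℕ => (N.descFactorial m : ℝ≥0∞)).comp (measurable_count hA)
  rw [lintegral_tsum fun m => ((hm m).mul_const _).aemeasurable,
    ← tsum_pow_mul_pow_div_factorial hκ]
  refine ENNReal.tsum_le_tsum fun m => ?_
  rw [lintegral_mul_const _ (hm m)]
  gcongr
  exact h m A hA

/-- The counts of a configuration in the cells of a compact set. -/
def cellCount (l : CompactExhaustion X) (i k : ℕ) (ξ : PointConfig X) :
    Fin (cellBound l i k) → ℕ := fun j => ξ.count (cell l i k j)

theorem measurable_cellCount (l : CompactExhaustion X) (i k : ℕ) :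
    Measurable (cellCount l i k) :=
  measurable_pi_lambda _ fun j => measurable_count (measurableSet_cell l i k j)

theorem measurable_multiplicityError (l : CompactExhaustion X) (i k : ℕ) :
    Measurable fun ξ => multiplicityError (cellCount l i k ξ) :=
  (measurable_of_countable multiplicityError).comp (measurable_cellCount l i k)

theorem HasFactorialBound.lintegral_multiplicityError_le (h : HasFactorialBound P κ)
    (l : CompactExhaustion X) (i k : ℕ) (hκ : κ (l i) < ∞) (M : ℕ) :
    ∫⁻ ξ, ENNReal.ofReal (multiplicityError (cellCount l i k ξ)) ∂P ≤
      2 ^ M * ∑ j : Fin (cellBound l i k), κ (cell l i k j) ^ 2 +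
        ENNReal.ofReal (Real.exp (3 * (κ (l i)).toReal)) / 2 ^ M := by
  have hm : ∀ j : Fin (cellBound l i k), Measurable fun ξ : PointConfig X =>
      ((ξ.count (cell l i k j)).descFactorial 2 : ℝ≥0∞) := fun j =>
    (measurable_of_countable fun N : ℕ => (N.descFactorial 2 : ℝ≥0∞)).comp
      (measurable_count (measurableSet_cell l i k j))
  have h4 : Measurable fun ξ : PointConfig X => (4 : ℝ≥0∞) ^ ξ.count (l i) :=
    (measurable_of_countable fun N : ℕ => (4 : ℝ≥0∞) ^ N).comp
      (measurable_count (l.isCompact i).measurableSet)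
  have hle : ∀ ξ : PointConfig X, ENNReal.ofReal (multiplicityError (cellCount l i k ξ)) ≤
      2 ^ M * ∑ j : Fin (cellBound l i k), ((ξ.count (cell l i k j)).descFactorial 2 : ℝ≥0∞) +
        4 ^ ξ.count (l i) / 2 ^ M := by
    intro ξ
    refine (ENNReal.ofReal_le_ofReal (multiplicityError_le_add _ M)).trans_eq ?_
    have hc : ∑ j, cellCount l i k ξ j = ξ.count (l i) := sum_count_cell ξ l i k
    rw [hc, ENNReal.ofReal_add (by positivity) (by positivity), ENNReal.ofReal_mul (by positivity),
      ENNReal.ofReal_div_of_pos (by positivity), ENNReal.ofReal_pow (by norm_num),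
      ENNReal.ofReal_pow (by norm_num), ENNReal.ofReal_sum_of_nonneg fun j _ => Nat.cast_nonneg _]
    simp [cellCount]
  refine (lintegral_mono hle).trans ?_
  rw [lintegral_add_right _ (h4.div_const _), lintegral_const_mul _
    (Finset.measurable_sum _ fun j _ => hm j), lintegral_finsetSum _ fun j _ => hm j]
  simp_rw [div_eq_mul_inv]
  rw [lintegral_mul_const _ h4]
  gcongr with j
  · exact h 2 _ (measurableSet_cell l i k j)
  · exact h.lintegral_four_pow_le (l.isCompact i).measurableSet hκ

/-- The sum is at most the largest mass of a cell times κ(l i), and without atoms the largest mass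
tends to zero. -/
theorem tendsto_sum_measure_cell_sq [κ.OuterRegular] (l : CompactExhaustion X) (i : ℕ)
    (hκ : κ (l i) < ∞) (h0 : ∀ x, κ {x} = 0) :
    Tendsto (fun k => ∑ j : Fin (cellBound l i k), κ (cell l i k j) ^ 2) atTop (𝓝 0) := by
  refine ENNReal.tendsto_nhds_zero.2 fun ε hε => ?_
  have hδ : 0 < ε / (κ (l i) + 1) :=
    ENNReal.div_pos hε.ne' (ENNReal.add_ne_top.2 ⟨hκ.ne, ENNReal.one_ne_top⟩)
  filter_upwards [eventually_measure_cell_lt l i (κ := κ) fun x => (h0 x).trans_lt hδ] with k hk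
  calc ∑ j : Fin (cellBound l i k), κ (cell l i k j) ^ 2
      ≤ ∑ j : Fin (cellBound l i k), ε / (κ (l i) + 1) * κ (cell l i k j) := by
        refine Finset.sum_le_sum fun j _ => ?_
        rw [pow_two]
        gcongr
        exact (hk j).le
    _ = ε / (κ (l i) + 1) * κ (l i) := by rw [← Finset.mul_sum, sum_measure_cell]
    _ ≤ ε / (κ (l i) + 1) * (κ (l i) + 1) := by gcongr; exact le_self_add
    _ = ε := ENNReal.div_mul_cancel (by simp) (ENNReal.add_ne_top.2 ⟨hκ.ne, ENNReal.one_ne_top⟩)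

/-- No factorial moments over a single set are assumed here, so simplicity takes their place: the
error vanishes for every fine mesh, and it is dominated by the integrable function 2 to the count.
-/
theorem HasCorrelations.lintegral_multiplicityError_lt_top [SigmaFinite κ]
    (h : HasCorrelations P ν)
    (hν : ∀ m, ν m ≤ Measure.pi fun _ => κ) (hs : ∀ᵐ ξ ∂P, ∀ x : X, ξ.toMeasure {x} ≤ 1)
    (l : CompactExhaustion X) (i : ℕ) (hκ : κ (l i) < ∞) :
    Tendsto (fun k => ∫⁻ ξ, ENNReal.ofReal (multiplicityError (cellCount l i k ξ)) ∂P) atTop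
      (𝓝 0) := by
  have h0 : (0 : ℝ≥0∞) = ∫⁻ _ : PointConfig X, 0 ∂P := by simp
  rw [h0]
  refine tendsto_lintegral_of_dominated_convergence (fun ξ => 2 ^ ξ.count (l i))
    (fun k => (measurable_multiplicityError l i k).ennreal_ofReal)
    (fun k => Eventually.of_forall fun ξ => ?_)
    ((h.lintegral_two_pow_count_le hν hs l i hκ).trans_lt ENNReal.ofReal_lt_top).ne ?_
  · refine (ENNReal.ofReal_le_ofReal (multiplicityError_le _)).trans_eq ?_
    have hc : ∑ j, cellCount l i k ξ j = ξ.count (l i) := sum_count_cell ξ l i k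
    rw [hc, ENNReal.ofReal_pow (by norm_num)]
    simp
  · filter_upwards [hs] with ξ hξ
    refine tendsto_const_nhds.congr' ?_
    filter_upwards [eventually_count_cell_le_one hξ l i] with k hk
    have h1 : ∀ j, cellCount l i k ξ j ≤ 1 := fun j => hk j
    rw [multiplicityError, if_pos h1, ENNReal.ofReal_zero]

theorem HasCorrelations.integral_sum_prod [SigmaFinite κ] (h : HasCorrelations P ν)
    (hν : ∀ m, ν m ≤ Measure.pi fun _ => κ) (l : CompactExhaustion X) (i k : ℕ)
    (hκ : κ (l i) < ∞) (a : Finset (Fin (cellBound l i k)) → ℝ) :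
    Integrable (fun ξ => ∑ S, a S * ∏ j ∈ S, (cellCount l i k ξ j : ℝ)) P ∧
    ∫ ξ, ∑ S, a S * ∏ j ∈ S, (cellCount l i k ξ j : ℝ) ∂P =
      ∑ S : Finset (Fin (cellBound l i k)), a S *
        (ν S.card (Set.univ.pi fun q => cell l i k (S.equivFin.symm q).1)).toReal := by
  have hQ : ∀ j : Fin (cellBound l i k), MeasurableSet (cell l i k j) :=
    fun j => measurableSet_cell l i k j
  have hlt : ∀ S : Finset (Fin (cellBound l i k)),
      ∫⁻ ξ, ∏ j ∈ S, ξ.toMeasure (cell l i k j) ∂P ≠ ∞ := fun S =>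
    ((h.lintegral_prod_finset_le hν hQ (pairwise_disjoint_cell l i k) S).trans_lt
      (ENNReal.prod_lt_top fun j _ => (measure_mono Set.inter_subset_left).trans_lt hκ)).ne
  have hm : ∀ S : Finset (Fin (cellBound l i k)),
      Measurable fun ξ : PointConfig X => ∏ j ∈ S, ξ.toMeasure (cell l i k j) := fun S =>
    Finset.measurable_prod _ fun j _ => measurable_apply (hQ j)
  have hprod : ∀ (S : Finset (Fin (cellBound l i k))) (ξ : PointConfig X),
      ∏ j ∈ S, (cellCount l i k ξ j : ℝ) = (∏ j ∈ S, ξ.toMeasure (cell l i k j)).toReal := by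
    intro S ξ
    rw [ENNReal.toReal_prod]
    refine Finset.prod_congr rfl fun j _ => ?_
    rw [← coe_count_cell, ENNReal.toReal_natCast]
    rfl
  have hint : ∀ S : Finset (Fin (cellBound l i k)),
      Integrable (fun ξ => a S * ∏ j ∈ S, (cellCount l i k ξ j : ℝ)) P := by
    intro S
    simp_rw [hprod]
    exact (integrable_toReal_of_lintegral_ne_top (hm S).aemeasurable (hlt S)).const_mul _
  refine ⟨integrable_finsetSum _ fun S _ => hint S, ?_⟩
  rw [integral_finsetSum _ fun S _ => hint S]
  refine Finset.sum_congr rfl fun S _ => ?_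
  rw [integral_const_mul, ← h.lintegral_prod_finset hQ (pairwise_disjoint_cell l i k) S]
  simp_rw [hprod]
  rw [integral_toReal (hm S).aemeasurable]
  refine Eventually.of_forall fun ξ => ENNReal.prod_lt_top fun j _ => ?_
  exact ξ.toMeasure_cell_lt_top l i k j

/-- The event that no cell has two points and that the family of occupied cells belongs to `𝒥`. -/
def occupancyEvent (l : CompactExhaustion X) (i k : ℕ)
    (𝒥 : Finset (Finset (Fin (cellBound l i k)))) : Set (PointConfig X) :=
  {ξ | (∀ j, cellCount l i k ξ j ≤ 1) ∧
    Finset.univ.filter (fun j => cellCount l i k ξ j = 1) ∈ 𝒥}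

theorem measurableSet_occupancyEvent (l : CompactExhaustion X) (i k : ℕ)
    (𝒥 : Finset (Finset (Fin (cellBound l i k)))) : MeasurableSet (occupancyEvent l i k 𝒥) :=
  measurable_cellCount l i k (MeasurableSet.of_discrete
    (s := {c : Fin (cellBound l i k) → ℕ | (∀ j, c j ≤ 1) ∧ Finset.univ.filter (fun j => c j = 1) ∈ 𝒥}))

theorem HasCorrelations.abs_integral_multilinearExt_sub_le [SigmaFinite κ] [IsFiniteMeasure P]
    (h : HasCorrelations P ν)
    (hν : ∀ m, ν m ≤ Measure.pi fun _ => κ) (l : CompactExhaustion X) (i k : ℕ)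
    (hκ : κ (l i) < ∞) (𝒥 : Finset (Finset (Fin (cellBound l i k)))) {δ : ℝ} (hδ : 0 ≤ δ)
    (hW : ∫⁻ ξ, ENNReal.ofReal (multiplicityError (cellCount l i k ξ)) ∂P ≤ ENNReal.ofReal δ) :
    |∫ ξ, multilinearExt 𝒥 (fun j => (cellCount l i k ξ j : ℝ)) ∂P -
      P.real (occupancyEvent l i k 𝒥)| ≤ δ := by
  obtain ⟨a, ha⟩ := exists_multilinearExt_eq 𝒥
  have hE := measurableSet_occupancyEvent l i k 𝒥
  have h1 : Integrable (fun ξ => multilinearExt 𝒥 (fun j => (cellCount l i k ξ j : ℝ))) P := by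
    simp_rw [ha]
    exact (h.integral_sum_prod hν l i k hκ a).1
  have h2 : Integrable ((occupancyEvent l i k 𝒥).indicator fun _ => (1 : ℝ)) P :=
    (integrable_const 1).indicator hE
  have hWm := measurable_multiplicityError l i k
  have hWi : Integrable (fun ξ => multiplicityError (cellCount l i k ξ)) P := by
    refine ⟨hWm.aestronglyMeasurable, ?_⟩
    rw [hasFiniteIntegral_iff_ofReal (Eventually.of_forall fun ξ => multiplicityError_nonneg _)]
    exact hW.trans_lt ENNReal.ofReal_lt_top
  have h3 : P.real (occupancyEvent l i k 𝒥) =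
      ∫ ξ, (occupancyEvent l i k 𝒥).indicator (fun _ => (1 : ℝ)) ξ ∂P := by
    rw [integral_indicator_const _ hE]; simp
  rw [h3, ← integral_sub h1 h2]
  have hWle : ∫ ξ, multiplicityError (cellCount l i k ξ) ∂P ≤ δ := by
    rw [integral_eq_lintegral_of_nonneg_ae (Eventually.of_forall fun ξ =>
      multiplicityError_nonneg _) hWm.aestronglyMeasurable]
    exact ENNReal.toReal_le_of_le_ofReal hδ hW
  rw [← Real.norm_eq_abs]
  refine le_trans (norm_integral_le_of_norm_le hWi (Eventually.of_forall fun ξ => ?_)) hWle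
  have := abs_multilinearExt_sub_le 𝒥 (cellCount l i k ξ)
  rw [Real.norm_eq_abs]
  convert this using 3
  by_cases hξ : ξ ∈ occupancyEvent l i k 𝒥
  · rw [Set.indicator_of_mem hξ]
    exact (if_pos hξ).symm
  · rw [Set.indicator_of_notMem hξ]
    exact (if_neg hξ).symm

/-- First M makes the exponential moment term small, then the mesh makes the second moment term
small. Both choices depend only on κ, so the bound is uniform in n. -/
theorem eventually_multiplicityError_le [κ.OuterRegular] {Q : ℕ → Measure (PointConfig X)}
    (h : ∀ n, HasFactorialBound (Q n) κ) (l : CompactExhaustion X) (i : ℕ) (hκ : κ (l i) < ∞)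
    (h0 : ∀ x, κ {x} = 0) {δ : ℝ} (hδ : 0 < δ) :
    ∀ᶠ k in atTop, ∀ n, ∫⁻ ξ, ENNReal.ofReal (multiplicityError (cellCount l i k ξ)) ∂(Q n) ≤
      ENNReal.ofReal δ := by
  set C : ℝ≥0∞ := ENNReal.ofReal (Real.exp (3 * (κ (l i)).toReal)) with hC
  have hM : Tendsto (fun M : ℕ => C / 2 ^ M) atTop (𝓝 0) := by
    have := ENNReal.Tendsto.const_mul (a := C)
      (ENNReal.tendsto_pow_atTop_nhds_zero_of_lt_one (r := 2⁻¹) (by norm_num))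
      (Or.inr ENNReal.ofReal_ne_top)
    rw [mul_zero] at this
    refine this.congr fun M => ?_
    rw [← ENNReal.inv_pow, div_eq_mul_inv]
  have hδ2 : (0 : ℝ≥0∞) < ENNReal.ofReal (δ / 2) := ENNReal.ofReal_pos.2 (by linarith)
  obtain ⟨M, hM⟩ := (hM.eventually (gt_mem_nhds hδ2)).exists
  have hk := ENNReal.Tendsto.const_mul (a := (2 : ℝ≥0∞) ^ M)
    (tendsto_sum_measure_cell_sq l i hκ h0) (Or.inr (by simp))
  rw [mul_zero] at hk
  filter_upwards [hk.eventually (gt_mem_nhds hδ2)] with k hk n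
  refine ((h n).lintegral_multiplicityError_le l i k hκ M).trans ?_
  rw [show δ = δ / 2 + δ / 2 by ring, ENNReal.ofReal_add (by linarith) (by linarith)]
  exact add_le_add hk.le hM.le

open Classical in
/-- The families of cells such that all the configurations with one point in each cell of the
family and none in the other ones belong to `G`. -/
def innerFamilies (l : CompactExhaustion X) (i k : ℕ) (G : Set (PointConfig X)) :
    Finset (Finset (Fin (cellBound l i k))) :=
  Finset.univ.filter fun J => ∀ ξ : PointConfig X,
    (∀ j, cellCount l i k ξ j = if j ∈ J then 1 else 0) → ξ ∈ G

theorem occupancyEvent_innerFamilies_subset (l : CompactExhaustion X) (i k : ℕ)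
    (G : Set (PointConfig X)) : occupancyEvent l i k (innerFamilies l i k G) ⊆ G := by
  classical
  rintro ξ ⟨h1, h2⟩
  refine (Finset.mem_filter.1 h2).2 ξ fun j => ?_
  have := h1 j
  by_cases hj : cellCount l i k ξ j = 1
  · simp [hj]
  · have h0 : cellCount l i k ξ j = 0 := by omega
    simp [h0]

/-- In a large window with fine cells, the counts of ξ already force membership in G, and they are
all 0 or 1; so the occupation events exhaust G up to non-simple configurations. -/
theorem eventually_mem_occupancyEvent (l : CompactExhaustion X) {G : Set (PointConfig X)}
    (hG : IsOpen G) {ξ : PointConfig X} (hs : ∀ x, ξ.toMeasure {x} ≤ 1) (hξ : ξ ∈ G) :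
    ∀ᶠ i in atTop, ∀ᶠ k in atTop, ξ ∈ occupancyEvent l i k (innerFamilies l i k G) := by
  classical
  filter_upwards [eventually_forall_mem_of_isOpen l hG hξ] with i hi
  filter_upwards [hi, eventually_count_cell_le_one hs l i] with k hk hk1
  refine ⟨fun j => hk1 j, Finset.mem_filter.2 ⟨Finset.mem_univ _, fun ξ' hξ' => hk ξ' fun j => ?_⟩⟩
  by_cases hj : j < cellBound l i k
  · rw [← coe_count_cell, ← coe_count_cell]
    have h := hξ' ⟨j, hj⟩
    have h2 := hk1 j
    have h4 : ξ'.count (cell l i k j) = if ξ.count (cell l i k j) = 1 then 1 else 0 :=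
      h.trans (if_congr (Finset.mem_filter.trans (and_iff_right (Finset.mem_univ _))) rfl rfl)
    rw [h4]
    split_ifs with h3
    · rw [h3]
    · have : ξ.count (cell l i k j) = 0 := by omega
      rw [this]
  · rw [cell_eq_empty l (not_lt.1 hj)]; simp

/-- Convergence of the correlations, for point processes with Poisson-like factorial moments,
implies convergence in law to any simple process with the limiting correlations. -/
theorem le_liminf_measure_of_isOpen [SigmaFinite κ] [κ.OuterRegular] [IsFiniteMeasureOnCompacts κ]
    (h0 : ∀ x, κ {x} = 0) {Q : ℕ → Measure (PointConfig X)} [∀ n, IsProbabilityMeasure (Q n)]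
    [IsProbabilityMeasure P] {νn : ℕ → ∀ m, Measure (Fin m → X)}
    (hQ : ∀ n, HasCorrelations (Q n) (νn n)) (hP : HasCorrelations P ν)
    (hνn : ∀ n m, νn n m ≤ Measure.pi fun _ => κ) (hν : ∀ m, ν m ≤ Measure.pi fun _ => κ)
    (hlim : ∀ m (S : Set (Fin m → X)), MeasurableSet S → (Measure.pi fun _ => κ) S < ∞ →
      Tendsto (fun n => νn n m S) atTop (𝓝 (ν m S)))
    (hfac : ∀ n, HasFactorialBound (Q n) κ) (hs : ∀ᵐ ξ ∂P, ∀ x : X, ξ.toMeasure {x} ≤ 1)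
    {G : Set (PointConfig X)} (hG : IsOpen G) :
    P G ≤ liminf (fun n => Q n G) atTop := by
  have l : CompactExhaustion X := default
  have hκ : ∀ i, κ (l i) < ∞ := fun i => (l.isCompact i).measure_lt_top
  set E : ∀ i k : ℕ, Set (PointConfig X) := fun i k =>
    occupancyEvent l i k (innerFamilies l i k G) with hE
  have hEm : ∀ i k, MeasurableSet (E i k) := fun i k => measurableSet_occupancyEvent l i k _
  have hexp : ∀ i k, Tendsto (fun n => ∫ ξ, multilinearExt (innerFamilies l i k G)
      (fun j => (cellCount l i k ξ j : ℝ)) ∂(Q n)) atTop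
      (𝓝 (∫ ξ, multilinearExt (innerFamilies l i k G)
        (fun j => (cellCount l i k ξ j : ℝ)) ∂P)) := by
    intro i k
    obtain ⟨a, ha⟩ := exists_multilinearExt_eq (innerFamilies l i k G)
    simp_rw [ha]
    rw [(hP.integral_sum_prod hν l i k (hκ i) a).2]
    simp_rw [fun n => ((hQ n).integral_sum_prod (hνn n) l i k (hκ i) a).2]
    refine tendsto_finsetSum _ fun S _ => Tendsto.const_mul _ ?_
    have hm : MeasurableSet (Set.univ.pi fun q => cell l i k (S.equivFin.symm q).1) :=
      MeasurableSet.univ_pi fun q => measurableSet_cell l i k _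
    have hfin : (Measure.pi fun _ => κ)
        (Set.univ.pi fun q => cell l i k (S.equivFin.symm q).1) < ∞ := by
      rw [Measure.pi_pi]
      exact ENNReal.prod_lt_top fun q _ => (measure_mono Set.inter_subset_left).trans_lt (hκ i)
    exact (ENNReal.tendsto_toReal ((hν _ _).trans_lt hfin).ne).comp (hlim _ _ hm hfin)
  -- The budget ε is split in three: multiplicity errors under P and under `Q n`, and the
  -- convergence of the polynomial expectations.
  have hstep : ∀ i, ∀ ε : ℝ, 0 < ε → ∀ᶠ k in atTop,
      P (E i k) ≤ liminf (fun n => Q n G) atTop + ENNReal.ofReal ε := by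
    intro i ε hε
    have hδ : 0 < ε / 3 := by linarith
    have hPk := (hP.lintegral_multiplicityError_lt_top hν hs l i (hκ i)).eventually
      (gt_mem_nhds (ENNReal.ofReal_pos.2 hδ))
    filter_upwards [hPk, eventually_multiplicityError_le hfac l i (hκ i) h0 hδ] with k hk1 hk2
    have h1 := hP.abs_integral_multilinearExt_sub_le hν l i k (hκ i) (innerFamilies l i k G) hδ.le
      hk1.le
    have h2 := fun n => (hQ n).abs_integral_multilinearExt_sub_le (hνn n) l i k (hκ i)
      (innerFamilies l i k G) hδ.le (hk2 n)
    have h3 := (hexp i k).eventually (lt_mem_nhds (sub_lt_self _ hδ))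
    have h4 : ∀ᶠ n in atTop, P (E i k) ≤ Q n G + ENNReal.ofReal ε := by
      filter_upwards [h3] with n hn
      have h5 : P.real (E i k) ≤ (Q n).real (E i k) + ε := by
        have h6 := abs_le.1 h1
        have h7 := abs_le.1 (h2 n)
        simp only [hE]
        linarith [h6.1, h6.2, h7.1, h7.2]
      have h8 := ENNReal.ofReal_le_ofReal h5
      rw [ENNReal.ofReal_add measureReal_nonneg hε.le, ofReal_measureReal, ofReal_measureReal] at h8
      exact h8.trans (by gcongr; exact occupancyEvent_innerFamilies_subset l i k G)
    have h9 : P (E i k) - ENNReal.ofReal ε ≤ liminf (fun n => Q n G) atTop := by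
      refine le_liminf_of_le (by isBoundedDefault) ?_
      filter_upwards [h4] with n hn
      exact tsub_le_iff_right.2 hn
    exact tsub_le_iff_right.1 h9
  have hL : ∀ i, liminf (fun k => P (E i k)) atTop ≤ liminf (fun n => Q n G) atTop := by
    intro i
    refine ENNReal.le_of_forall_pos_le_add fun ε hε _ => ?_
    refine liminf_le_of_frequently_le' ?_
    have := (hstep i ε hε).frequently
    simpa using this
  have hm1 : ∀ i k, Measurable ((E i k).indicator fun _ => (1 : ℝ≥0∞)) := fun i k =>
    measurable_const.indicator (hEm i k)
  -- A simple configuration in G lies in `E i k` for all large i and then all large k, so Fatou's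
  -- lemma is applied once in each index.
  calc P G = ∫⁻ ξ, G.indicator (fun _ => (1 : ℝ≥0∞)) ξ ∂P := by
        rw [lintegral_indicator_const hG.measurableSet, one_mul]
    _ ≤ ∫⁻ ξ, liminf (fun i => liminf (fun k =>
          (E i k).indicator (fun _ => (1 : ℝ≥0∞)) ξ) atTop) atTop ∂P := by
        refine lintegral_mono_ae ?_
        filter_upwards [hs] with ξ hξ
        by_cases hξG : ξ ∈ G
        · rw [Set.indicator_of_mem hξG]
          refine le_liminf_of_le (by isBoundedDefault) ?_
          filter_upwards [eventually_mem_occupancyEvent l hG hξ hξG] with i hi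
          refine le_liminf_of_le (by isBoundedDefault) ?_
          filter_upwards [hi] with k hk
          rw [Set.indicator_of_mem (show ξ ∈ E i k from hk)]
        · rw [Set.indicator_of_notMem hξG]; exact bot_le
    _ ≤ liminf (fun i => ∫⁻ ξ, liminf (fun k =>
          (E i k).indicator (fun _ => (1 : ℝ≥0∞)) ξ) atTop ∂P) atTop :=
        lintegral_liminf_le fun i => Measurable.liminf fun k => hm1 i k
    _ ≤ liminf (fun n => Q n G) atTop := by
        refine liminf_le_of_frequently_le' (Frequently.of_forall fun i => ?_)
        refine (lintegral_liminf_le fun k => hm1 i k).trans ?_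
        simp_rw [lintegral_indicator_const (hEm i _), one_mul]
        exact hL i

end PointConfig

/-! ### The outer particles converge in law. -/

section ParticleLaws

variable {V : ℝ → ℝ} {χ R : ℝ}

theorem outerConfig_apply {n : ℕ} (x : Fin n → ℂ) {A : Set (Exterior R)} (hA : MeasurableSet A) :
    (outerConfig R x).toMeasure A =
      ∑ k, (Subtype.val '' A).indicator (fun _ => (1 : ℝ≥0∞)) (x k) := by
  have hme := MeasurableEmbedding.subtype_coe (measurableSet_exterior R)
  change ((∑ k, Measure.dirac (x k)).comap Subtype.val) A = _
  rw [hme.comap_apply, Measure.coe_finsetSum, Finset.sum_apply]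
  exact Finset.sum_congr rfl fun k _ => Measure.dirac_apply' _ (hme.measurableSet_image.2 hA)

theorem measurable_outerConfig (R : ℝ) (n : ℕ) :
    Measurable fun x : Fin n → ℂ => outerConfig R x := by
  refine PointConfig.measurable_of_measurable_apply fun A hA => ?_
  have hme := MeasurableEmbedding.subtype_coe (measurableSet_exterior R)
  simp_rw [outerConfig_apply _ hA]
  exact Finset.measurable_sum _ fun k _ =>
    (measurable_const.indicator (hme.measurableSet_image.2 hA)).comp (measurable_pi_apply k)

theorem image_valPi_univ_pi {m : ℕ} (A : Fin m → Set (Exterior R)) :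
    valPi '' (Set.univ.pi A) = Set.univ.pi fun i => Subtype.val '' A i := by
  ext y
  simp only [Set.mem_image, Set.mem_univ_pi]
  constructor
  · rintro ⟨x, hx, rfl⟩ i
    exact ⟨x i, hx i, rfl⟩
  · intro h
    choose x hx hxy using h
    exact ⟨x, hx, funext hxy⟩

theorem prod_indicator_eq {m : ℕ} (C : Fin m → Set ℂ) (y : Fin m → ℂ) :
    ∏ i, (C i).indicator (fun _ => (1 : ℝ≥0∞)) (y i) =
      (Set.univ.pi C).indicator (fun _ => (1 : ℝ≥0∞)) y := by
  by_cases hy : y ∈ Set.univ.pi C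
  · rw [Set.indicator_of_mem hy]
    exact Finset.prod_eq_one fun i _ => Set.indicator_of_mem (hy i (Set.mem_univ i)) _
  · rw [Set.indicator_of_notMem hy]
    simp only [Set.mem_univ_pi, not_forall] at hy
    obtain ⟨i, hi⟩ := hy
    exact Finset.prod_eq_zero (Finset.mem_univ i) (Set.indicator_of_notMem hi _)

theorem lintegral_sum_embedding_indicator (hV : IsCirclePotential V) (hχ : 0 < χ) (hR : 1 ≤ R)
    (hV_eq : ∀ r, R ≤ r → V r = Real.log r) (n : ℕ) {m : ℕ} {A : Fin m → Set (Exterior R)}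
    (hA : ∀ i, MeasurableSet (A i)) :
    ∫⁻ x : Fin n → ℂ, ∑ f : Fin m ↪ Fin n, ∏ i,
      (Subtype.val '' A i).indicator (fun _ => (1 : ℝ≥0∞)) (x (f i)) ∂(coulombGas V χ n) =
      corrN V χ R n m (Set.univ.pi A) := by
  have hme := MeasurableEmbedding.subtype_coe (measurableSet_exterior R)
  have hC : ∀ i, MeasurableSet (Subtype.val '' A i) := fun i => hme.measurableSet_image.2 (hA i)
  rw [← sum_coulombGas_preimage hV hχ hR hV_eq n (MeasurableSet.univ_pi hA),
    lintegral_finsetSum]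
  · refine Finset.sum_congr rfl fun f _ => ?_
    have hmf : Measurable fun (x : Fin n → ℂ) i => x (f i) :=
      measurable_pi_lambda _ fun i => measurable_pi_apply _
    rw [image_valPi_univ_pi]
    have : MeasurableSet {x : Fin n → ℂ | (fun i => x (f i)) ∈
        Set.univ.pi fun i => Subtype.val '' A i} := hmf (MeasurableSet.univ_pi hC)
    rw [← lintegral_indicator_one this]
    refine lintegral_congr fun x => ?_
    rw [prod_indicator_eq (fun i => Subtype.val '' A i) fun i => x (f i)]
    rfl
  · exact fun f _ => Finset.measurable_prod _ fun i _ =>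
      (measurable_const.indicator (hC i)).comp (measurable_pi_apply _)

theorem sum_embedding_eq_sum_of_eq_zero {α β : Type*} [Fintype α] [Fintype β]
    [DecidableEq α] [DecidableEq β] {M : Type*} [AddCommMonoid M] {F : (α → β) → M}
    (hF : ∀ f, ¬ Function.Injective f → F f = 0) : ∑ f : α ↪ β, F f = ∑ f : α → β, F f := by
  rw [← Finset.sum_filter_of_ne (p := Function.Injective) fun f _ hf => by
    by_contra hc; exact hf (hF f hc)]
  refine Finset.sum_bij (fun (f : α ↪ β) _ => (f : α → β)) (fun f _ => ?_) (fun f _ g _ h => ?_)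
    (fun f hf => ?_) fun f _ => rfl
  · simpa using f.injective
  · exact DFunLike.coe_injective h
  · exact ⟨⟨f, (Finset.mem_filter.1 hf).2⟩, Finset.mem_univ _, rfl⟩

/-- The product of the counts expands over all maps from `Fin m` to the particles. Since the sets
are disjoint, maps that use a particle twice contribute zero. -/
theorem hasCorrelations_map_outerConfig (hV : IsCirclePotential V) (hχ : 0 < χ) (hR : 1 ≤ R)
    (hV_eq : ∀ r, R ≤ r → V r = Real.log r) (n : ℕ) :
    PointConfig.HasCorrelations ((coulombGas V χ n).map fun x => outerConfig R x)
      (corrN V χ R n) := by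
  intro m A hA hd
  rw [lintegral_map (Finset.measurable_prod _ fun i _ => PointConfig.measurable_apply (hA i))
    (measurable_outerConfig R n), ← lintegral_sum_embedding_indicator hV hχ hR hV_eq n hA]
  refine lintegral_congr fun x => ?_
  simp_rw [outerConfig_apply _ (hA _)]
  rw [Finset.prod_univ_sum, Fintype.piFinset_univ]
  refine (sum_embedding_eq_sum_of_eq_zero (F := fun f : Fin m → Fin n => ∏ i,
    (Subtype.val '' A i).indicator (fun _ => (1 : ℝ≥0∞)) (x (f i))) fun f hf => ?_).symm
  simp only [Function.Injective, not_forall] at hf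
  obtain ⟨i, j, hij, hne⟩ := hf
  by_cases hi : x (f i) ∈ Subtype.val '' A i
  · refine Finset.prod_eq_zero (Finset.mem_univ j) (Set.indicator_of_notMem (fun hj => ?_) _)
    rw [← hij] at hj
    have hdd := (Set.disjoint_image_iff Subtype.val_injective).2 (hd hne)
    exact Set.disjoint_left.1 hdd hi hj
  · exact Finset.prod_eq_zero (Finset.mem_univ i) (Set.indicator_of_notMem hi _)

theorem count_outerConfig {n : ℕ}
    (x : Fin n → ℂ) {A : Set (Exterior R)} [DecidablePred fun z => z ∈ Subtype.val '' A]
    (hA : MeasurableSet A) :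
    (outerConfig R x).count A = (Finset.univ.filter fun k => x k ∈ Subtype.val '' A).card := by
  rw [PointConfig.count, outerConfig_apply x hA]
  have : ∑ k, (Subtype.val '' A).indicator (fun _ => (1 : ℝ≥0∞)) (x k) =
      ((Finset.univ.filter fun k => x k ∈ Subtype.val '' A).card : ℝ≥0∞) := by
    rw [Finset.card_filter, Nat.cast_sum]
    refine Finset.sum_congr rfl fun k _ => ?_
    rw [Set.indicator_apply]
    split_ifs <;> simp
  rw [this]; simp

theorem card_embedding_forall_mem {m : ℕ} {β : Type*} [Fintype β] [DecidableEq β]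
    (T : Finset β) :
    (Finset.univ.filter fun f : Fin m ↪ β => ∀ i, f i ∈ T).card = T.card.descFactorial m := by
  have e : {f : Fin m ↪ β // ∀ i, f i ∈ T} ≃ (Fin m ↪ T) :=
    { toFun := fun f => ⟨fun i => ⟨f.1 i, f.2 i⟩, fun i j h => f.1.injective (congrArg Subtype.val h)⟩
      invFun := fun g => ⟨⟨fun i => g i, fun i j h => g.injective (Subtype.ext h)⟩, fun i => (g i).2⟩
      left_inv := fun f => rfl
      right_inv := fun g => rfl }
  rw [← Fintype.card_subtype, Fintype.card_congr e, Fintype.card_embedding_eq]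
  simp

theorem sum_embedding_prod_indicator_eq {n m : ℕ} (x : Fin n → ℂ) {A : Set (Exterior R)}
    (hA : MeasurableSet A) :
    ∑ f : Fin m ↪ Fin n, ∏ i, (Subtype.val '' A).indicator (fun _ => (1 : ℝ≥0∞)) (x (f i)) =
      (((outerConfig R x).count A).descFactorial m : ℝ≥0∞) := by
  classical
  rw [count_outerConfig x hA, ← card_embedding_forall_mem, Finset.card_filter, Nat.cast_sum]
  refine Finset.sum_congr rfl fun f _ => ?_
  rw [prod_indicator_eq (fun _ => Subtype.val '' A) fun i => x (f i), Set.indicator_apply]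
  simp

theorem lintegral_descFactorial_count (hV : IsCirclePotential V) (hχ : 0 < χ) (hR : 1 ≤ R)
    (hV_eq : ∀ r, R ≤ r → V r = Real.log r) (n m : ℕ) {A : Set (Exterior R)}
    (hA : MeasurableSet A) :
    ∫⁻ x, (((outerConfig R x).count A).descFactorial m : ℝ≥0∞) ∂(coulombGas V χ n) =
      corrN V χ R n m (Set.univ.pi fun _ => A) := by
  rw [← lintegral_sum_embedding_indicator hV hχ hR hV_eq n fun _ => hA]
  exact lintegral_congr fun x => (sum_embedding_prod_indicator_eq x hA).symm

theorem lintegral_descFactorial_count_le (hV : IsCirclePotential V) (hχ : 0 < χ) (hR : 1 ≤ R)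
    (hV_eq : ∀ r, R ≤ r → V r = Real.log r) (n m : ℕ) {A : Set (Exterior R)}
    (hA : MeasurableSet A) :
    ∫⁻ x, (((outerConfig R x).count A).descFactorial m : ℝ≥0∞) ∂(coulombGas V χ n) ≤
      intensityB χ R A ^ m := by
  rw [lintegral_descFactorial_count hV hχ hR hV_eq n m hA]
  refine (corrN_le hV hχ hR hV_eq n m _).trans_eq ?_
  rw [Measure.pi_pi]; simp

theorem hasFactorialBound_map_outerConfig (hV : IsCirclePotential V) (hχ : 0 < χ) (hR : 1 ≤ R)
    (hV_eq : ∀ r, R ≤ r → V r = Real.log r) (n : ℕ) :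
    PointConfig.HasFactorialBound ((coulombGas V χ n).map fun x => outerConfig R x)
      (intensityB χ R) := by
  intro m A hA
  rw [lintegral_map _ (measurable_outerConfig R n)]
  · exact lintegral_descFactorial_count_le hV hχ hR hV_eq n m hA
  · exact (measurable_of_countable fun N : ℕ => (N.descFactorial m : ℝ≥0∞)).comp
      (PointConfig.measurable_count hA)

/-- A compact subset of the open exterior stays at positive distance from the disk, where the
intensity is finite. -/
theorem isFiniteMeasureOnCompacts_intensityB (hχ : 0 < χ) (hR : 1 ≤ R) :
    IsFiniteMeasureOnCompacts (intensityB χ R) := by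
  refine ⟨fun K hK => ?_⟩
  obtain ⟨ρ, hρ, hKρ⟩ : ∃ ρ, R < ρ ∧ ∀ z ∈ K, ρ < ‖(z : ℂ)‖ := by
    rcases K.eq_empty_or_nonempty with rfl | hne
    · exact ⟨R + 1, by linarith, by simp⟩
    · obtain ⟨z, hz, hmin⟩ := hK.exists_isMinOn hne
        (continuous_subtype_val.norm : Continuous fun z : Exterior R => ‖(z : ℂ)‖).continuousOn
      have h1 : R < ‖(z : ℂ)‖ := z.2
      refine ⟨(R + ‖(z : ℂ)‖) / 2, by linarith, fun w hw => ?_⟩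
      have : ‖(z : ℂ)‖ ≤ ‖(w : ℂ)‖ := hmin hw
      linarith
  exact (measure_mono hKρ).trans_lt (intensityB_lt_top hχ hR hρ)

theorem IsDeterminantal.hasCorrelations {B : Measure (PointConfig (Exterior R))}
    (hB : IsDeterminantal B (lebesgueExterior R) (kernelB χ R)) :
    PointConfig.HasCorrelations B (corrB χ R) := by
  intro m A hA hd
  rw [hB.correlation m A hA hd, corrB, withDensity_apply _ (MeasurableSet.univ_pi hA)]

theorem le_liminf_map_outerConfig (hV : IsCirclePotential V) (hχ : 0 < χ) (hR : 1 ≤ R)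
    (hV_eq : ∀ r, R ≤ r → V r = Real.log r)
    (hV_gt : ∀ r, 1 < r → r < R → Real.log r < V r)
    {B : Measure (PointConfig (Exterior R))} [IsProbabilityMeasure B]
    (hB : IsDeterminantal B (lebesgueExterior R) (kernelB χ R)) {G : Set (PointConfig (Exterior R))}
    (hG : IsOpen G) :
    B G ≤ liminf (fun n => ((coulombGas V χ n).map fun x => outerConfig R x) G) atTop := by
  have hP := hV.isProbabilityMeasure_coulombGas hχ hR hV_eq
  have : ∀ n, IsProbabilityMeasure ((coulombGas V χ n).map fun x => outerConfig R x) := fun n =>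
    Measure.isProbabilityMeasure_map (measurable_outerConfig R n).aemeasurable
  have := isFiniteMeasureOnCompacts_intensityB hχ hR
  exact PointConfig.le_liminf_measure_of_isOpen (κ := intensityB χ R) (fun x => measure_singleton x)
    (fun n => hasCorrelations_map_outerConfig hV hχ hR hV_eq n) hB.hasCorrelations
    (fun n m => corrN_le hV hχ hR hV_eq n m) (corrB_le hV hχ hR hV_eq hV_gt)
    (fun m S hS hfin => tendsto_corrN hV hχ hR hV_eq hV_gt hS hfin)
    (fun n => hasFactorialBound_map_outerConfig hV hχ hR hV_eq n) hB.simple hG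

theorem tendstoInDistribution_outerConfig (hV : IsCirclePotential V) (hχ : 0 < χ) (hR : 1 ≤ R)
    (hV_eq : ∀ r, R ≤ r → V r = Real.log r)
    (hV_gt : ∀ r, 1 < r → r < R → Real.log r < V r)
    [∀ n, IsProbabilityMeasure (coulombGas V χ n)]
    {B : Measure (PointConfig (Exterior R))} [IsProbabilityMeasure B]
    (hB : IsDeterminantal B (lebesgueExterior R) (kernelB χ R)) :
    TendstoInDistribution (fun (n : ℕ) (x : Fin n → ℂ) => outerConfig R x) atTop
      (fun ξ => ξ) (fun n => coulombGas V χ n) B where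
  forall_aemeasurable n := (measurable_outerConfig R n).aemeasurable
  aemeasurable_limit := aemeasurable_id
  tendsto := by
    refine tendsto_of_forall_isOpen_le_liminf' fun G hG => ?_
    simp only [ProbabilityMeasure.coe_mk]
    rw [show (fun ξ : PointConfig (Exterior R) => ξ) = id from rfl, Measure.map_id]
    exact le_liminf_map_outerConfig hV hχ hR hV_eq hV_gt hB hG

end ParticleLaws

/-! ### Open conditions and atoms of configurations. -/

namespace PointConfig

variable {X : Type*} [MetricSpace X] [SecondCountableTopology X] [Nonempty X]
  [MeasurableSpace X] [BorelSpace X] [LocallyCompactSpace X]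

/-- A configuration that charges U charges a compact subset of it, hence has positive integral
against a bump function supported by U; this is an open condition that forces U to be charged. -/
theorem isOpen_setOf_measure_pos {U : Set X} (hU : IsOpen U) :
    IsOpen {ξ : PointConfig X | 0 < ξ.toMeasure U} := by
  refine isOpen_iff_mem_nhds.2 fun ξ hξ => ?_
  obtain ⟨K, hKU, hK, hpos⟩ := hU.exists_lt_isCompact (μ := ξ.toMeasure) hξ
  obtain ⟨f, hf1, hf0, hfc, hf01⟩ := exists_continuous_one_zero_of_isCompact hK hU.isClosed_compl
    (Set.disjoint_compl_right_iff_subset.2 hKU)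
  let φ : CompactlySupportedContinuousMap X ℝ := ⟨f, hfc⟩
  have hint : ∀ ζ : PointConfig X, Integrable φ ζ.toMeasure := fun ζ =>
    φ.continuous.integrable_of_hasCompactSupport φ.hasCompactSupport
  have h1 : 0 < ∫ x, φ x ∂ξ.toMeasure := by
    have hle : (ξ.toMeasure K).toReal ≤ ∫ x, φ x ∂ξ.toMeasure := by
      rw [← Measure.real, ← integral_indicator_one hK.measurableSet]
      refine integral_mono_of_nonneg (Eventually.of_forall fun x => ?_) (hint ξ)
        (Eventually.of_forall fun x => ?_)
      · exact Set.indicator_nonneg (fun _ _ => zero_le_one) x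
      · by_cases hx : x ∈ K
        · rw [Set.indicator_of_mem hx]; exact (hf1 hx).ge
        · rw [Set.indicator_of_notMem hx]; exact (hf01 x).1
    exact (ENNReal.toReal_pos hpos.ne' (ξ.finite_of_isCompact K hK).ne).trans_le hle
  filter_upwards [(continuous_integral φ).isOpen_preimage _ isOpen_Ioi |>.mem_nhds h1] with ζ hζ
  refine pos_iff_ne_zero.2 fun h0 => ?_
  have hz : ∫ x, φ x ∂ζ.toMeasure = 0 := by
    refine integral_eq_zero_of_ae ?_
    filter_upwards [measure_eq_zero_iff_ae_notMem.1 h0] with x hx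
    exact hf0 hx
  have : 0 < ∫ x, φ x ∂ζ.toMeasure := hζ
  exact this.ne' hz

/-- Counts are integers: if the integral of a bump function that is 1 on K is less than one, then K
has no point. -/
theorem isOpen_setOf_measure_eq_zero {K : Set X} (hK : IsCompact K) :
    IsOpen {ξ : PointConfig X | ξ.toMeasure K = 0} := by
  refine isOpen_iff_mem_nhds.2 fun ξ hξ => ?_
  have hξ0 : ξ.toMeasure K = 0 := hξ
  obtain ⟨U, hKU, hU, hlt⟩ := Set.exists_isOpen_lt_of_lt K 1 (hξ0.trans_lt one_pos)
  obtain ⟨f, hf1, hf0, hfc, hf01⟩ := exists_continuous_one_zero_of_isCompact hK hU.isClosed_compl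
    (Set.disjoint_compl_right_iff_subset.2 hKU)
  let φ : CompactlySupportedContinuousMap X ℝ := ⟨f, hfc⟩
  have hint : ∀ ζ : PointConfig X, Integrable φ ζ.toMeasure := fun ζ =>
    φ.continuous.integrable_of_hasCompactSupport φ.hasCompactSupport
  have h1 : ∫ x, φ x ∂ξ.toMeasure < 1 := by
    have hle : ∫ x, φ x ∂ξ.toMeasure ≤ (ξ.toMeasure U).toReal := by
      rw [← Measure.real, ← integral_indicator_one hU.measurableSet]
      refine integral_mono_of_nonneg (Eventually.of_forall fun x => (hf01 x).1)
        ((integrableOn_const (hlt.trans ENNReal.one_lt_top).ne).integrable_indicator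
          hU.measurableSet) (Eventually.of_forall fun x => ?_)
      by_cases hx : x ∈ U
      · rw [Set.indicator_of_mem hx]; exact (hf01 x).2
      · rw [Set.indicator_of_notMem hx]; exact (hf0 hx).le
    refine hle.trans_lt ?_
    rw [← ENNReal.toReal_one]
    exact (ENNReal.toReal_lt_toReal (hlt.trans ENNReal.one_lt_top).ne ENNReal.one_ne_top).2 hlt
  filter_upwards [(continuous_integral φ).isOpen_preimage _ isOpen_Iio |>.mem_nhds h1] with ζ hζ
  have hζ1 : ∫ x, φ x ∂ζ.toMeasure < 1 := hζ
  have hKt := ζ.finite_of_isCompact K hK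
  have hle : (ζ.toMeasure K).toReal ≤ ∫ x, φ x ∂ζ.toMeasure := by
    rw [← Measure.real, ← integral_indicator_one hK.measurableSet]
    refine integral_mono_of_nonneg (Eventually.of_forall fun x => ?_) (hint ζ)
      (Eventually.of_forall fun x => ?_)
    · exact Set.indicator_nonneg (fun _ _ => zero_le_one) x
    · by_cases hx : x ∈ K
      · rw [Set.indicator_of_mem hx]; exact (hf1 hx).ge
      · rw [Set.indicator_of_notMem hx]; exact (hf01 x).1
  obtain ⟨m, hm⟩ := exists_natCast_eq hK.measurableSet hKt
  change ζ.toMeasure K = 0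
  rw [hm] at hle ⊢
  rw [ENNReal.toReal_natCast] at hle
  have : m < 1 := by exact_mod_cast hle.trans_lt hζ1
  simp [Nat.lt_one_iff.1 this]

/-- Without atoms every point of A has an open neighbourhood of mass less than one, hence zero by
integrality, so A is locally null and therefore null. -/
theorem exists_atom {ξ : PointConfig X} {A : Set X} (hA : ξ.toMeasure A ≠ 0) :
    ∃ z ∈ A, ξ.toMeasure {z} ≠ 0 := by
  by_contra h
  push Not at h
  refine hA (measure_null_of_locally_null A fun x hx => ?_)
  obtain ⟨U, hxU, hU, hlt⟩ := Set.exists_isOpen_lt_of_lt {x} 1 ((h x hx).trans_lt one_pos)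
  refine ⟨U, mem_nhdsWithin_of_mem_nhds (hU.mem_nhds (hxU rfl)), ?_⟩
  obtain ⟨m, hm⟩ := exists_natCast_eq hU.measurableSet (hlt.trans ENNReal.one_lt_top)
  rw [hm] at hlt ⊢
  have : m < 1 := by exact_mod_cast hlt
  simp [Nat.lt_one_iff.1 this]

theorem one_le_of_ne_zero {ξ : PointConfig X} {A : Set X} (hA : MeasurableSet A)
    (h : ξ.toMeasure A ≠ 0) : 1 ≤ ξ.toMeasure A := by
  obtain ⟨m, hm⟩ := ξ.integer_valued A hA
  rw [hm] at h ⊢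
  have : 1 ≤ m := Order.one_le_iff_ne_zero.2 fun h0 => h (by simp [h0])
  exact_mod_cast this

theorem finite_atoms {ξ : PointConfig X} {A : Set X} (hA : ξ.toMeasure A < ∞) :
    {z | z ∈ A ∧ ξ.toMeasure {z} ≠ 0}.Finite := by
  have h := Measure.finite_const_le_meas_of_disjoint_iUnion ξ.toMeasure one_pos
    (As := fun z : A => {(z : X)}) (fun z => measurableSet_singleton _) (fun z w hzw => by
      simpa [Function.onFun, Subtype.ext_iff] using hzw) (by
      refine ((measure_mono ?_).trans_lt hA).ne
      exact Set.iUnion_subset fun z => Set.singleton_subset_iff.2 z.2)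
  refine (h.image Subtype.val).subset ?_
  rintro z ⟨hz, hne⟩
  exact ⟨⟨z, hz⟩, one_le_of_ne_zero (measurableSet_singleton z) hne, rfl⟩

end PointConfig

/-! ### Moduli of the points and the maximum. -/

section Moduli

variable {R : ℝ}

/-- The points of modulus larger than `t`. -/
def outside (R t : ℝ) : Set (Exterior R) := {z | t < ‖(z : ℂ)‖}

theorem isOpen_outside (R t : ℝ) : IsOpen (outside R t) :=
  isOpen_lt continuous_const continuous_subtype_val.norm

/-- A nonempty configuration with finitely many points at positive distance of the disk has a point
of maximal modulus. -/
theorem isGreatest_moduli {ξ : PointConfig (Exterior R)} (hne : ξ.toMeasure Set.univ ≠ 0)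
    (hfin : ∀ t, R < t → ξ.toMeasure (outside R t) < ∞) :
    IsGreatest (moduli ξ) (sSup (moduli ξ)) := by
  obtain ⟨z, -, hz⟩ := PointConfig.exists_atom hne
  have hzR : R < ‖(z : ℂ)‖ := z.2
  -- Points of modulus at most this midpoint cannot compete with z, and only finitely many points
  -- lie beyond it.
  set t := (R + ‖(z : ℂ)‖) / 2 with ht
  have hS := (PointConfig.finite_atoms (hfin t (by linarith))).image
    fun w : Exterior R => ‖(w : ℂ)‖
  have hzS : ‖(z : ℂ)‖ ∈ (fun w : Exterior R => ‖(w : ℂ)‖) ''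
      {w | w ∈ outside R t ∧ ξ.toMeasure {w} ≠ 0} :=
    ⟨z, ⟨show t < ‖(z : ℂ)‖ by linarith, hz⟩, rfl⟩
  obtain ⟨r, ⟨w, hw, rfl⟩, hmax⟩ := Set.exists_max_image _ id hS ⟨_, hzS⟩
  have hgr : IsGreatest (moduli ξ) ‖(w : ℂ)‖ := by
    refine ⟨⟨w, hw.2, rfl⟩, ?_⟩
    rintro _ ⟨v, hv, rfl⟩
    by_cases hvt : v ∈ outside R t
    · exact hmax _ ⟨v, ⟨hvt, hv⟩, rfl⟩
    · have h1 : ‖(v : ℂ)‖ ≤ t := not_lt.1 hvt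
      have h2 : ‖(z : ℂ)‖ ≤ ‖(w : ℂ)‖ := hmax _ hzS
      linarith
  rwa [hgr.csSup_eq]

theorem sSup_moduli_le_iff {ξ : PointConfig (Exterior R)}
    (h : IsGreatest (moduli ξ) (sSup (moduli ξ))) (r : ℝ) :
    sSup (moduli ξ) ≤ r ↔ ξ.toMeasure (outside R r) = 0 := by
  constructor
  · intro hr
    by_contra hne
    obtain ⟨z, hz, hz0⟩ := PointConfig.exists_atom hne
    have h1 : r < ‖(z : ℂ)‖ := hz
    have h2 : ‖(z : ℂ)‖ ≤ sSup (moduli ξ) := h.2 ⟨z, hz0, rfl⟩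
    linarith
  · intro h0
    by_contra hr
    obtain ⟨z, hz, hzr⟩ := h.1
    refine hz (measure_mono_null (Set.singleton_subset_iff.2 ?_) h0)
    change r < ‖(z : ℂ)‖
    rw [hzr]; exact not_le.1 hr

theorem outerConfig_outside_eq_zero_iff {n : ℕ} (x : Fin n → ℂ) {t : ℝ} (ht : R ≤ t) :
    (outerConfig R x).toMeasure (outside R t) = 0 ↔ ∀ i, ‖x i‖ ≤ t := by
  rw [outerConfig_apply x (isOpen_outside R t).measurableSet, Finset.sum_eq_zero_iff]
  refine ⟨fun h i => ?_, fun h i _ => ?_⟩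
  · by_contra hi
    have h1 := h i (Finset.mem_univ i)
    rw [Set.indicator_of_mem] at h1
    · exact one_ne_zero h1
    · exact ⟨⟨x i, ht.trans_lt (not_le.1 hi)⟩, not_le.1 hi, rfl⟩
  · refine Set.indicator_of_notMem ?_ _
    rintro ⟨z, hz, hzx⟩
    have h1 : t < ‖(z : ℂ)‖ := hz
    have h2 := h i
    rw [← hzx] at h2
    linarith

theorem measurable_maxModulus (n : ℕ) : Measurable (maxModulus (n := n)) :=
  Measurable.iSup fun i => (measurable_pi_apply i).norm

/-- The condition 0 ≤ t matters only for n = 0, where the supremum is 0 by convention. -/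
theorem maxModulus_le_iff {n : ℕ} (x : Fin n → ℂ) {t : ℝ} (ht : 0 ≤ t) :
    maxModulus x ≤ t ↔ ∀ i, ‖x i‖ ≤ t := by
  constructor
  · intro h i
    exact (le_ciSup (f := fun k => ‖x k‖) (Set.finite_range _).bddAbove i).trans h
  · exact fun h => Real.iSup_le h ht

end Moduli

theorem PointConfig.HasCorrelations.lintegral_apply_le {X : Type*} [MetricSpace X]
    [SecondCountableTopology X] [Nonempty X] [MeasurableSpace X] [BorelSpace X]
    [LocallyCompactSpace X] {P : Measure (PointConfig X)} {ν : ∀ m, Measure (Fin m → X)}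
    {κ : Measure X} [SigmaFinite κ] (h : HasCorrelations P ν)
    (hν : ∀ m, ν m ≤ Measure.pi fun _ => κ) {A : Set X} (hA : MeasurableSet A) :
    ∫⁻ ξ, ξ.toMeasure A ∂P ≤ κ A := by
  simpa using h.lintegral_prod_finset_le hν (Q := fun _ : Unit => A) (fun _ => hA)
    (fun i j hij => absurd (Subsingleton.elim i j) hij) {()}

theorem PointConfig.HasCorrelations.measure_ne_zero_le {X : Type*} [MetricSpace X]
    [SecondCountableTopology X] [Nonempty X] [MeasurableSpace X] [BorelSpace X]
    [LocallyCompactSpace X] {P : Measure (PointConfig X)} {ν : ∀ m, Measure (Fin m → X)}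
    {κ : Measure X} [SigmaFinite κ] (h : HasCorrelations P ν)
    (hν : ∀ m, ν m ≤ Measure.pi fun _ => κ) {A : Set X} (hA : MeasurableSet A) :
    P {ξ | ξ.toMeasure A ≠ 0} ≤ κ A := by
  refine le_trans ?_ (h.lintegral_apply_le hν hA)
  have h1 := mul_meas_ge_le_lintegral (μ := P) (measurable_apply hA) 1
  rw [one_mul] at h1
  exact (measure_mono fun ξ hξ => one_le_of_ne_zero hA hξ).trans h1

/-! ### Law of the maximum of the limiting process. -/

section Maximum

variable {V : ℝ → ℝ} {χ R : ℝ}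

/-- The limiting distribution function of the maximal modulus. -/
def maxCdf (χ R t : ℝ) : ℝ := ∏' k : ℕ, (1 - (R / t) ^ (2 * (k : ℝ) + 2 * χ))

theorem measurableSet_outside (R t : ℝ) : MeasurableSet (outside R t) :=
  (isOpen_outside R t).measurableSet

theorem tendsto_intensityB_outside (hχ : 0 < χ) (hR : 1 ≤ R) :
    Tendsto (fun s : ℕ => intensityB χ R (outside R s)) atTop (𝓝 0) := by
  have hanti : Antitone fun s : ℕ => outside R s := fun s s' h z hz =>
    lt_of_le_of_lt (Nat.cast_le.2 h) (show (s' : ℝ) < ‖(z : ℂ)‖ from hz)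
  obtain ⟨s0, hs0⟩ := exists_nat_gt R
  have h := tendsto_measure_iInter_atTop (μ := intensityB χ R)
    (fun s : ℕ => (measurableSet_outside R s).nullMeasurableSet) hanti
    ⟨s0, (intensityB_lt_top hχ hR hs0).ne⟩
  have hemp : ⋂ s : ℕ, outside R s = ∅ := by
    refine Set.eq_empty_of_forall_notMem fun z hz => ?_
    obtain ⟨s, hs⟩ := exists_nat_gt ‖(z : ℂ)‖
    have h1 : (s : ℝ) < ‖(z : ℂ)‖ := Set.mem_iInter.1 hz s
    linarith
  rwa [hemp, measure_empty] at h

theorem intensityB_sphere (χ R t : ℝ) : intensityB χ R {z | ‖(z : ℂ)‖ = t} = 0 := by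
  refine withDensity_absolutelyContinuous _ _ ?_
  have hme := MeasurableEmbedding.subtype_coe (measurableSet_exterior R)
  rw [lebesgueExterior, hme.comap_apply]
  rcases eq_or_ne t 0 with rfl | ht
  · refine measure_mono_null (t := {0}) ?_ (measure_singleton 0)
    rintro _ ⟨z, hz, rfl⟩
    exact norm_eq_zero.1 hz
  · refine measure_mono_null (t := Metric.sphere 0 t) ?_ (Measure.addHaar_sphere_of_ne_zero _ 0 ht)
    rintro _ ⟨z, hz, rfl⟩
    exact mem_sphere_zero_iff_norm.2 hz

theorem isCompact_annulus {t s : ℝ} (ht : R < t) :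
    IsCompact {z : Exterior R | t ≤ ‖(z : ℂ)‖ ∧ ‖(z : ℂ)‖ ≤ s} := by
  rw [Subtype.isCompact_iff]
  have himg : Subtype.val '' {z : Exterior R | t ≤ ‖(z : ℂ)‖ ∧ ‖(z : ℂ)‖ ≤ s} =
      {z : ℂ | t ≤ ‖z‖} ∩ Metric.closedBall 0 s := by
    ext z
    simp only [Set.mem_image, Set.mem_inter_iff, mem_closedBall_zero_iff]
    constructor
    · rintro ⟨w, hw, rfl⟩
      exact hw
    · intro hz
      exact ⟨⟨z, lt_of_lt_of_le ht hz.1⟩, hz, rfl⟩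
  rw [himg]
  exact (isCompact_closedBall 0 s).inter_left (isClosed_le continuous_const continuous_norm)

variable {B : Measure (PointConfig (Exterior R))}

theorem ae_forall_outside_lt_top (hV : IsCirclePotential V) (hχ : 0 < χ) (hR : 1 ≤ R)
    (hV_eq : ∀ r, R ≤ r → V r = Real.log r)
    (hV_gt : ∀ r, 1 < r → r < R → Real.log r < V r)
    (hB : IsDeterminantal B (lebesgueExterior R) (kernelB χ R)) :
    ∀ᵐ ξ ∂B, ∀ t, R < t → ξ.toMeasure (outside R t) < ∞ := by
  have h : ∀ n : ℕ, ∀ᵐ ξ ∂B, ξ.toMeasure (outside R (R + 1 / ((n : ℝ) + 1))) < ∞ := fun n =>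
    ae_lt_top (PointConfig.measurable_apply (measurableSet_outside _ _))
      ((hB.hasCorrelations.lintegral_apply_le (corrB_le hV hχ hR hV_eq hV_gt)
        (measurableSet_outside _ _)).trans_lt (intensityB_lt_top hχ hR (by
          have : (0 : ℝ) < 1 / ((n : ℝ) + 1) := by positivity
          linarith))).ne
  filter_upwards [ae_all_iff.2 h] with ξ hξ t ht
  obtain ⟨n, hn⟩ := exists_nat_one_div_lt (sub_pos.2 ht)
  refine (measure_mono fun z hz => ?_).trans_lt (hξ n)
  have h1 : t < ‖(z : ℂ)‖ := hz
  change R + 1 / ((n : ℝ) + 1) < ‖(z : ℂ)‖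
  linarith

theorem map_outerConfig_outside_eq_zero (V : ℝ → ℝ) (χ : ℝ)
    (n : ℕ) [IsProbabilityMeasure (coulombGas V χ n)] {t : ℝ} (ht : R ≤ t) :
    ((coulombGas V χ n).map fun x => outerConfig R x) {ξ | ξ.toMeasure (outside R t) = 0} =
      ENNReal.ofReal ((coulombGas V χ n).real {x | ∀ i, ‖x i‖ ≤ t}) := by
  have hm : MeasurableSet {ξ : PointConfig (Exterior R) | ξ.toMeasure (outside R t) = 0} :=
    PointConfig.measurable_apply (measurableSet_outside R t) (measurableSet_singleton 0)
  rw [Measure.map_apply (measurable_outerConfig R n) hm, ofReal_measureReal]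
  congr 1
  ext x
  exact outerConfig_outside_eq_zero_iff x ht

theorem tendsto_map_outerConfig_outside (hV : IsCirclePotential V) (hχ : 0 < χ) (hR : 1 ≤ R)
    (hV_eq : ∀ r, R ≤ r → V r = Real.log r)
    (hV_gt : ∀ r, 1 < r → r < R → Real.log r < V r) {t : ℝ} (ht : R ≤ t) :
    Tendsto (fun n => ((coulombGas V χ n).map fun x => outerConfig R x)
      {ξ | ξ.toMeasure (outside R t) = 0}) atTop (𝓝 (ENNReal.ofReal (maxCdf χ R t))) := by
  have hP := hV.isProbabilityMeasure_coulombGas hχ hR hV_eq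
  simp_rw [fun n => map_outerConfig_outside_eq_zero V χ n ht]
  exact ENNReal.tendsto_ofReal (tendsto_coulombGas_forall_norm_le hV hχ hR hV_eq hV_gt ht)

/-- The set of points beyond t is not compact, so it is replaced by a closed annulus. Its inner
circle almost surely has no point, and the points beyond its outer radius s cost at most an
intensity, uniformly in n, which vanishes as s grows. -/
theorem measure_outside_eq_zero_le (hV : IsCirclePotential V) (hχ : 0 < χ) (hR : 1 ≤ R)
    (hV_eq : ∀ r, R ≤ r → V r = Real.log r)
    (hV_gt : ∀ r, 1 < r → r < R → Real.log r < V r) [IsProbabilityMeasure B]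
    (hB : IsDeterminantal B (lebesgueExterior R) (kernelB χ R)) {t : ℝ} (ht : R < t) :
    B {ξ | ξ.toMeasure (outside R t) = 0} ≤ ENNReal.ofReal (maxCdf χ R t) := by
  have hlim := (tendsto_map_outerConfig_outside hV hχ hR hV_eq hV_gt ht.le)
  have hsphere : ∀ᵐ ξ ∂B, ξ.toMeasure {z : Exterior R | ‖(z : ℂ)‖ = t} = 0 := by
    have hm : MeasurableSet {z : Exterior R | ‖(z : ℂ)‖ = t} :=
      measurable_subtype_coe.norm (measurableSet_singleton t)
    have h := hB.hasCorrelations.measure_ne_zero_le (corrB_le hV hχ hR hV_eq hV_gt) hm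
    rw [intensityB_sphere] at h
    exact nonpos_iff_eq_zero.1 h
  have hstep : ∀ s : ℕ, B {ξ | ξ.toMeasure (outside R t) = 0} ≤
      ENNReal.ofReal (maxCdf χ R t) + intensityB χ R (outside R s) := by
    intro s
    set K := {z : Exterior R | t ≤ ‖(z : ℂ)‖ ∧ ‖(z : ℂ)‖ ≤ s} with hK
    have h1 : B {ξ | ξ.toMeasure (outside R t) = 0} ≤ B {ξ | ξ.toMeasure K = 0} := by
      refine measure_mono_ae ?_
      filter_upwards [hsphere] with ξ hξ h0
      refine measure_mono_null (t := outside R t ∪ {z : Exterior R | ‖(z : ℂ)‖ = t}) ?_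
        (measure_union_null h0 hξ)
      intro z hz
      rcases eq_or_lt_of_le hz.1 with h | h
      · exact Or.inr h.symm
      · exact Or.inl h
    have h2 := le_liminf_map_outerConfig hV hχ hR hV_eq hV_gt hB
      (PointConfig.isOpen_setOf_measure_eq_zero (isCompact_annulus (s := s) ht))
    refine h1.trans (h2.trans ?_)
    have h3 : Tendsto (fun n => ((coulombGas V χ n).map fun x => outerConfig R x)
        {ξ | ξ.toMeasure (outside R t) = 0} + intensityB χ R (outside R s)) atTop
        (𝓝 (ENNReal.ofReal (maxCdf χ R t) + intensityB χ R (outside R s))) :=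
      hlim.add tendsto_const_nhds
    rw [← h3.liminf_eq]
    refine liminf_le_liminf (Eventually.of_forall fun n => ?_)
    refine le_trans (measure_mono (t := {ξ | ξ.toMeasure (outside R t) = 0} ∪
      {ξ | ξ.toMeasure (outside R s) ≠ 0}) ?_) ((measure_union_le _ _).trans (by
        gcongr
        exact (hasCorrelations_map_outerConfig hV hχ hR hV_eq n).measure_ne_zero_le
          (corrN_le hV hχ hR hV_eq n) (measurableSet_outside R s)))
    intro ξ hξ
    by_cases hs : ξ.toMeasure (outside R s) = 0
    · refine Or.inl (measure_mono_null (t := K ∪ outside R s) ?_ (measure_union_null hξ hs))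
      intro z hz
      by_cases hzs : z ∈ outside R s
      · exact Or.inr hzs
      · exact Or.inl ⟨le_of_lt hz, not_lt.1 hzs⟩
    · exact Or.inr hs
  have h4 := (tendsto_intensityB_outside hχ hR).const_add (ENNReal.ofReal (maxCdf χ R t))
  rw [add_zero] at h4
  exact ge_of_tendsto' h4 hstep

/-- The reverse bound: the complementary event, that an open set has a point, is open, so the
portmanteau inequality applies to it. -/
theorem measureReal_outside_eq_zero (hV : IsCirclePotential V) (hχ : 0 < χ) (hR : 1 ≤ R)
    (hV_eq : ∀ r, R ≤ r → V r = Real.log r)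
    (hV_gt : ∀ r, 1 < r → r < R → Real.log r < V r) [IsProbabilityMeasure B]
    (hB : IsDeterminantal B (lebesgueExterior R) (kernelB χ R)) {t : ℝ} (ht : R < t) :
    B {ξ | ξ.toMeasure (outside R t) = 0} = ENNReal.ofReal (maxCdf χ R t) := by
  refine le_antisymm (measure_outside_eq_zero_le hV hχ hR hV_eq hV_gt hB ht) ?_
  have hP := hV.isProbabilityMeasure_coulombGas hχ hR hV_eq
  have hQ : ∀ n, IsProbabilityMeasure ((coulombGas V χ n).map fun x => outerConfig R x) := fun n =>
    Measure.isProbabilityMeasure_map (measurable_outerConfig R n).aemeasurable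
  have hlim := (tendsto_map_outerConfig_outside hV hχ hR hV_eq hV_gt ht.le)
  have hm : MeasurableSet {ξ : PointConfig (Exterior R) | ξ.toMeasure (outside R t) = 0} :=
    PointConfig.measurable_apply (measurableSet_outside R t) (measurableSet_singleton 0)
  have hc : {ξ : PointConfig (Exterior R) | 0 < ξ.toMeasure (outside R t)} =
      {ξ | ξ.toMeasure (outside R t) = 0}ᶜ := by
    ext ξ; simp [pos_iff_ne_zero]
  have h2 := le_liminf_map_outerConfig hV hχ hR hV_eq hV_gt hB
      (PointConfig.isOpen_setOf_measure_pos (isOpen_outside R t))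
  rw [hc] at h2
  simp_rw [fun n => prob_compl_eq_one_sub (μ := (coulombGas V χ n).map fun x => outerConfig R x) hm]
    at h2
  rw [prob_compl_eq_one_sub hm] at h2
  have h3 : Tendsto (fun n => 1 - ((coulombGas V χ n).map fun x => outerConfig R x)
      {ξ | ξ.toMeasure (outside R t) = 0}) atTop (𝓝 (1 - ENNReal.ofReal (maxCdf χ R t))) :=
    ENNReal.Tendsto.sub tendsto_const_nhds hlim (Or.inl ENNReal.one_ne_top)
  rw [h3.liminf_eq] at h2
  have h5 : ENNReal.ofReal (maxCdf χ R t) ≤ 1 := le_of_tendsto' hlim fun n => prob_le_one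
  exact (ENNReal.sub_le_sub_iff_left h5 ENNReal.one_ne_top).1 h2

theorem maxCdf_le (χ : ℝ) (hχ : 0 < χ) (hR : 1 ≤ R) {t : ℝ} (ht : R ≤ t) :
    maxCdf χ R t ≤ 1 - (R / t) ^ (2 * χ) := by
  have hm := (multipliable_one_sub_rpow χ hR ht).hasProd.tendsto_prod_nat
  have h0 : 0 ≤ R / t := by have : 0 < t := by linarith
                            positivity
  have h1 : R / t ≤ 1 := (div_le_one (by linarith)).2 ht
  have hb : ∀ k : ℕ, 0 ≤ 1 - (R / t) ^ (2 * (k : ℝ) + 2 * χ) ∧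
      1 - (R / t) ^ (2 * (k : ℝ) + 2 * χ) ≤ 1 := fun k =>
    ⟨sub_nonneg.2 (Real.rpow_le_one h0 h1 (by positivity)),
      sub_le_self _ (Real.rpow_nonneg h0 _)⟩
  refine le_of_tendsto hm ?_
  filter_upwards [eventually_ge_atTop 1] with N hN
  obtain ⟨N, rfl⟩ := Nat.exists_eq_add_of_le' hN
  rw [Finset.prod_range_succ']
  have h2 : ∏ k ∈ Finset.range N, (1 - (R / t) ^ (2 * ((k + 1 : ℕ) : ℝ) + 2 * χ)) ≤ 1 :=
    Finset.prod_le_one (fun k _ => (hb (k + 1)).1) fun k _ => (hb (k + 1)).2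
  refine (mul_le_of_le_one_left (hb 0).1 h2).trans_eq ?_
  simp

/-- An empty configuration has no point beyond any t > R, which has probability at most 1 -
(R/t)^{2χ}; this tends to zero as t decreases to R. -/
theorem ae_measure_univ_ne_zero (hV : IsCirclePotential V) (hχ : 0 < χ) (hR : 1 ≤ R)
    (hV_eq : ∀ r, R ≤ r → V r = Real.log r)
    (hV_gt : ∀ r, 1 < r → r < R → Real.log r < V r) [IsProbabilityMeasure B]
    (hB : IsDeterminantal B (lebesgueExterior R) (kernelB χ R)) :
    ∀ᵐ ξ ∂B, ξ.toMeasure Set.univ ≠ 0 := by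
  have hb : ∀ᶠ t in 𝓝[>] R, B {ξ | ξ.toMeasure Set.univ = 0} ≤
      ENNReal.ofReal (1 - (R / t) ^ (2 * χ)) := by
    filter_upwards [self_mem_nhdsWithin] with t ht
    have htR : R < t := ht
    have hsub : {ξ : PointConfig (Exterior R) | ξ.toMeasure Set.univ = 0} ⊆
        {ξ | ξ.toMeasure (outside R t) = 0} := fun ξ hξ =>
      measure_mono_null (Set.subset_univ _) hξ
    exact (measure_mono hsub).trans
      ((measure_outside_eq_zero_le hV hχ hR hV_eq hV_gt hB htR).trans
        (ENNReal.ofReal_le_ofReal (maxCdf_le χ hχ hR htR.le)))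
  have hlim : Tendsto (fun t => ENNReal.ofReal (1 - (R / t) ^ (2 * χ))) (𝓝[>] R) (𝓝 0) := by
    have hR0 : R ≠ 0 := by linarith
    have hc : ContinuousAt (fun t => ENNReal.ofReal (1 - (R / t) ^ (2 * χ))) R := by
      refine ENNReal.continuous_ofReal.continuousAt.comp (continuousAt_const.sub ?_)
      exact (continuousAt_const.div continuousAt_id hR0).rpow_const (Or.inr (by linarith))
    have := hc.tendsto.mono_left (nhdsWithin_le_nhds (s := Set.Ioi R))
    simpa [div_self hR0] using this
  have h0 : B {ξ | ξ.toMeasure Set.univ = 0} ≤ 0 := ge_of_tendsto hlim hb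
  rw [ae_iff]
  simpa using h0

theorem ae_isGreatest_moduli (hV : IsCirclePotential V) (hχ : 0 < χ) (hR : 1 ≤ R)
    (hV_eq : ∀ r, R ≤ r → V r = Real.log r)
    (hV_gt : ∀ r, 1 < r → r < R → Real.log r < V r) [IsProbabilityMeasure B]
    (hB : IsDeterminantal B (lebesgueExterior R) (kernelB χ R)) :
    ∀ᵐ ξ ∂B, IsGreatest (moduli ξ) (sSup (moduli ξ)) := by
  filter_upwards [ae_measure_univ_ne_zero hV hχ hR hV_eq hV_gt hB,
    ae_forall_outside_lt_top hV hχ hR hV_eq hV_gt hB] with ξ h1 h2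
  exact isGreatest_moduli h1 h2

/-- Where the maximum is attained, its sublevel sets are void events, which are measurable; so all
sublevel sets are measurable up to null sets. -/
theorem aemeasurable_sSup_moduli (h : ∀ᵐ ξ ∂B, IsGreatest (moduli ξ) (sSup (moduli ξ))) :
    AEMeasurable (fun ξ => sSup (moduli ξ)) B := by
  refine NullMeasurable.aemeasurable ?_
  have hm : @Measurable (NullMeasurableSpace (PointConfig (Exterior R)) B) ℝ _ _
      (fun ξ : PointConfig (Exterior R) => sSup (moduli ξ)) := by
    refine measurable_of_Iic fun r => ?_
    change NullMeasurableSet {ξ : PointConfig (Exterior R) | sSup (moduli ξ) ≤ r} B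
    have hr : MeasurableSet {ξ : PointConfig (Exterior R) | ξ.toMeasure (outside R r) = 0} :=
      PointConfig.measurable_apply (measurableSet_outside R r) (measurableSet_singleton 0)
    refine hr.nullMeasurableSet.congr ?_
    filter_upwards [h] with ξ hξ
    exact propext (sSup_moduli_le_iff hξ r).symm
  exact fun s hs => hm hs

theorem map_sSup_moduli_Iic (hV : IsCirclePotential V) (hχ : 0 < χ) (hR : 1 ≤ R)
    (hV_eq : ∀ r, R ≤ r → V r = Real.log r)
    (hV_gt : ∀ r, 1 < r → r < R → Real.log r < V r) [IsProbabilityMeasure B]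
    (hB : IsDeterminantal B (lebesgueExterior R) (kernelB χ R)) (t : ℝ) :
    (B.map fun ξ => sSup (moduli ξ)) (Set.Iic t) =
      if R ≤ t then ENNReal.ofReal (maxCdf χ R t) else 0 := by
  have hgr := ae_isGreatest_moduli hV hχ hR hV_eq hV_gt hB
  rw [Measure.map_apply_of_aemeasurable (aemeasurable_sSup_moduli hgr) measurableSet_Iic]
  have h1 : B ((fun ξ => sSup (moduli ξ)) ⁻¹' Set.Iic t) =
      B {ξ | ξ.toMeasure (outside R t) = 0} := by
    refine measure_congr ?_
    filter_upwards [hgr] with ξ hξ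
    exact propext (sSup_moduli_le_iff hξ t)
  rw [h1]
  -- For t ≤ R the condition is that the whole configuration is empty.
  have hle : ∀ t ≤ R, B {ξ | ξ.toMeasure (outside R t) = 0} = 0 := by
    intro t ht
    have huniv : outside R t = Set.univ :=
      Set.eq_univ_of_forall fun z => lt_of_le_of_lt ht z.2
    rw [huniv]
    have := ae_measure_univ_ne_zero hV hχ hR hV_eq hV_gt hB
    rw [ae_iff] at this
    simpa using this
  split_ifs with h
  · rcases eq_or_lt_of_le h with h | h
    · rw [hle t h.ge]
      have := maxCdf_le χ hχ hR h.le
      rw [← h, div_self (by linarith), Real.one_rpow, sub_self] at this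
      rw [← h, ENNReal.ofReal_of_nonpos this]
    · exact measureReal_outside_eq_zero hV hχ hR hV_eq hV_gt hB h
  · exact hle t (not_le.1 h).le

theorem setOf_maxModulus_le {n : ℕ} {t : ℝ} (ht : 0 ≤ t) :
    {x : Fin n → ℂ | maxModulus x ≤ t} = {x | ∀ i, ‖x i‖ ≤ t} :=
  Set.ext fun x => maxModulus_le_iff x ht

theorem tendsto_map_maxModulus_Iic (hV : IsCirclePotential V) (hχ : 0 < χ) (hR : 1 ≤ R)
    (hV_eq : ∀ r, R ≤ r → V r = Real.log r)
    (hV_gt : ∀ r, 1 < r → r < R → Real.log r < V r) (t : ℝ) :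
    Tendsto (fun n => ((coulombGas V χ n).map maxModulus) (Set.Iic t)) atTop
      (𝓝 (if R ≤ t then ENNReal.ofReal (maxCdf χ R t) else 0)) := by
  have hP := hV.isProbabilityMeasure_coulombGas hχ hR hV_eq
  have hge : ∀ t, R ≤ t → Tendsto (fun n => ((coulombGas V χ n).map maxModulus) (Set.Iic t)) atTop
      (𝓝 (ENNReal.ofReal (maxCdf χ R t))) := by
    intro t ht
    refine (ENNReal.tendsto_ofReal
      (tendsto_coulombGas_forall_norm_le hV hχ hR hV_eq hV_gt ht)).congr fun n => ?_
    rw [ofReal_measureReal, Measure.map_apply (measurable_maxModulus n) measurableSet_Iic,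
      ← setOf_maxModulus_le (by linarith)]
    rfl
  split_ifs with h
  · exact hge t h
  · have h0 := hge R le_rfl
    have := maxCdf_le χ hχ hR (le_refl R)
    rw [div_self (by linarith), Real.one_rpow, sub_self] at this
    rw [ENNReal.ofReal_of_nonpos this] at h0
    exact tendsto_of_tendsto_of_tendsto_of_le_of_le tendsto_const_nhds h0 (fun n => bot_le)
      fun n => measure_mono (Set.Iic_subset_Iic.2 (not_le.1 h).le)

/-- Differences give convergence on half-open intervals, a π-system that contains arbitrarily small
neighbourhoods of every point. -/
theorem tendsto_of_tendsto_measure_Iic {μs : ℕ → ProbabilityMeasure ℝ} {μ : ProbabilityMeasure ℝ}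
    (h : ∀ t, Tendsto (fun n => (μs n : Measure ℝ) (Set.Iic t)) atTop
      (𝓝 ((μ : Measure ℝ) (Set.Iic t)))) : Tendsto μs atTop (𝓝 μ) := by
  have hIoc : ∀ (ν : ProbabilityMeasure ℝ) (a b : ℝ), a ≤ b →
      (ν : Measure ℝ) (Set.Ioc a b) = (ν : Measure ℝ) (Set.Iic b) - (ν : Measure ℝ) (Set.Iic a) := by
    intro ν a b hab
    rw [← Set.Iic_sdiff_Iic, measure_sdiff (Set.Iic_subset_Iic.2 hab)
      measurableSet_Iic.nullMeasurableSet (measure_ne_top _ _)]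
  refine (isPiSystem_Ioc (id : ℝ → ℝ) id).tendsto_probabilityMeasure_of_tendsto_of_mem ?_ ?_ ?_
  · rintro _ ⟨a, b, -, rfl⟩
    exact measurableSet_Ioc
  · intro u hu x hx
    obtain ⟨ε, hε, hball⟩ := Metric.isOpen_iff.1 hu x hx
    refine ⟨Set.Ioc (x - ε / 2) (x + ε / 2), ⟨_, _, by simp; linarith, rfl⟩,
      Ioc_mem_nhds (by linarith) (by linarith), fun y hy => hball ?_⟩
    rw [Metric.mem_ball, Real.dist_eq, abs_lt]
    constructor <;> linarith [hy.1, hy.2]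
  · rintro _ ⟨a, b, hab, rfl⟩
    have h1 := ENNReal.Tendsto.sub (h b) (h a) (Or.inl (measure_ne_top _ _))
    simp_rw [← hIoc _ a b (le_of_lt hab)] at h1
    have h2 := (ENNReal.tendsto_toNNReal (measure_ne_top _ _)).comp h1
    exact h2

theorem tendstoInDistribution_maxModulus (hV : IsCirclePotential V) (hχ : 0 < χ) (hR : 1 ≤ R)
    (hV_eq : ∀ r, R ≤ r → V r = Real.log r)
    (hV_gt : ∀ r, 1 < r → r < R → Real.log r < V r)
    [∀ n, IsProbabilityMeasure (coulombGas V χ n)] [IsProbabilityMeasure B]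
    (hB : IsDeterminantal B (lebesgueExterior R) (kernelB χ R)) :
    TendstoInDistribution (fun (n : ℕ) (x : Fin n → ℂ) => maxModulus x) atTop
      (fun ξ => sSup (moduli ξ)) (fun n => coulombGas V χ n) B where
  forall_aemeasurable n := (measurable_maxModulus n).aemeasurable
  aemeasurable_limit := aemeasurable_sSup_moduli (ae_isGreatest_moduli hV hχ hR hV_eq hV_gt hB)
  tendsto := by
    refine tendsto_of_tendsto_measure_Iic fun t => ?_
    simp only [ProbabilityMeasure.coe_mk]
    rw [map_sSup_moduli_Iic hV hχ hR hV_eq hV_gt hB t]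
    exact tendsto_map_maxModulus_Iic hV hχ hR hV_eq hV_gt t

end Maximum

/-! ### Labelling the outer particles by annulus and rank. -/

section Labels

variable {R : ℝ} {n : ℕ}

/-- The index of the annulus that contains a point outside the disk. -/
def level (R : ℝ) (z : ℂ) : ℕ := ⌊1 / (‖z‖ - R)⌋₊

theorem measurable_level (R : ℝ) : Measurable (level R) :=
  Nat.measurable_floor.comp (measurable_const.div (measurable_norm.sub_const R))

open Classical in
/-- The particle `x i` is outside the disk, in the annulus `p.1`, and is preceded by `p.2` particles
in this annulus. -/
def IsLabel (R : ℝ) (x : Fin n → ℂ) (p : ℕ × ℕ) (i : Fin n) : Prop :=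
  (R < ‖x i‖ ∧ level R (x i) = p.1) ∧
    (Finset.univ.filter fun j => j < i ∧ (R < ‖x j‖ ∧ level R (x j) = p.1)).card = p.2

open Classical in
/-- The particle with label `p`, or `0` if there is none. -/
def labelled (R : ℝ) (x : Fin n → ℂ) (p : ℕ × ℕ) : ℂ := ∑ i, if IsLabel R x p i then x i else 0

/-- Within one annulus the rank strictly increases with the index. -/
theorem IsLabel.index_unique {x : Fin n → ℂ} {p : ℕ × ℕ} {i j : Fin n} (hi : IsLabel R x p i)
    (hj : IsLabel R x p j) : i = j := by
  classical
  have key : ∀ i j : Fin n, IsLabel R x p i → IsLabel R x p j → ¬ i < j := by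
    intro i j hi hj hij
    have hlt : (Finset.univ.filter fun k => k < i ∧ (R < ‖x k‖ ∧ level R (x k) = p.1)).card <
        (Finset.univ.filter fun k => k < j ∧ (R < ‖x k‖ ∧ level R (x k) = p.1)).card := by
      refine Finset.card_lt_card (Finset.ssubset_iff_of_subset (fun k hk => ?_) |>.2 ⟨i, ?_, ?_⟩)
      · simp only [Finset.mem_filter, Finset.mem_univ, true_and] at hk ⊢
        exact ⟨hk.1.trans hij, hk.2⟩
      · simp only [Finset.mem_filter, Finset.mem_univ, true_and]
        exact ⟨hij, hi.1⟩
      · simp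
    have h1 := hi.2
    have h2 := hj.2
    omega
  exact le_antisymm (not_lt.1 (key j i hj hi)) (not_lt.1 (key i j hi hj))

theorem IsLabel.label_unique {x : Fin n → ℂ} {p q : ℕ × ℕ} {i : Fin n} (hp : IsLabel R x p i)
    (hq : IsLabel R x q i) : p = q := by
  have h1 : p.1 = q.1 := hp.1.2.symm.trans hq.1.2
  have h2 := hp.2
  rw [h1] at h2
  exact Prod.ext h1 (h2.symm.trans hq.2)

theorem exists_isLabel {x : Fin n → ℂ} {i : Fin n} (hi : R < ‖x i‖) : ∃ p, IsLabel R x p i := by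
  classical
  refine ⟨(level R (x i), (Finset.univ.filter fun j => j < i ∧
    (R < ‖x j‖ ∧ level R (x j) = level R (x i))).card), ⟨hi, rfl⟩, ?_⟩
  convert rfl

theorem IsLabel.labelled_eq {x : Fin n → ℂ} {p : ℕ × ℕ} {i : Fin n} (hi : IsLabel R x p i) :
    labelled R x p = x i := by
  classical
  rw [labelled, Finset.sum_eq_single i]
  · rw [if_pos hi]
  · intro j _ hj
    rw [if_neg fun h => hj (h.index_unique hi)]
  · simp

theorem labelled_eq_zero {x : Fin n → ℂ} {p : ℕ × ℕ} (h : ∀ i, ¬ IsLabel R x p i) :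
    labelled R x p = 0 := by
  classical
  exact Finset.sum_eq_zero fun i _ => if_neg (h i)

/-- The default value 0 lies in the disk, so a labelled point outside the disk is a genuine
particle. -/
theorem exists_isLabel_of_lt {x : Fin n → ℂ} {p : ℕ × ℕ} (hR : 0 ≤ R)
    (h : R < ‖labelled R x p‖) : ∃ i, IsLabel R x p i := by
  by_contra hc
  push Not at hc
  rw [labelled_eq_zero hc, norm_zero] at h
  linarith

theorem measurable_labelled (R : ℝ) (n : ℕ) : Measurable (labelled R (n := n)) := by
  classical
  refine measurable_pi_lambda _ fun p => Finset.measurable_sum _ fun i _ => ?_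
  have hm : ∀ j : Fin n, MeasurableSet {x : Fin n → ℂ | R < ‖x j‖ ∧ level R (x j) = p.1} := by
    intro j
    refine MeasurableSet.inter ?_ ?_
    · exact measurableSet_lt measurable_const (measurable_pi_apply j).norm
    · exact (measurable_level R).comp (measurable_pi_apply j) (measurableSet_singleton p.1)
  refine Measurable.ite ?_ (measurable_pi_apply i) measurable_const
  refine (hm i).inter ?_
  have hc : Measurable fun x : Fin n → ℂ =>
      (Finset.univ.filter fun j => j < i ∧ (R < ‖x j‖ ∧ level R (x j) = p.1)).card := by
    simp_rw [Finset.card_filter]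
    refine Finset.measurable_sum _ fun j _ => Measurable.ite ?_ measurable_const measurable_const
    exact (MeasurableSet.const _).inter (hm j)
  exact hc (measurableSet_singleton p.2)

/-- Families of distinct labels correspond to families of distinct particles. -/
theorem tsum_labelled_eq (hR : 0 ≤ R) (x : Fin n → ℂ) {m : ℕ} {S : Set (Fin m → ℂ)}
    (hS : S ⊆ Set.univ.pi fun _ => Exterior R) :
    ∑' p : Fin m ↪ ℕ × ℕ, S.indicator (fun _ => (1 : ℝ≥0∞)) (fun i => labelled R x (p i)) =
      ∑ f : Fin m ↪ Fin n, S.indicator (fun _ => (1 : ℝ≥0∞)) (fun i => x (f i)) := by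
  rw [← tsum_fintype (L := .unconditional _)]
  have hout : ∀ f : Fin m ↪ Fin n, (fun i => x (f i)) ∈ S → ∀ i, ∃ p, IsLabel R x p (f i) :=
    fun f hf i => exists_isLabel (hS hf i (Set.mem_univ i))
  have hmem : ∀ f : Function.support fun f : Fin m ↪ Fin n =>
      S.indicator (fun _ => (1 : ℝ≥0∞)) (fun i => x (f i)), (fun i => x (f.1 i)) ∈ S := by
    intro f
    by_contra hc
    exact f.2 (Set.indicator_of_notMem hc _)
  choose ℓ hℓ using fun f : Function.support fun f : Fin m ↪ Fin n =>
      S.indicator (fun _ => (1 : ℝ≥0∞)) (fun i => x (f i)) => hout f.1 (hmem f)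
  have hinj : ∀ f, Function.Injective (ℓ f) := by
    intro f i j hij
    have h1 := hℓ f i
    rw [hij] at h1
    exact f.1.injective (h1.index_unique (hℓ f j))
  refine tsum_eq_tsum_of_ne_zero_bij (fun f => ⟨ℓ f, hinj f⟩) ?_ ?_ ?_
  · intro f g hfg
    refine Subtype.ext (Function.Embedding.ext fun i => ?_)
    have h : ℓ f i = ℓ g i := congrArg (fun e : Fin m ↪ ℕ × ℕ => e i) hfg
    have h1 := hℓ f i
    rw [h] at h1
    exact h1.index_unique (hℓ g i)
  · intro p hp
    have hpS : (fun i => labelled R x (p i)) ∈ S := by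
      by_contra hc
      exact hp (Set.indicator_of_notMem hc _)
    choose f hf using fun i => exists_isLabel_of_lt hR (hS hpS i (Set.mem_univ i))
    have hfi : Function.Injective f := by
      intro i j hij
      have h1 := hf i
      rw [hij] at h1
      exact p.injective (h1.label_unique (hf j))
    have hxS : (fun i => x (f i)) ∈ S := by
      have : (fun i => x (f i)) = fun i => labelled R x (p i) :=
        funext fun i => (hf i).labelled_eq.symm
      rwa [this]
    refine ⟨⟨⟨f, hfi⟩, ?_⟩, ?_⟩
    · rw [Function.mem_support]
      change S.indicator (fun _ => (1 : ℝ≥0∞)) (fun i => x (f i)) ≠ 0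
      rw [Set.indicator_of_mem hxS]
      exact one_ne_zero
    · exact Function.Embedding.ext fun i => (hℓ _ i).label_unique (hf i)
  · intro f
    have : (fun i => labelled R x (ℓ f i)) = fun i => x (f.1 i) :=
      funext fun i => (hℓ f i).labelled_eq
    change S.indicator (fun _ => (1 : ℝ≥0∞)) (fun i => labelled R x (ℓ f i)) = _
    rw [this]

/-- A floor at most J gives 1/(|z| - R) < J + 1; the constant J + 2 leaves some room. -/
theorem lt_norm_of_level_le {J : ℕ} {z : ℂ} (hz : R < ‖z‖) (h : level R z ≤ J) :
    R + 1 / ((J : ℝ) + 2) < ‖z‖ := by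
  have h1 : 1 / (‖z‖ - R) < (J : ℝ) + 2 := by
    have h2 := Nat.lt_floor_add_one (1 / (‖z‖ - R))
    have h3 : (level R z : ℝ) ≤ J := Nat.cast_le.2 h
    unfold level at h3
    linarith
  have h0 : 0 < ‖z‖ - R := sub_pos.2 hz
  rw [one_div_lt h0 (by positivity)] at h1
  linarith

theorem level_le_of_lt_norm {ρ : ℝ} (hρ : R < ρ) {z : ℂ} (hz : ρ < ‖z‖) :
    level R z ≤ ⌊1 / (ρ - R)⌋₊ := by
  refine Nat.floor_le_floor ?_
  exact one_div_le_one_div_of_le (by linarith) (by linarith)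

theorem lt_count_of_isLabel {x : Fin n → ℂ} {J : ℕ} {p : ℕ × ℕ} {i : Fin n} (h : IsLabel R x p i)
    (hJ : p.1 ≤ J) : p.2 < (outerConfig R x).count (outside R (R + 1 / ((J : ℝ) + 2))) := by
  classical
  rw [count_outerConfig x (measurableSet_outside _ _), ← h.2]
  have hmem : ∀ j, (R < ‖x j‖ ∧ level R (x j) = p.1) →
      x j ∈ Subtype.val '' outside R (R + 1 / ((J : ℝ) + 2)) := fun j hj =>
    ⟨⟨x j, hj.1⟩, lt_norm_of_level_le hj.1 (hj.2.trans_le hJ), rfl⟩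
  refine Finset.card_lt_card (Finset.ssubset_iff_of_subset (fun k hk => ?_) |>.2 ⟨i, ?_, ?_⟩)
  · simp only [Finset.mem_filter, Finset.mem_univ, true_and] at hk ⊢
    exact hmem k hk.2
  · simp only [Finset.mem_filter, Finset.mem_univ, true_and]
    exact hmem i h.1
  · simp

/-- The families of labels with bounded entries. -/
def boundedLabels (m J K : ℕ) : Set (Fin m ↪ ℕ × ℕ) := {p | ∀ i, (p i).1 ≤ J ∧ (p i).2 < K}

theorem finite_boundedLabels (m J K : ℕ) : (boundedLabels m J K).Finite := by
  have h : {f : Fin m → ℕ × ℕ | ∀ i, f i ∈ Set.Iic J ×ˢ Set.Iio K}.Finite :=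
    Set.Finite.pi' fun i => (Set.finite_Iic J).prod (Set.finite_Iio K)
  exact h.preimage (f := fun p : Fin m ↪ ℕ × ℕ => (p : Fin m → ℕ × ℕ))
    DFunLike.coe_injective.injOn

theorem mul_descFactorial_eq (N m : ℕ) :
    N * N.descFactorial m = N.descFactorial (m + 1) + m * N.descFactorial m := by
  rcases lt_or_ge N m with h | h
  · rw [Nat.descFactorial_eq_zero_iff_lt.2 h, Nat.descFactorial_eq_zero_iff_lt.2 (by omega)]
    simp
  · rw [Nat.descFactorial_succ, ← Nat.add_mul, Nat.sub_add_cancel h]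

/-- Beyond ρ all levels are at most J, so a tuple outside `boundedLabels` has a rank at least K.
This forces K ≤ N, so such a term costs at most N/K. There are at most N.descFactorial m tuples, and
N times this number is a sum of factorial powers. -/
theorem tsum_labelled_le {ρ : ℝ} (hR : 0 ≤ R) (hρ : R < ρ) (x : Fin n → ℂ) {m : ℕ}
    {S : Set (Fin m → ℂ)} (hS : S ⊆ Set.univ.pi fun _ => {z | ρ < ‖z‖}) {J K : ℕ}
    (hJ : ∀ z : ℂ, ρ < ‖z‖ → level R z ≤ J) (hK : K ≠ 0) :
    ∑' p : Fin m ↪ ℕ × ℕ, (boundedLabels m J K)ᶜ.indicator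
      (fun p => S.indicator (fun _ => (1 : ℝ≥0∞)) (fun i => labelled R x (p i))) p ≤
      ((((outerConfig R x).count (outside R (R + 1 / ((J : ℝ) + 2)))).descFactorial (m + 1) : ℝ≥0∞) +
        m * ((outerConfig R x).count (outside R (R + 1 / ((J : ℝ) + 2)))).descFactorial m) / K := by
  set A := outside R (R + 1 / ((J : ℝ) + 2)) with hA
  set N := (outerConfig R x).count A with hN
  have hK0 : (K : ℝ≥0∞) ≠ 0 := Nat.cast_ne_zero.2 hK
  have hSR : S ⊆ Set.univ.pi fun _ => Exterior R := fun y hy i hi => hρ.trans (hS hy i hi)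
  have hNm : (N.descFactorial (m + 1) : ℝ≥0∞) + m * N.descFactorial m =
      N * N.descFactorial m := by exact_mod_cast (mul_descFactorial_eq N m).symm
  rw [hNm]
  have hterm : ∀ p : Fin m ↪ ℕ × ℕ, (boundedLabels m J K)ᶜ.indicator
      (fun p => S.indicator (fun _ => (1 : ℝ≥0∞)) (fun i => labelled R x (p i))) p ≤
      (N : ℝ≥0∞) / K * S.indicator (fun _ => (1 : ℝ≥0∞)) (fun i => labelled R x (p i)) := by
    intro p
    by_cases hp : p ∈ boundedLabels m J K
    · rw [Set.indicator_of_notMem (show p ∉ (boundedLabels m J K)ᶜ from fun h => h hp)]; exact bot_le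
    · rw [Set.indicator_of_mem (show p ∈ (boundedLabels m J K)ᶜ from hp)]
      by_cases hpS : (fun i => labelled R x (p i)) ∈ S
      · rw [Set.indicator_of_mem hpS, mul_one]
        have hlev : ∀ i, (p i).1 ≤ J ∧ (p i).2 < N := by
          intro i
          have hi : ρ < ‖labelled R x (p i)‖ := hS hpS i (Set.mem_univ i)
          obtain ⟨k, hk⟩ := exists_isLabel_of_lt hR (hρ.trans hi)
          rw [hk.labelled_eq] at hi
          have h1 : (p i).1 ≤ J := hk.1.2 ▸ hJ _ hi
          exact ⟨h1, lt_count_of_isLabel hk h1⟩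
        have hKN : K ≤ N := by
          by_contra hc
          exact hp fun i => ⟨(hlev i).1, (hlev i).2.trans (not_le.1 hc)⟩
        rw [ENNReal.le_div_iff_mul_le (Or.inl hK0) (Or.inl (ENNReal.natCast_ne_top K)), one_mul]
        exact_mod_cast hKN
      · rw [Set.indicator_of_notMem hpS]; exact bot_le
  refine (ENNReal.tsum_le_tsum hterm).trans ?_
  rw [ENNReal.tsum_mul_left, tsum_labelled_eq hR x hSR, ENNReal.mul_div_right_comm]
  gcongr
  rw [hN, ← sum_embedding_prod_indicator_eq x (measurableSet_outside _ _)]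
  refine Finset.sum_le_sum fun f _ => ?_
  rw [prod_indicator_eq (fun _ => Subtype.val '' A) fun i => x (f i)]
  refine Set.indicator_le_indicator_of_subset ?_ (fun _ => zero_le_one) _
  intro y hy i hi
  exact ⟨⟨y i, hSR hy i hi⟩, lt_norm_of_level_le (hSR hy i hi) (hJ _ (hS hy i hi)), rfl⟩

end Labels

/-! ### Tightness of the labelled laws. -/

section LabelledLaw

variable {V : ℝ → ℝ} {χ R : ℝ}

/-- The law of the labelled particles. -/
def labelledLaw (V : ℝ → ℝ) (χ R : ℝ) (n : ℕ) : Measure (ℕ × ℕ → ℂ) :=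
  (coulombGas V χ n).map (labelled R)

theorem isProbabilityMeasure_labelledLaw (hV : IsCirclePotential V) (hχ : 0 < χ) (hR : 1 ≤ R)
    (hV_eq : ∀ r, R ≤ r → V r = Real.log r) (n : ℕ) :
    IsProbabilityMeasure (labelledLaw V χ R n) := by
  have := hV.isProbabilityMeasure_coulombGas hχ hR hV_eq n
  exact Measure.isProbabilityMeasure_map (measurable_labelled R n).aemeasurable

theorem labelledLaw_exists_lt_le (hV : IsCirclePotential V) (hχ : 0 < χ) (hR : 1 ≤ R)
    (hV_eq : ∀ r, R ≤ r → V r = Real.log r) (n : ℕ) {s : ℝ} (hs : R ≤ s) :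
    labelledLaw V χ R n {z | ∃ p, s < ‖z p‖} ≤ intensityB χ R (outside R s) := by
  classical
  have hm : MeasurableSet {z : ℕ × ℕ → ℂ | ∃ p, s < ‖z p‖} := by
    rw [Set.ofPred_exists]
    exact MeasurableSet.iUnion fun p => measurableSet_lt measurable_const (measurable_pi_apply p).norm
  have h := lintegral_descFactorial_count_le hV hχ hR hV_eq n 1 (measurableSet_outside R s)
  rw [pow_one] at h
  refine le_trans ?_ h
  rw [labelledLaw, Measure.map_apply (measurable_labelled R n) hm,
    ← lintegral_indicator_one (measurable_labelled R n hm)]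
  refine lintegral_mono fun x => ?_
  refine Set.indicator_le (f := 1) (g := fun x => (((outerConfig R x).count
    (outside R s)).descFactorial 1 : ℝ≥0∞)) (fun x hx => ?_) x
  obtain ⟨p, hp⟩ := hx
  obtain ⟨i, hi⟩ := exists_isLabel_of_lt (by linarith) (hs.trans_lt hp)
  rw [hi.labelled_eq] at hp
  rw [Nat.descFactorial_one, count_outerConfig x (measurableSet_outside R s)]
  have : 1 ≤ (Finset.univ.filter fun k => x k ∈ Subtype.val '' outside R s).card :=
    Finset.card_pos.2 ⟨i, by
      simp only [Finset.mem_filter, Finset.mem_univ, true_and]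
      exact ⟨⟨x i, hs.trans_lt hp⟩, hp, rfl⟩⟩
  simpa using this

/-- The probability that some point exceeds s is at most the intensity beyond s. One radius
therefore serves all coordinates, and a product of closed balls is compact. -/
theorem isTightMeasureSet_labelledLaw (hV : IsCirclePotential V) (hχ : 0 < χ) (hR : 1 ≤ R)
    (hV_eq : ∀ r, R ≤ r → V r = Real.log r) :
    IsTightMeasureSet (Set.range (labelledLaw V χ R)) := by
  rw [isTightMeasureSet_iff_exists_isCompact_measure_compl_le]
  intro ε hε
  obtain ⟨s, hs, hsR⟩ := (((tendsto_order.1 (tendsto_intensityB_outside hχ hR)).2 ε hε).and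
    (eventually_ge_atTop ⌈R⌉₊)).exists
  refine ⟨Set.univ.pi fun _ => Metric.closedBall 0 s,
    isCompact_univ_pi fun _ => isCompact_closedBall 0 _, ?_⟩
  rintro _ ⟨n, rfl⟩
  refine le_trans (measure_mono fun z hz => ?_) ((labelledLaw_exists_lt_le hV hχ hR hV_eq n
    (Nat.ceil_le.1 hsR)).trans hs.le)
  by_contra hc
  refine hz fun p _ => ?_
  rw [mem_closedBall_zero_iff]
  by_contra hp
  exact hc ⟨p, not_le.1 hp⟩

/-- Prokhorov's theorem gives the limit law. Only its portmanteau inequalities are kept, so the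
discontinuity of the labelling does no harm. -/
theorem exists_subseq_labelledLaw (hV : IsCirclePotential V) (hχ : 0 < χ) (hR : 1 ≤ R)
    (hV_eq : ∀ r, R ≤ r → V r = Real.log r) :
    ∃ φ : ℕ → ℕ, StrictMono φ ∧ ∃ Q : Measure (ℕ × ℕ → ℂ), IsProbabilityMeasure Q ∧
      (∀ G, IsOpen G → Q G ≤ liminf (fun k => labelledLaw V χ R (φ k) G) atTop) ∧
      (∀ F, IsClosed F → limsup (fun k => labelledLaw V χ R (φ k) F) atTop ≤ Q F) := by
  let μ : ℕ → ProbabilityMeasure (ℕ × ℕ → ℂ) := fun n =>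
    ⟨labelledLaw V χ R n, isProbabilityMeasure_labelledLaw hV hχ hR hV_eq n⟩
  have ht : IsTightMeasureSet {((ν : ProbabilityMeasure (ℕ × ℕ → ℂ)) : Measure (ℕ × ℕ → ℂ)) |
      ν ∈ Set.range μ} := by
    refine (isTightMeasureSet_labelledLaw hV hχ hR hV_eq).subset ?_
    rintro _ ⟨_, ⟨n, rfl⟩, rfl⟩
    exact ⟨n, rfl⟩
  have hc := isCompact_closure_of_isTightMeasureSet ht
  obtain ⟨Q, -, φ, hφ, hlim⟩ := hc.tendsto_subseq fun n => subset_closure (Set.mem_range_self n)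
  refine ⟨φ, hφ, Q, Q.2, fun G hG => ?_, fun F hF => ?_⟩
  · exact ProbabilityMeasure.le_liminf_measure_open_of_tendsto hlim hG
  · exact ProbabilityMeasure.limsup_measure_closed_le_of_tendsto hlim hF

/-- The set of labelled families whose particles with labels `p` are in `S`. -/
def labelledIn {R : ℝ} {m : ℕ} (S : Set (Fin m → Exterior R)) (p : Fin m ↪ ℕ × ℕ) :
    Set (ℕ × ℕ → ℂ) := {z | (fun i => z (p i)) ∈ valPi '' S}

theorem continuous_comp_label {m : ℕ} (p : Fin m ↪ ℕ × ℕ) :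
    Continuous fun (z : ℕ × ℕ → ℂ) i => z (p i) := continuous_pi fun i => continuous_apply (p i)

theorem measurableSet_labelledIn {m : ℕ} {S : Set (Fin m → Exterior R)} (hS : MeasurableSet S)
    (p : Fin m ↪ ℕ × ℕ) : MeasurableSet (labelledIn S p) :=
  (measurable_pi_lambda _ fun i => measurable_pi_apply (p i) :
    Measurable fun (z : ℕ × ℕ → ℂ) i => z (p i)) (measurableEmbedding_valPi.measurableSet_image.2 hS)

theorem isOpen_labelledIn {m : ℕ} {S : Set (Fin m → Exterior R)} (hS : IsOpen S)
    (p : Fin m ↪ ℕ × ℕ) : IsOpen (labelledIn S p) :=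
  (isOpenEmbedding_valPi.isOpenMap S hS).preimage (continuous_comp_label p)

/-- Compactness of S is needed: a closed subset of the exterior need not be closed in ℂ^m. -/
theorem isClosed_labelledIn {m : ℕ} {S : Set (Fin m → Exterior R)} (hS : IsCompact S)
    (p : Fin m ↪ ℕ × ℕ) : IsClosed (labelledIn S p) :=
  (hS.image continuous_valPi).isClosed.preimage (continuous_comp_label p)

theorem image_valPi_subset {m : ℕ} (S : Set (Fin m → Exterior R)) :
    valPi '' S ⊆ Set.univ.pi fun _ => Exterior R := by
  rintro _ ⟨x, -, rfl⟩ i -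
  exact (x i).2

theorem labelledLaw_labelledIn {n m : ℕ} {S : Set (Fin m → Exterior R)} (hS : MeasurableSet S)
    (p : Fin m ↪ ℕ × ℕ) :
    labelledLaw V χ R n (labelledIn S p) = ∫⁻ x, (valPi '' S).indicator (fun _ => (1 : ℝ≥0∞))
      (fun i => labelled R x (p i)) ∂(coulombGas V χ n) := by
  have hm := measurableSet_labelledIn hS p
  rw [labelledLaw, Measure.map_apply (measurable_labelled R n) hm,
    ← lintegral_indicator_one (measurable_labelled R n hm)]
  rfl

theorem measurable_indicator_labelled {n m : ℕ} {S : Set (Fin m → Exterior R)}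
    (hS : MeasurableSet S) (p : Fin m ↪ ℕ × ℕ) :
    Measurable fun x : Fin n → ℂ => (valPi '' S).indicator (fun _ => (1 : ℝ≥0∞))
      (fun i => labelled R x (p i)) :=
  (measurable_const.indicator (measurableEmbedding_valPi.measurableSet_image.2 hS)).comp
    (measurable_pi_lambda _ fun i => (measurable_pi_apply (p i)).comp (measurable_labelled R n))

theorem tsum_labelledLaw (hV : IsCirclePotential V) (hχ : 0 < χ) (hR : 1 ≤ R)
    (hV_eq : ∀ r, R ≤ r → V r = Real.log r) (n : ℕ) {m : ℕ} {S : Set (Fin m → Exterior R)}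
    (hS : MeasurableSet S) :
    ∑' p : Fin m ↪ ℕ × ℕ, labelledLaw V χ R n (labelledIn S p) = corrN V χ R n m S := by
  have : Countable (Fin m ↪ ℕ × ℕ) := (DFunLike.coe_injective (F := Fin m ↪ ℕ × ℕ)).countable
  simp_rw [labelledLaw_labelledIn hS]
  rw [← lintegral_tsum fun p => (measurable_indicator_labelled hS p).aemeasurable]
  simp_rw [tsum_labelled_eq (by linarith : 0 ≤ R) _ (image_valPi_subset S)]
  have hS2 : MeasurableSet (valPi '' S) := measurableEmbedding_valPi.measurableSet_image.2 hS
  have hmeas : ∀ f : Fin m ↪ Fin n, Measurable fun (x : Fin n → ℂ) i => x (f i) := fun f =>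
    measurable_pi_lambda _ fun i => measurable_pi_apply _
  rw [← sum_coulombGas_preimage hV hχ hR hV_eq n hS, lintegral_finsetSum]
  swap
  · exact fun f _ => (measurable_const.indicator hS2).comp (hmeas f)
  refine Finset.sum_congr rfl fun f _ => ?_
  exact lintegral_indicator_one (hmeas f hS2)

theorem tsum_compl_labelledLaw_le (hV : IsCirclePotential V) (hχ : 0 < χ) (hR : 1 ≤ R)
    (hV_eq : ∀ r, R ≤ r → V r = Real.log r) (n : ℕ) {m : ℕ} {ρ : ℝ} (hρ : R < ρ)
    {S : Set (Fin m → Exterior R)} (hS : MeasurableSet S)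
    (hSρ : S ⊆ Set.univ.pi fun _ => outside R ρ) {J K : ℕ}
    (hJ : ∀ z : ℂ, ρ < ‖z‖ → level R z ≤ J) (hK : K ≠ 0) :
    ∑' p : Fin m ↪ ℕ × ℕ, (boundedLabels m J K)ᶜ.indicator
        (fun p => labelledLaw V χ R n (labelledIn S p)) p ≤
      (intensityB χ R (outside R (R + 1 / ((J : ℝ) + 2))) ^ (m + 1) +
        m * intensityB χ R (outside R (R + 1 / ((J : ℝ) + 2))) ^ m) / K := by
  have : Countable (Fin m ↪ ℕ × ℕ) := (DFunLike.coe_injective (F := Fin m ↪ ℕ × ℕ)).countable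
  classical
  set A := outside R (R + 1 / ((J : ℝ) + 2)) with hA
  have hSρ' : valPi '' S ⊆ Set.univ.pi fun _ => {z | ρ < ‖z‖} := by
    rintro _ ⟨x, hx, rfl⟩ i hi
    exact hSρ hx i hi
  have hind : ∀ p : Fin m ↪ ℕ × ℕ, (boundedLabels m J K)ᶜ.indicator
      (fun p => labelledLaw V χ R n (labelledIn S p)) p =
      ∫⁻ x, (boundedLabels m J K)ᶜ.indicator (fun p => (valPi '' S).indicator
        (fun _ => (1 : ℝ≥0∞)) (fun i => labelled R x (p i))) p ∂(coulombGas V χ n) := by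
    intro p
    by_cases hp : p ∈ (boundedLabels m J K)ᶜ
    · simp only [Set.indicator_of_mem hp]
      exact labelledLaw_labelledIn hS p
    · simp only [Set.indicator_of_notMem hp, lintegral_zero]
  have hcount : Measurable fun x : Fin n → ℂ => (outerConfig R x).count A :=
    (PointConfig.measurable_count (measurableSet_outside _ _)).comp (measurable_outerConfig R n)
  have hdesc : ∀ k, Measurable fun x : Fin n → ℂ =>
      (((outerConfig R x).count A).descFactorial k : ℝ≥0∞) := fun k =>
    (measurable_of_countable fun N : ℕ => (N.descFactorial k : ℝ≥0∞)).comp hcount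
  simp_rw [hind]
  rw [← lintegral_tsum fun p => by
    by_cases hp : p ∈ (boundedLabels m J K)ᶜ
    · simp only [Set.indicator_of_mem hp]
      exact (measurable_indicator_labelled hS p).aemeasurable
    · simp only [Set.indicator_of_notMem hp]
      exact aemeasurable_const]
  refine (lintegral_mono fun x => tsum_labelled_le (by linarith) hρ x hSρ' hJ hK).trans ?_
  simp_rw [ENNReal.div_eq_inv_mul]
  have hK0 : (K : ℝ≥0∞)⁻¹ ≠ ∞ := ENNReal.inv_ne_top.2 (Nat.cast_ne_zero.2 hK)
  rw [lintegral_const_mul' _ _ hK0, lintegral_add_left (hdesc (m + 1)),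
    lintegral_const_mul' _ _ (ENNReal.natCast_ne_top m)]
  gcongr
  · exact lintegral_descFactorial_count_le hV hχ hR hV_eq n (m + 1) (measurableSet_outside _ _)
  · exact lintegral_descFactorial_count_le hV hχ hR hV_eq n m (measurableSet_outside _ _)

end LabelledLaw

theorem tsum_liminf_le {ι : Type*} (f : ℕ → ι → ℝ≥0∞) :
    ∑' i, liminf (fun k => f k i) atTop ≤ liminf (fun k => ∑' i, f k i) atTop := by
  let _ : MeasurableSpace ι := ⊤
  have : MeasurableSingletonClass ι := ⟨fun _ => trivial⟩
  simp_rw [← lintegral_count]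
  exact lintegral_liminf_le fun k => measurable_from_top

theorem limsup_add_le_add_limsup (u v : ℕ → ℝ≥0∞) :
    limsup (fun k => u k + v k) atTop ≤ limsup u atTop + limsup v atTop := by
  refine ENNReal.le_of_forall_pos_le_add fun ε hε hfin => ?_
  have hε2 : ((ε / 2 : NNReal) : ℝ≥0∞) ≠ 0 := by simpa using hε.ne'
  have hu := eventually_lt_of_limsup_lt (ENNReal.lt_add_right (ENNReal.add_lt_top.1 hfin).1.ne hε2)
  have hv := eventually_lt_of_limsup_lt (ENNReal.lt_add_right (ENNReal.add_lt_top.1 hfin).2.ne hε2)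
  refine limsup_le_of_le isCobounded_le_of_bot ?_
  filter_upwards [hu, hv] with k h1 h2
  refine (add_le_add h1.le h2.le).trans_eq ?_
  rw [add_add_add_comm, ← ENNReal.coe_add, add_halves]

theorem limsup_finsetSum_le {ι : Type*} (s : Finset ι) (f : ℕ → ι → ℝ≥0∞) :
    limsup (fun k => ∑ i ∈ s, f k i) atTop ≤ ∑ i ∈ s, limsup (fun k => f k i) atTop := by
  classical
  induction s using Finset.induction_on with
  | empty => simp
  | insert i s hi ih =>
    simp_rw [Finset.sum_insert hi]
    exact (limsup_add_le_add_limsup _ _).trans (by gcongr)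

/-! ### Correlations of the limit of the labelled laws. -/

section LimitCorrelations

variable {V : ℝ → ℝ} {χ R : ℝ}

/-- The factorial moment measure of the points of a random family that are outside the disk. -/
def familyCorr (Q : Measure (ℕ × ℕ → ℂ)) (R : ℝ) (m : ℕ) : Measure (Fin m → Exterior R) :=
  Measure.sum fun p : Fin m ↪ ℕ × ℕ => (Q.map fun z i => z (p i)).comap valPi

theorem familyCorr_apply (Q : Measure (ℕ × ℕ → ℂ)) {m : ℕ} {S : Set (Fin m → Exterior R)}
    (hS : MeasurableSet S) : familyCorr Q R m S = ∑' p : Fin m ↪ ℕ × ℕ, Q (labelledIn S p) := by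
  rw [familyCorr, Measure.sum_apply _ hS]
  refine tsum_congr fun p => ?_
  rw [measurableEmbedding_valPi.comap_apply, Measure.map_apply (continuous_comp_label p).measurable
    (measurableEmbedding_valPi.measurableSet_image.2 hS)]
  rfl

/-- The portmanteau inequality for each label, and Fatou's lemma for the sum over labels. -/
theorem familyCorr_le_of_isOpen (hV : IsCirclePotential V) (hχ : 0 < χ) (hR : 1 ≤ R)
    (hV_eq : ∀ r, R ≤ r → V r = Real.log r)
    (hV_gt : ∀ r, 1 < r → r < R → Real.log r < V r) {φ : ℕ → ℕ} (hφ : StrictMono φ)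
    {Q : Measure (ℕ × ℕ → ℂ)}
    (hQ : ∀ G, IsOpen G → Q G ≤ liminf (fun k => labelledLaw V χ R (φ k) G) atTop) {m : ℕ}
    {S : Set (Fin m → Exterior R)} (hS : IsOpen S)
    (hfin : (Measure.pi fun _ => intensityB χ R) S < ∞) :
    familyCorr Q R m S ≤ corrB χ R m S := by
  have hlim := (tendsto_corrN hV hχ hR hV_eq hV_gt hS.measurableSet hfin).comp hφ.tendsto_atTop
  rw [familyCorr_apply Q hS.measurableSet, ← hlim.liminf_eq]
  refine (ENNReal.tsum_le_tsum fun p => hQ _ (isOpen_labelledIn hS p)).trans ?_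
  refine (tsum_liminf_le _).trans_eq ?_
  congr 1
  exact funext fun k => tsum_labelledLaw hV hχ hR hV_eq (φ k) hS.measurableSet

theorem pi_intensityB_outside_lt_top (hχ : 0 < χ) (hR : 1 ≤ R) {ρ : ℝ} (hρ : R < ρ) (m : ℕ) :
    (Measure.pi fun _ => intensityB χ R) (Set.univ.pi fun _ : Fin m => outside R ρ) < ∞ := by
  rw [Measure.pi_pi]
  exact ENNReal.prod_lt_top fun _ _ => intensityB_lt_top hχ hR hρ

/-- Here mass must not escape to infinite labels. Up to c/K, uniformly in n, the correlation is
carried by the finitely many bounded labels, to which the portmanteau inequality for closed sets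
applies; then K tends to infinity. -/
theorem corrB_le_of_isCompact (hV : IsCirclePotential V) (hχ : 0 < χ) (hR : 1 ≤ R)
    (hV_eq : ∀ r, R ≤ r → V r = Real.log r)
    (hV_gt : ∀ r, 1 < r → r < R → Real.log r < V r) {φ : ℕ → ℕ} (hφ : StrictMono φ)
    {Q : Measure (ℕ × ℕ → ℂ)}
    (hQ : ∀ F, IsClosed F → limsup (fun k => labelledLaw V χ R (φ k) F) atTop ≤ Q F) {m : ℕ}
    {ρ : ℝ} (hρ : R < ρ) {S : Set (Fin m → Exterior R)} (hS : IsCompact S)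
    (hSρ : S ⊆ Set.univ.pi fun _ => outside R ρ) :
    corrB χ R m S ≤ familyCorr Q R m S := by
  have hSm := hS.isClosed.measurableSet
  have hfin := (measure_mono hSρ).trans_lt (pi_intensityB_outside_lt_top hχ hR hρ m)
  have hlim := (tendsto_corrN hV hχ hR hV_eq hV_gt hSm hfin).comp hφ.tendsto_atTop
  set J := ⌊1 / (ρ - R)⌋₊
  have hJ : ∀ z : ℂ, ρ < ‖z‖ → level R z ≤ J := fun z hz => level_le_of_lt_norm hρ hz
  set κ := intensityB χ R (outside R (R + 1 / ((J : ℝ) + 2)))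
  have hκ : κ < ∞ := intensityB_lt_top hχ hR (by
    have : (0 : ℝ) < 1 / ((J : ℝ) + 2) := by positivity
    linarith)
  set c := κ ^ (m + 1) + m * κ ^ m
  have hc : c ≠ ∞ := ENNReal.add_ne_top.2 ⟨ENNReal.pow_ne_top hκ.ne,
    ENNReal.mul_ne_top (ENNReal.natCast_ne_top m) (ENNReal.pow_ne_top hκ.ne)⟩
  have hbound : ∀ K : ℕ, K ≠ 0 → corrB χ R m S ≤ familyCorr Q R m S + c * (K : ℝ≥0∞)⁻¹ := by
    intro K hK
    set F := (finite_boundedLabels m J K).toFinset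
    have hsplit : ∀ n, corrN V χ R n m S ≤
        ∑ p ∈ F, labelledLaw V χ R n (labelledIn S p) + c * (K : ℝ≥0∞)⁻¹ := by
      intro n
      rw [← tsum_labelledLaw hV hχ hR hV_eq n hSm]
      have h1 : ∀ p : Fin m ↪ ℕ × ℕ, labelledLaw V χ R n (labelledIn S p) =
          (boundedLabels m J K).indicator (fun p => labelledLaw V χ R n (labelledIn S p)) p +
          (boundedLabels m J K)ᶜ.indicator (fun p => labelledLaw V χ R n (labelledIn S p)) p :=
        fun p => (Set.indicator_self_add_compl_apply (boundedLabels m J K)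
          (fun p => labelledLaw V χ R n (labelledIn S p)) p).symm
      rw [tsum_congr h1, ENNReal.tsum_add]
      refine add_le_add (le_of_eq ?_)
        (tsum_compl_labelledLaw_le hV hχ hR hV_eq n hρ hSm hSρ hJ hK)
      rw [tsum_eq_sum (s := F) fun p hp => Set.indicator_of_notMem (fun h => hp
        ((finite_boundedLabels m J K).mem_toFinset.2 h)) _]
      exact Finset.sum_congr rfl fun p hp => Set.indicator_of_mem
        ((finite_boundedLabels m J K).mem_toFinset.1 hp) _
    calc corrB χ R m S = limsup (fun k => corrN V χ R (φ k) m S) atTop := hlim.limsup_eq.symm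
      _ ≤ limsup (fun k => ∑ p ∈ F, labelledLaw V χ R (φ k) (labelledIn S p) +
          c * (K : ℝ≥0∞)⁻¹) atTop := limsup_le_limsup (Eventually.of_forall fun k => hsplit (φ k))
      _ ≤ limsup (fun k => ∑ p ∈ F, labelledLaw V χ R (φ k) (labelledIn S p)) atTop +
          limsup (fun _ : ℕ => c * (K : ℝ≥0∞)⁻¹) atTop := limsup_add_le_add_limsup _ _
      _ ≤ ∑ p ∈ F, Q (labelledIn S p) + c * (K : ℝ≥0∞)⁻¹ := by
        rw [limsup_const]
        gcongr
        exact (limsup_finsetSum_le _ _).trans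
          (Finset.sum_le_sum fun p _ => hQ _ (isClosed_labelledIn hS p))
      _ ≤ familyCorr Q R m S + c * (K : ℝ≥0∞)⁻¹ := by
        gcongr
        rw [familyCorr_apply Q hSm]
        exact ENNReal.sum_le_tsum F
  have hlim2 : Tendsto (fun K : ℕ => familyCorr Q R m S + c * (K : ℝ≥0∞)⁻¹) atTop
      (𝓝 (familyCorr Q R m S + c * 0)) :=
    tendsto_const_nhds.add (ENNReal.Tendsto.const_mul ENNReal.tendsto_inv_nat_nhds_zero
      (Or.inr hc))
  rw [mul_zero, add_zero] at hlim2
  exact ge_of_tendsto hlim2 ((eventually_ne_atTop 0).mono hbound)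

/-- The two one-sided bounds agree on open sets at positive distance from the disk. These form a
π-system that determines the measures on an exhausting sequence `W` of open sets of finite mass. -/
theorem familyCorr_eq_corrB (hV : IsCirclePotential V) (hχ : 0 < χ) (hR : 1 ≤ R)
    (hV_eq : ∀ r, R ≤ r → V r = Real.log r)
    (hV_gt : ∀ r, 1 < r → r < R → Real.log r < V r) {φ : ℕ → ℕ} (hφ : StrictMono φ)
    {Q : Measure (ℕ × ℕ → ℂ)}
    (hO : ∀ G, IsOpen G → Q G ≤ liminf (fun k => labelledLaw V χ R (φ k) G) atTop)
    (hC : ∀ F, IsClosed F → limsup (fun k => labelledLaw V χ R (φ k) F) atTop ≤ Q F) (m : ℕ) :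
    familyCorr Q R m = corrB χ R m := by
  have := isFiniteMeasureOnCompacts_intensityB hχ hR
  have hle := corrB_le hV hχ hR hV_eq hV_gt m
  have hfinC : IsFiniteMeasureOnCompacts (corrB χ R m) :=
    ⟨fun K hK => (hle K).trans_lt hK.measure_lt_top⟩
  let W : ℕ → Set (Fin m → Exterior R) := fun k =>
    Set.univ.pi fun _ => outside R (R + 1 / ((k : ℝ) + 1))
  have hpos : ∀ k : ℕ, R < R + 1 / ((k : ℝ) + 1) := fun k => by
    have : (0 : ℝ) < 1 / ((k : ℝ) + 1) := by positivity
    linarith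
  have hWo : ∀ k, IsOpen (W k) := fun k =>
    isOpen_set_pi Set.finite_univ fun _ _ => isOpen_outside _ _
  have key : ∀ (k : ℕ) (O : Set (Fin m → Exterior R)), IsOpen O → O ⊆ W k →
      familyCorr Q R m O = corrB χ R m O := by
    intro k O hOo hOW
    refine le_antisymm (familyCorr_le_of_isOpen hV hχ hR hV_eq hV_gt hφ hO hOo
      ((measure_mono hOW).trans_lt (pi_intensityB_outside_lt_top hχ hR (hpos k) m))) ?_
    -- Inner regularity on open sets is available because `corrB` is finite on compact sets.
    rw [hOo.measure_eq_iSup_isCompact]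
    refine iSup₂_le fun K hKO => iSup_le fun hK => ?_
    exact (corrB_le_of_isCompact hV hχ hR hV_eq hV_gt hφ hC (hpos k) hK (hKO.trans hOW)).trans
      (measure_mono hKO)
  have hcover : ⋃₀ Set.range W = Set.univ := by
    refine Set.eq_univ_of_forall fun x => ?_
    rw [Set.sUnion_range]
    have hx : ∀ᶠ k : ℕ in atTop, ∀ i, R + 1 / ((k : ℝ) + 1) < ‖(x i : ℂ)‖ := by
      rw [eventually_all]
      intro i
      have h := (tendsto_one_div_add_atTop_nhds_zero_nat (𝕜 := ℝ)).const_add R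
      rw [add_zero] at h
      exact h.eventually_lt_const (x i).2
    obtain ⟨k, hk⟩ := hx.exists
    exact Set.mem_iUnion.2 ⟨k, fun i _ => hk i⟩
  refine Measure.ext_of_generateFrom_of_cover (S := {O | IsOpen O}) (T := Set.range W)
    (BorelSpace.measurable_eq) (Set.countable_range W) isPiSystem_isOpen hcover ?_ ?_ ?_
  · rintro _ ⟨k, rfl⟩
    rw [key k _ (hWo k) subset_rfl]
    exact ((hle _).trans_lt (pi_intensityB_outside_lt_top hχ hR (hpos k) m)).ne
  · rintro _ ⟨k, rfl⟩ O hOo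
    exact key k _ (IsOpen.inter hOo (hWo k)) Set.inter_subset_right
  · rintro _ ⟨k, rfl⟩
    exact key k _ (hWo k) subset_rfl

end LimitCorrelations

theorem prod_tsum_eq_tsum_prod {α : Type*} {m : ℕ} (f : Fin m → α → ℝ≥0∞) :
    ∏ i, ∑' a, f i a = ∑' g : Fin m → α, ∏ i, f i (g i) := by
  induction m with
  | zero => simp
  | succ m ih =>
    rw [Fin.prod_univ_succ, ih, ← (Fin.consEquiv fun _ => α).tsum_eq]
    simp_rw [Fin.prod_univ_succ]
    change _ = ∑' c : α × (Fin m → α), f 0 c.1 * ∏ i, f i.succ (c.2 i)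
    rw [ENNReal.tsum_prod (f := fun a (g : Fin m → α) => f 0 a * ∏ i, f i.succ (g i)),
      ← ENNReal.tsum_mul_right]
    refine tsum_congr fun a => ?_
    rw [← ENNReal.tsum_mul_left]

/-- A configuration is simple if and only if in each window some mesh leaves at most one point in
every cell; this involves only countably many counts. -/
theorem PointConfig.measurableSet_setOf_singleton_le_one {X : Type*} [MetricSpace X]
    [SecondCountableTopology X] [Nonempty X] [MeasurableSpace X] [BorelSpace X]
    [LocallyCompactSpace X] :
    MeasurableSet {ξ : PointConfig X | ∀ x, ξ.toMeasure {x} ≤ 1} := by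
  have l : CompactExhaustion X := default
  have : {ξ : PointConfig X | ∀ x, ξ.toMeasure {x} ≤ 1} =
      ⋂ i : ℕ, ⋃ k : ℕ, ⋂ j : ℕ, {ξ | ξ.count (cell l i k j) ≤ 1} := by
    ext ξ
    simp only [Set.mem_iInter, Set.mem_iUnion]
    refine ⟨fun h i => (eventually_count_cell_le_one h l i).exists, fun h x => ?_⟩
    obtain ⟨i, hi⟩ := Set.mem_iUnion.1 (l.iUnion_eq ▸ Set.mem_univ x)
    obtain ⟨k, hk⟩ := h i
    have hx : x ∈ cell l i k (cellIndex k x) := ⟨hi, rfl⟩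
    refine (measure_mono (Set.singleton_subset_iff.2 hx)).trans ?_
    rw [← coe_count_cell]
    exact_mod_cast hk (cellIndex k x)
  rw [this]
  exact MeasurableSet.iInter fun i => MeasurableSet.iUnion fun k => MeasurableSet.iInter fun j =>
    measurable_count (measurableSet_cell l i k j) measurableSet_Iic

theorem exists_subset_outside {R : ℝ} {K : Set (Exterior R)} (hK : IsCompact K) :
    ∃ k : ℕ, K ⊆ outside R (R + 1 / ((k : ℝ) + 1)) := by
  refine (hK.elim_directed_cover (fun k : ℕ => outside R (R + 1 / ((k : ℝ) + 1)))
    (fun k => isOpen_outside _ _) (fun x _ => ?_) (directed_of_isDirected_le fun i j hij x hx => ?_))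
  · have h := (tendsto_one_div_add_atTop_nhds_zero_nat (𝕜 := ℝ)).const_add R
    rw [add_zero] at h
    obtain ⟨k, hk⟩ := (h.eventually_lt_const (show R < ‖(x : ℂ)‖ from x.2)).exists
    exact Set.mem_iUnion.2 ⟨k, hk⟩
  · refine lt_of_le_of_lt ?_ (show R + 1 / ((i : ℝ) + 1) < ‖(x : ℂ)‖ from hx)
    gcongr

/-! ### The configuration of the points of a labelled family. -/

section FamilyConfig

variable {R : ℝ}

/-- The counting measure of the points of a family that are outside the disk. -/
def familyMeasure (R : ℝ) (z : ℕ × ℕ → ℂ) : Measure (Exterior R) :=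
  Measure.sum fun p => (Measure.dirac (z p)).comap Subtype.val

theorem familyMeasure_apply (z : ℕ × ℕ → ℂ) {A : Set (Exterior R)} (hA : MeasurableSet A) :
    familyMeasure R z A = ∑' p, (Subtype.val '' A).indicator (fun _ => (1 : ℝ≥0∞)) (z p) := by
  have hme := MeasurableEmbedding.subtype_coe (measurableSet_exterior R)
  rw [familyMeasure, Measure.sum_apply _ hA]
  refine tsum_congr fun p => ?_
  rw [hme.comap_apply, Measure.dirac_apply' _ (hme.measurableSet_image.2 hA)]
  rfl

theorem familyMeasure_eq_encard (z : ℕ × ℕ → ℂ) {A : Set (Exterior R)} (hA : MeasurableSet A) :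
    familyMeasure R z A = ({p | z p ∈ Subtype.val '' A}.encard : ℝ≥0∞) := by
  rw [familyMeasure_apply z hA, ← ENNReal.tsum_set_one, tsum_subtype _ fun _ => (1 : ℝ≥0∞)]
  rfl

theorem measurable_familyMeasure_apply {A : Set (Exterior R)} (hA : MeasurableSet A) :
    Measurable fun z => familyMeasure R z A := by
  have hme := MeasurableEmbedding.subtype_coe (measurableSet_exterior R)
  simp_rw [familyMeasure_apply _ hA]
  exact Measurable.tsum fun p =>
    (measurable_const.indicator (hme.measurableSet_image.2 hA)).comp (measurable_pi_apply p)

/-- The family has finitely many points at positive distance of the disk. -/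
def LocallyFiniteFamily (R : ℝ) (z : ℕ × ℕ → ℂ) : Prop :=
  ∀ k : ℕ, familyMeasure R z (outside R (R + 1 / ((k : ℝ) + 1))) < ∞

theorem measurableSet_locallyFiniteFamily (R : ℝ) :
    MeasurableSet {z | LocallyFiniteFamily R z} := by
  have : {z | LocallyFiniteFamily R z} =
      ⋂ k : ℕ, {z | familyMeasure R z (outside R (R + 1 / ((k : ℝ) + 1))) < ∞} := by
    ext z
    simp [LocallyFiniteFamily]
  rw [this]
  exact MeasurableSet.iInter fun k => measurableSet_lt
    (measurable_familyMeasure_apply (measurableSet_outside _ _)) measurable_const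

open Classical in
/-- The configuration of the points of a family that are outside the disk, empty if it is not
locally finite. -/
def familyConfig (R : ℝ) (z : ℕ × ℕ → ℂ) : PointConfig (Exterior R) where
  toMeasure := if LocallyFiniteFamily R z then familyMeasure R z else 0
  finite_of_isCompact K hK := by
    split_ifs with h
    · obtain ⟨k, hk⟩ := exists_subset_outside hK
      exact (measure_mono hk).trans_lt (h k)
    · simp
  integer_valued s hs := by
    split_ifs with h
    · exact ⟨_, familyMeasure_eq_encard z hs⟩
    · exact ⟨0, by simp⟩

theorem toMeasure_familyConfig {z : ℕ × ℕ → ℂ} (h : LocallyFiniteFamily R z) :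
    (familyConfig R z).toMeasure = familyMeasure R z := if_pos h

theorem measurable_familyConfig (R : ℝ) : Measurable (familyConfig R) := by
  classical
  refine PointConfig.measurable_of_measurable_apply fun A hA => ?_
  have : (fun z => (familyConfig R z).toMeasure A) = fun z =>
      if LocallyFiniteFamily R z then familyMeasure R z A else 0 := by
    funext z
    simp only [familyConfig]
    split_ifs <;> simp
  rw [this]
  exact Measurable.ite (measurableSet_locallyFiniteFamily R) (measurable_familyMeasure_apply hA)
    measurable_const

/-- A product of counts expands over all tuples of labels; as the sets are disjoint, a tuple that
repeats a label contributes zero. -/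
theorem lintegral_prod_familyMeasure (Q : Measure (ℕ × ℕ → ℂ)) {m : ℕ}
    {A : Fin m → Set (Exterior R)} (hA : ∀ i, MeasurableSet (A i))
    (hd : Pairwise (Function.onFun Disjoint A)) :
    ∫⁻ z, ∏ i, familyMeasure R z (A i) ∂Q = familyCorr Q R m (Set.univ.pi A) := by
  have : Countable (Fin m ↪ ℕ × ℕ) := (DFunLike.coe_injective (F := Fin m ↪ ℕ × ℕ)).countable
  have hpi : MeasurableSet (Set.univ.pi A) := MeasurableSet.univ_pi hA
  have key : ∀ z : ℕ × ℕ → ℂ, ∏ i, familyMeasure R z (A i) =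
      ∑' p : Fin m ↪ ℕ × ℕ, (labelledIn (Set.univ.pi A) p).indicator 1 z := by
    intro z
    have h1 : ∀ f : Fin m → ℕ × ℕ,
        ∏ i, (Subtype.val '' A i).indicator (fun _ => (1 : ℝ≥0∞)) (z (f i)) =
        (valPi '' Set.univ.pi A).indicator (fun _ => (1 : ℝ≥0∞)) (fun i => z (f i)) := by
      intro f
      rw [image_valPi_univ_pi]
      exact prod_indicator_eq (fun i => Subtype.val '' A i) fun i => z (f i)
    simp_rw [familyMeasure_apply z (hA _)]
    rw [prod_tsum_eq_tsum_prod]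
    simp_rw [h1]
    symm
    refine (DFunLike.coe_injective (F := Fin m ↪ ℕ × ℕ)).tsum_eq (f := fun f : Fin m → ℕ × ℕ =>
      (valPi '' Set.univ.pi A).indicator (fun _ => (1 : ℝ≥0∞)) (fun i => z (f i))) ?_
    intro f hf
    have hmem : (fun i => z (f i)) ∈ valPi '' Set.univ.pi A := by
      by_contra hc
      exact hf (Set.indicator_of_notMem hc _)
    rw [image_valPi_univ_pi] at hmem
    refine ⟨⟨f, fun i j hij => ?_⟩, rfl⟩
    by_contra hne
    obtain ⟨a, ha, hav⟩ := hmem i (Set.mem_univ i)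
    obtain ⟨b, hb, hbv⟩ := hmem j (Set.mem_univ j)
    have hab : a = b := Subtype.ext (hav.trans ((congrArg z hij).trans hbv.symm))
    exact Set.disjoint_left.1 (hd hne) ha (hab ▸ hb)
  simp_rw [key]
  rw [lintegral_tsum fun p => (measurable_one.indicator
    (measurableSet_labelledIn hpi p)).aemeasurable, familyCorr_apply Q hpi]
  exact tsum_congr fun p => lintegral_indicator_one (measurableSet_labelledIn hpi p)

end FamilyConfig

/-! ### Existence of the limiting determinantal process. -/

section Existence

variable {V : ℝ → ℝ} {χ R : ℝ}

theorem ae_locallyFiniteFamily {Q : Measure (ℕ × ℕ → ℂ)} (hχ : 0 < χ) (hR : 1 ≤ R)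
    (hQ : familyCorr Q R 1 ≤ Measure.pi fun _ => intensityB χ R) :
    ∀ᵐ z ∂Q, LocallyFiniteFamily R z := by
  refine ae_all_iff.2 fun k => ?_
  have hA := measurableSet_outside R (R + 1 / ((k : ℝ) + 1))
  have h := lintegral_prod_familyMeasure Q (A := fun _ : Fin 1 => _) (fun _ => hA)
    (fun i j hij => absurd (Subsingleton.elim i j) hij)
  simp only [Finset.univ_unique, Finset.prod_const, Finset.card_singleton, pow_one] at h
  refine ae_lt_top (measurable_familyMeasure_apply hA) ?_
  rw [h]
  refine ((hQ _).trans_lt (pi_intensityB_outside_lt_top hχ hR ?_ 1)).ne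
  have : (0 : ℝ) < 1 / ((k : ℝ) + 1) := by positivity
  linarith

/-- On the diagonal the determinant has two equal rows; this repulsion is the source of simplicity.
-/
theorem corrB_two_diagonal (χ R : ℝ) : corrB χ R 2 {x | x 0 = x 1} = 0 := by
  have hm : MeasurableSet {x : Fin 2 → Exterior R | x 0 = x 1} :=
    measurableSet_eq_fun (measurable_pi_apply 0) (measurable_pi_apply 1)
  rw [corrB, withDensity_apply _ hm]
  refine (setLIntegral_congr_fun hm fun x hx => ?_).trans lintegral_zero
  have hx' : x 0 = x 1 := hx
  have : (Matrix.of fun i j => kernelB χ R (x i) (x j)).det = 0 := by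
    refine Matrix.det_zero_of_row_eq (i := 0) (j := 1) (by decide) ?_
    funext j
    simp [hx']
  simp [this]

/-- A multiple point would give two distinct labels the same value outside the disk. There are
countably many pairs of labels, and each does so with probability zero. -/
theorem ae_familyConfig_singleton_le_one {Q : Measure (ℕ × ℕ → ℂ)}
    (hQ : familyCorr Q R 2 {x | x 0 = x 1} = 0) :
    ∀ᵐ z ∂Q, ∀ x, (familyConfig R z).toMeasure {x} ≤ 1 := by
  classical
  have : Countable (Fin 2 ↪ ℕ × ℕ) := (DFunLike.coe_injective (F := Fin 2 ↪ ℕ × ℕ)).countable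
  have hm : MeasurableSet {x : Fin 2 → Exterior R | x 0 = x 1} :=
    measurableSet_eq_fun (measurable_pi_apply 0) (measurable_pi_apply 1)
  rw [familyCorr_apply Q hm, ENNReal.tsum_eq_zero] at hQ
  have hae : ∀ᵐ z ∂Q, ∀ p : Fin 2 ↪ ℕ × ℕ,
      z ∉ labelledIn {x : Fin 2 → Exterior R | x 0 = x 1} p :=
    ae_all_iff.2 fun p => measure_eq_zero_iff_ae_notMem.1 (hQ p)
  filter_upwards [hae] with z hz x
  by_cases h : LocallyFiniteFamily R z
  · rw [toMeasure_familyConfig h, familyMeasure_eq_encard z (measurableSet_singleton x)]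
    have hsub : {p | z p ∈ Subtype.val '' ({x} : Set (Exterior R))}.encard ≤ 1 := by
      refine Set.encard_le_one_iff.2 fun p q hp hq => ?_
      by_contra hne
      obtain ⟨a, ha, hap⟩ := hp
      obtain ⟨b, hb, hbq⟩ := hq
      rw [Set.mem_singleton_iff] at ha hb
      rw [hb, ← ha] at hbq
      refine hz ⟨![p, q], ?_⟩ ⟨fun _ => a, rfl, ?_⟩
      · intro i j hij
        fin_cases i <;> fin_cases j <;> simp_all
      · funext i
        fin_cases i
        · exact hap
        · exact hbq
    exact_mod_cast hsub
  · simp [familyConfig, h]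

theorem exists_isDeterminantal (hV : IsCirclePotential V) (hχ : 0 < χ) (hR : 1 ≤ R)
    (hV_eq : ∀ r, R ≤ r → V r = Real.log r)
    (hV_gt : ∀ r, 1 < r → r < R → Real.log r < V r) :
    ∃ B : Measure (PointConfig (Exterior R)), IsProbabilityMeasure B ∧
      IsDeterminantal B (lebesgueExterior R) (kernelB χ R) := by
  obtain ⟨φ, hφ, Q, hQ, hO, hC⟩ := exists_subseq_labelledLaw hV hχ hR hV_eq
  have hcorr := familyCorr_eq_corrB hV hχ hR hV_eq hV_gt hφ hO hC
  have hmeas := measurable_familyConfig R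
  refine ⟨Q.map (familyConfig R), Measure.isProbabilityMeasure_map hmeas.aemeasurable,
    measurable_kernelB hV hχ hR hV_eq hV_gt, ?_,
    fun m => Eventually.of_forall fun x => det_kernelB_nonneg hV hχ hR hV_eq hV_gt x,
    fun m A hA hd => ?_⟩
  · have hm := PointConfig.measurableSet_setOf_singleton_le_one (X := Exterior R)
    rw [ae_map_iff hmeas.aemeasurable hm]
    refine ae_familyConfig_singleton_le_one ?_
    rw [hcorr 2, corrB_two_diagonal]
  · rw [lintegral_map (Finset.measurable_prod _ fun i _ => PointConfig.measurable_apply (hA i)) hmeas,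
      ← withDensity_apply _ (MeasurableSet.univ_pi hA)]
    change _ = corrB χ R m _
    rw [← hcorr m, ← lintegral_prod_familyMeasure Q hA hd]
    refine lintegral_congr_ae ?_
    filter_upwards [ae_locallyFiniteFamily hχ hR
      ((hcorr 1).trans_le (corrB_le hV hχ hR hV_eq hV_gt 1))] with z hz
    rw [toMeasure_familyConfig hz]

end Existence

end

/-- Very weak confinement. -/
theorem mainTheorem3 (χ : ℝ) (hχ : 0 < χ) (V : ℝ → ℝ) (hV : IsCirclePotential V)
    (R : ℝ) (hR : 1 ≤ R) (hV_eq : ∀ r, R ≤ r → V r = Real.log r)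
    (hV_gt : ∀ r, 1 < r → r < R → Real.log r < V r) :
    -- the laws of the particles and the limiting determinantal process exist
    ∃ _ : ∀ n, IsProbabilityMeasure (coulombGas V χ n),
      (∃ B : Measure (PointConfig (Exterior R)), IsProbabilityMeasure B ∧
        IsDeterminantal B (lebesgueExterior R) (kernelB χ R)) ∧
      (∀ (B : Measure (PointConfig (Exterior R))) [IsProbabilityMeasure B],
        IsDeterminantal B (lebesgueExterior R) (kernelB χ R) →
          -- the particles outside the disk converge in law to the determinantal process
          TendstoInDistribution (fun (n : ℕ) (x : Fin n → ℂ) => outerConfig R x) atTop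
            (fun ξ => ξ) (fun n => coulombGas V χ n) B ∧
          -- the limiting process has a point of maximal modulus
          (∀ᵐ ξ ∂B, IsGreatest (moduli ξ) (sSup (moduli ξ))) ∧
          -- the maximal modulus converges in law to the maximum of the limiting process
          TendstoInDistribution (fun (n : ℕ) (x : Fin n → ℂ) => maxModulus x) atTop
            (fun ξ => sSup (moduli ξ)) (fun n => coulombGas V χ n) B) ∧
      (∀ t : ℝ, R ≤ t →
        Multipliable (fun k : ℕ => 1 - (R / t) ^ (2 * (k : ℝ) + 2 * χ)) ∧
        Tendsto (fun n : ℕ => (coulombGas V χ n).real {x | maxModulus x ≤ t}) atTop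
          (𝓝 (∏' k : ℕ, (1 - (R / t) ^ (2 * (k : ℝ) + 2 * χ))))) := by
  have hP := hV.isProbabilityMeasure_coulombGas hχ hR hV_eq
  refine ⟨hP, exists_isDeterminantal hV hχ hR hV_eq hV_gt, fun B _ hB =>
    ⟨tendstoInDistribution_outerConfig hV hχ hR hV_eq hV_gt hB,
      ae_isGreatest_moduli hV hχ hR hV_eq hV_gt hB,
      tendstoInDistribution_maxModulus hV hχ hR hV_eq hV_gt hB⟩,
    fun t ht => ⟨multipliable_one_sub_rpow χ hR ht, ?_⟩⟩
  simp_rw [setOf_maxModulus_le (by linarith : 0 ≤ t)]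
  exact tendsto_coulombGas_forall_norm_le hV hχ hR hV_eq hV_gt ht
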